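/- **Language.** Consider the session-typed language PRast. Session types are $\oplus\{\ell:A_\ell\}_{\ell\in L}$, $\&\{\ell:A_\ell\}_{\ell\in L}$, $A\otimes B$, $A\multimap B$, $\mathbf 1$, type identifiers $V$, $\triangleright^r A$, $\triangleleft^r A$ (sending/receiving $r$ units of potential) and the probabilistic choices $\oplus_{\mathrm P}\{\ell^{p_\ell}:A_\ell\}_{\ell\in L}$, $\&_{\mathrm P}\{\ell^{p_\ell}:A_\ell\}_{\ell\in L}$ with $\sum_\ell p_\ell=1$; $L$ is a finite set of labels and all annotations are nonnegative rationals. Type definitions are contractive, and types are identified when they have the same infinite unfolding. Processes are built from sending/receiving labels, channels, potential and close messages, forwarding, spawning of defined processes, $\mathsf{work}\{r\}$, $\mathsf{flip}\ p\,(P_H\mid P_T)$, and sending/receiving on probabilistic choices. The judgment $\Delta\vdash^q P::(x:A)$ (process $P$ with potential $q\ge 0$ provides $x:A$ and uses $\Delta$ linearly) has the usual rules of intuitionistic linear session types with amortized potential, where $\mathsf{work}\{r\}$ consumes $r$ units of potential and potential may be thrown away. In a flip, or a receive on a probabilistic choice, potentials are averaged with the branch probabilities, the type of the provided channel is a weighted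 sum $\sum^{\mathrm R}$ of the types in the branches (the outermost probabilities of $\oplus_{\mathrm P}$ are averaged, all other types coincide), and the types of the used channels are a weighted sum $\sum^{\mathrm L}$ (the outermost probabilities of $\&_{\mathrm P}$ are averaged, all other types coincide); in a receive, the received channel itself continues with $A_\ell$ in branch $\ell$. A probabilistic send of $k$ requires $p_k=1$. Fix a signature in which every process definition is well typed. **Nested configurations.** A configuration is $\mathcal C=\mathcal O_1\parallel\dots\parallel\mathcal O_n$, clients to the left of providers, where an object is $\mathrm{proc}(c,(w,P))$ (a process providing $c$ that has performed work $w\ge 0$) or $\mathrm{proc}(c,\{\mathcal C_i:p_i\}_{i\in I})$ (a finite distribution on configurations that provide $c$). The judgment $\Delta\models^q\mathcal C::\Gamma$ is given by: $\Delta\models^{q+w}\mathrm{proc}(c,(w,P))::(c:A)$ if $\Delta\vdash^q P::(c:A)$; $\Delta\models^{q}\mathrm{proc}(c,\{\mathcal C_i:p_i\})::(c:A)$ if $\Delta_i\models^{q_i}\mathcal C_i::(c:A_i)$ for all $i$, $\Delta=\sum^{\mathrm L}p_i\Delta_i$, $A=\sum^{\mathrm R}p_iA_i$, $q=\sum p_iq_i$;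 and $\Delta_1,\Delta_2\models^{q_1+q_2}(\mathcal O\parallel\mathcal C)::(\Gamma,(c:A))$ if $\Delta_1,\Delta'\models^{q_1}\mathcal O::(c:A)$ and $\Delta_2\models^{q_2}\mathcal C::(\Gamma,\Delta')$, all composed channels (also those internal to distribution objects) being distinct. In the nested-multiverse semantics, a flip turns its process into a local distribution object, work and spawning are local steps (possibly inside one branch of a distribution), and two communicating objects synchronize; when distribution objects communicate along $d$, they are first decomposed: a process and a distribution into the distribution of the compositions, two distributions into their product for deterministic communication, and only the receiving distribution into its branches for probabilistic communication. $\mathcal C$ is *poised* if every process in it communicates along the channel it provides. An *execution* from $\mathcal C$ is a sequence $\mathcal C_0=\mathcal C,\mathcal C_1,\dots$ in which each $\mathcal C_n$ either makes a step to $\mathcal C_{n+1}$, or is poised and $\mathcal C_{n+1}=\mathcal C_n$. **Flattening.** A non-nested configuration is a finite multiset $\mathcal D$ of processes $\mathrm{proc}(c_i,(w_i,P_i))$, with $\mathrm{work}(\mathcal D)=\sum_i w_i$. The relation $\mathcal C\approx\mu$ ($\mu$ a distribution on non-nested configurations) is given by $\mathrm{proc}(c,(w,P))\approx\delta_{\mathrm{proc}(c,(w,P))}$;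 $\mathrm{proc}(c,\{\mathcal C_i:p_i\})\approx\sum_ip_i\mu_i$ if $\mathcal C_i\approx\mu_i$ for all $i$; and $(\mathcal O\parallel\mathcal C)\approx$ the law of $\mathcal D_1\parallel\mathcal D_2$ under $\mu_1\otimes\mu_2$ if $\mathcal O\approx\mu_1$, $\mathcal C\approx\mu_2$. Non-nested configurations have the ordinary synchronous semantics: $\mathcal D$ steps to a Dirac distribution by a deterministic local or communication step, or to $p\,\delta_{\mathcal D_H}+(1-p)\,\delta_{\mathcal D_T}$ by a flip. **Theorem.** Suppose $(\cdot)\models^q\mathcal C::\Gamma$. Then there is an execution from $\mathcal C$. For every execution $\{\mathcal C_n\}_{n\in\mathbb N}$ from $\mathcal C$ there is a (possibly time-inhomogeneous) Markov chain $\{\mathcal D_n\}_{n\in\mathbb N}$ of non-nested configurations, on some probability space, each of whose transition laws from a state $\mathcal D$ is a mixture of $\delta_{\mathcal D}$ and of distributions to which $\mathcal D$ steps, such that 1. for each $n$, $(\cdot)\models^q\mathcal C_n::\Gamma$ and $\mathcal C_n\approx\mu_n$, where $\mu_n$ is the law of $\mathcal D_n$; 2. for each $n$, $\mathbb E[\mathrm{work}(\mathcal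 D_n)]\le q$. Moreover, the expected total work $\mathrm{etw}:=\lim_{n\to\infty}\mathbb E[\mathrm{work}(\mathcal D_n)]$ of such a chain exists, and $\mathrm{etw}\le q$. -/

import Mathlib

open scoped NNReal ENNReal

namespace PRast

/-! ### Names and finite probability distributions -/

/-- Channels (which are also the session variables). -/
abbrev Chan := ℕ
/-- Labels of choices. -/
abbrev Label := ℕ
/-- Type identifiers. -/
abbrev TyName := ℕ
/-- Names of defined processes. -/
abbrev PName := ℕ

/-- A probability distribution with rational weights on a finite index type. -/
structure FinDist (ι : Type) [Fintype ι] where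
  w : ι → ℚ≥0
  sum_eq : ∑ i, w i = 1

namespace FinDist

/-- The distribution `{0 : p, 1 : 1 - p}`. -/
def coin (p : ℚ≥0) (hp : p ≤ 1) : FinDist (Fin 2) where
  w := ![p, 1 - p]
  sum_eq := by simp [Fin.sum_univ_two, add_tsub_cancel_of_le hp]

/-- The product distribution, with pairs of indices coded by `finProdFinEquiv`. -/
def prod {n m : ℕ} (p : FinDist (Fin n)) (p' : FinDist (Fin m)) : FinDist (Fin (n * m)) where
  w k := p.w (finProdFinEquiv.symm k).1 * p'.w (finProdFinEquiv.symm k).2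
  sum_eq := by
    rw [finProdFinEquiv.symm.sum_comp (fun x : Fin n × Fin m => p.w x.1 * p'.w x.2),
      Fintype.sum_prod_type]
    simp [← Finset.mul_sum, p.sum_eq, p'.sum_eq]

/-- The associated probability mass function. -/
noncomputable def toPMF {ι : Type} [Fintype ι] (p : FinDist ι) : PMF ι :=
  PMF.ofFintype (fun i => (((p.w i : ℚ≥0) : ℝ≥0) : ℝ≥0∞)) (by
    have h := congrArg (fun q : ℚ≥0 => (((q : ℚ≥0) : ℝ≥0) : ℝ≥0∞)) p.sum_eq
    simpa [NNRat.cast_sum] using h)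

end FinDist

/-! ### Session types -/

/-- Session types. Label sets are finite sets of labels; the probabilities of a probabilistic
choice sum up to one by construction. -/
inductive Ty : Type
  /-- internal choice `⊕{ℓ : A_ℓ}` -/
  | ichoice (L : Finset Label) (A : {ℓ // ℓ ∈ L} → Ty)
  /-- external choice `&{ℓ : A_ℓ}` -/
  | echoice (L : Finset Label) (A : {ℓ // ℓ ∈ L} → Ty)
  /-- `A ⊗ B` -/
  | tensor (A B : Ty)
  /-- `A ⊸ B` -/
  | lolli (A B : Ty)
  /-- `1` -/
  | one
  /-- a type identifier -/
  | name (V : TyName)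
  /-- `▷^r A`: the provider pays `r` units of potential -/
  | payPot (r : ℚ≥0) (A : Ty)
  /-- `◁^r A`: the provider receives `r` units of potential -/
  | getPot (r : ℚ≥0) (A : Ty)
  /-- probabilistic internal choice `⊕_P{ℓ^{p_ℓ} : A_ℓ}` -/
  | pichoice (L : Finset Label) (p : FinDist {ℓ // ℓ ∈ L}) (A : {ℓ // ℓ ∈ L} → Ty)
  /-- probabilistic external choice `&_P{ℓ^{p_ℓ} : A_ℓ}` -/
  | pechoice (L : Finset Label) (p : FinDist {ℓ // ℓ ∈ L}) (A : {ℓ // ℓ ∈ L} → Ty)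

/-- Contexts: partial maps from channels to types. -/
abbrev Ctx := Chan → Option Ty

namespace Ctx

/-- The empty context. -/
def empty : Ctx := fun _ => none
/-- The context `x : A`. -/
def single (x : Chan) (A : Ty) : Ctx := fun y => if y = x then some A else none
/-- `Δ` with `x` mapped to `A`; it stands for `Δ, (x : A)`. -/
def set (Δ : Ctx) (x : Chan) (A : Ty) : Ctx := fun y => if y = x then some A else Δ y
/-- `Δ` without the channel `x`. -/
def erase (Δ : Ctx) (x : Chan) : Ctx := fun y => if y = x then none else Δ y
/-- The two contexts have no channel in common. -/
def Disj (Δ Δ' : Ctx) : Prop := ∀ x, Δ x = none ∨ Δ' x = none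
/-- The context `Δ, Δ'` (used for contexts without common channels). -/
def join (Δ Δ' : Ctx) : Ctx := fun x => (Δ x).or (Δ' x)
/-- The context given by a list of declarations. -/
def ofList (l : List (Chan × Ty)) : Ctx := fun x => l.lookup x

end Ctx

/-! ### Process expressions

Variables bound by an input or by a spawn are de Bruijn indices; free variables are channels. -/

/-- Occurrences of variables: channels or bound variables. -/
inductive Name : Type
  | chan (c : Chan)
  | bvar (k : ℕ)

namespace Name

/-- Replace the bound variable `k` by the channel `e`. -/
def inst (k : ℕ) (e : Chan) : Name → Name
  | chan c => chan c
  | bvar j => if j = k then chan e else bvar j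

/-- Rename the channels. -/
def rename (ρ : Chan → Chan) : Name → Name
  | chan c => chan (ρ c)
  | bvar j => bvar j

/-- The channel of an occurrence, if it is one. -/
def chans : Name → Set Chan
  | chan c => {c}
  | bvar _ => ∅

end Name

inductive Proc : Type
  /-- `x.k ; P` -/
  | sendL (x : Name) (k : Label) (P : Proc)
  /-- `case x (ℓ ⇒ P_ℓ)_{ℓ ∈ L}` -/
  | caseL (x : Name) (L : Finset Label) (P : {ℓ // ℓ ∈ L} → Proc)
  /-- `send x y ; P` -/
  | sendC (x y : Name) (P : Proc)
  /-- `y ← recv x ; P_y`, binding `y` -/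
  | recvC (x : Name) (P : Proc)
  /-- `close x` -/
  | close (x : Name)
  /-- `wait x ; P` -/
  | wait (x : Name) (P : Proc)
  /-- `x ↔ y` -/
  | fwd (x y : Name)
  /-- `x ← f ← ys ; Q_x`, binding `x` -/
  | spawn (f : PName) (ys : List Name) (Q : Proc)
  /-- `get x {r} ; P` -/
  | get (x : Name) (r : ℚ≥0) (P : Proc)
  /-- `pay x {r} ; P` -/
  | pay (x : Name) (r : ℚ≥0) (P : Proc)
  /-- `work {r} ; P` -/
  | work (r : ℚ≥0) (P : Proc)
  /-- `flip p (H ⇒ P_H | T ⇒ P_T)` -/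
  | flip (p : ℚ≥0) (hp : p ≤ 1) (PH PT : Proc)
  /-- `x..k ; P`, the probabilistic send -/
  | psend (x : Name) (k : Label) (P : Proc)
  /-- `pcase x (ℓ ⇒ P_ℓ)_{ℓ ∈ L}` -/
  | pcase (x : Name) (L : Finset Label) (P : {ℓ // ℓ ∈ L} → Proc)

namespace Proc

/-- Replace the bound variable `k` (counted from outside) by the channel `e`. -/
def inst (e : Chan) : ℕ → Proc → Proc
  | k, sendL x l P => sendL (x.inst k e) l (inst e k P)
  | k, caseL x L P => caseL (x.inst k e) L (fun l => inst e k (P l))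
  | k, sendC x y P => sendC (x.inst k e) (y.inst k e) (inst e k P)
  | k, recvC x P => recvC (x.inst k e) (inst e (k + 1) P)
  | k, close x => close (x.inst k e)
  | k, wait x P => wait (x.inst k e) (inst e k P)
  | k, fwd x y => fwd (x.inst k e) (y.inst k e)
  | k, spawn f ys Q => spawn f (ys.map (Name.inst k e)) (inst e (k + 1) Q)
  | k, get x r P => get (x.inst k e) r (inst e k P)
  | k, pay x r P => pay (x.inst k e) r (inst e k P)
  | k, work r P => work r (inst e k P)
  | k, flip p hp PH PT => flip p hp (inst e k PH) (inst e k PT)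
  | k, psend x l P => psend (x.inst k e) l (inst e k P)
  | k, pcase x L P => pcase (x.inst k e) L (fun l => inst e k (P l))

/-- `P_y[e/y]`, where `P_y` is the body of a binder. -/
def subst (P : Proc) (e : Chan) : Proc := inst e 0 P

/-- Simultaneous renaming of the free channels. -/
def rename (ρ : Chan → Chan) : Proc → Proc
  | sendL x l P => sendL (x.rename ρ) l (rename ρ P)
  | caseL x L P => caseL (x.rename ρ) L (fun l => rename ρ (P l))
  | sendC x y P => sendC (x.rename ρ) (y.rename ρ) (rename ρ P)
  | recvC x P => recvC (x.rename ρ) (rename ρ P)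
  | close x => close (x.rename ρ)
  | wait x P => wait (x.rename ρ) (rename ρ P)
  | fwd x y => fwd (x.rename ρ) (y.rename ρ)
  | spawn f ys Q => spawn f (ys.map (Name.rename ρ)) (rename ρ Q)
  | get x r P => get (x.rename ρ) r (rename ρ P)
  | pay x r P => pay (x.rename ρ) r (rename ρ P)
  | work r P => work r (rename ρ P)
  | flip p hp PH PT => flip p hp (rename ρ PH) (rename ρ PT)
  | psend x l P => psend (x.rename ρ) l (rename ρ P)
  | pcase x L P => pcase (x.rename ρ) L (fun l => rename ρ (P l))

/-- `P[e/d]` for a free channel `d`. -/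
def replace (P : Proc) (d e : Chan) : Proc := P.rename (fun c => if c = d then e else c)

/-- The channels that occur (freely) in a process expression. -/
def chans : Proc → Set Chan
  | sendL x _ P => x.chans ∪ chans P
  | caseL x _ P => x.chans ∪ ⋃ l, chans (P l)
  | sendC x y P => x.chans ∪ y.chans ∪ chans P
  | recvC x P => x.chans ∪ chans P
  | close x => x.chans
  | wait x P => x.chans ∪ chans P
  | fwd x y => x.chans ∪ y.chans
  | spawn _ ys Q => (⋃ y ∈ ys, y.chans) ∪ chans Q
  | get x _ P => x.chans ∪ chans P
  | pay x _ P => x.chans ∪ chans P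
  | work _ P => chans P
  | flip _ _ PH PT => chans PH ∪ chans PT
  | psend x _ P => x.chans ∪ chans P
  | pcase x _ P => x.chans ∪ ⋃ l, chans (P l)

end Proc

/-! ### Signatures and equality of equirecursive types -/

/-- A process definition `f = (Δ, q, P, x, A)`. -/
structure PDef where
  args : List (Chan × Ty)
  pot : ℚ≥0
  body : Proc
  out : Chan
  ty : Ty

/-- The renaming `[b/x', ds/ys']` for a definition with provided channel `x'` and arguments
`ys'`. -/
def PDef.ren (D : PDef) (b : Chan) (ds : List Chan) : Chan → Chan := fun y =>
  if y = D.out then b else (((D.args.map Prod.fst).zip ds).lookup y).getD y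

/-- A signature: type definitions `V = A` and process definitions. -/
structure Sig where
  tdef : TyName → Ty
  pdef : PName → Option PDef

/-- Unfold a type identifier at the root. -/
def Sig.unfold (S : Sig) : Ty → Ty
  | .name V => S.tdef V
  | A => A

/-- Same root constructor (not a type identifier), with components related by `R`. -/
inductive HeadRel (R : Ty → Ty → Prop) : Ty → Ty → Prop
  | ichoice {L A B} : (∀ l, R (A l) (B l)) → HeadRel R (.ichoice L A) (.ichoice L B)
  | echoice {L A B} : (∀ l, R (A l) (B l)) → HeadRel R (.echoice L A) (.echoice L B)
  | tensor {A A' B B'} : R A A' → R B B' → HeadRel R (.tensor A B) (.tensor A' B')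
  | lolli {A A' B B'} : R A A' → R B B' → HeadRel R (.lolli A B) (.lolli A' B')
  | one : HeadRel R .one .one
  | payPot {r A A'} : R A A' → HeadRel R (.payPot r A) (.payPot r A')
  | getPot {r A A'} : R A A' → HeadRel R (.getPot r A) (.getPot r A')
  | pichoice {L p A B} : (∀ l, R (A l) (B l)) → HeadRel R (.pichoice L p A) (.pichoice L p B)
  | pechoice {L p A B} : (∀ l, R (A l) (B l)) → HeadRel R (.pechoice L p A) (.pechoice L p B)

/-- Equirecursive type equality: the two types have the same infinite unfolding. -/
def TyEq (S : Sig) (A B : Ty) : Prop :=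
  ∃ R : Ty → Ty → Prop, (∀ A B, R A B → HeadRel R (S.unfold A) (S.unfold B)) ∧ R A B

/-- The contexts have the same channels, with equal types. -/
def CtxEq (S : Sig) (Δ Δ' : Ctx) : Prop := ∀ x, Option.Rel (TyEq S) (Δ x) (Δ' x)

/-! ### Weighted sums of types and contexts -/

/-- `A = ∑ᴿ_i p_i · A_i`. Only the outermost probabilities of a probabilistic internal choice may
differ; all other types have to be equal. -/
inductive WSumR (S : Sig) {ι : Type} [Fintype ι] (p : FinDist ι) (As : ι → Ty) (A : Ty) : Prop
  | pichoice {L : Finset Label} (r : FinDist {ℓ // ℓ ∈ L}) (rs : ι → FinDist {ℓ // ℓ ∈ L})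
      (B : {ℓ // ℓ ∈ L} → Ty) :
      TyEq S A (.pichoice L r B) → (∀ i, TyEq S (As i) (.pichoice L (rs i) B)) →
      (∀ l, r.w l = ∑ i, p.w i * (rs i).w l) → WSumR S p As A
  | same : (∀ i, TyEq S (As i) A) → WSumR S p As A

/-- `A = ∑ᴸ_i p_i · A_i`. Only the outermost probabilities of a probabilistic external choice may
differ; all other types have to be equal. -/
inductive WSumL (S : Sig) {ι : Type} [Fintype ι] (p : FinDist ι) (As : ι → Ty) (A : Ty) : Prop
  | pechoice {L : Finset Label} (r : FinDist {ℓ // ℓ ∈ L}) (rs : ι → FinDist {ℓ // ℓ ∈ L})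
      (B : {ℓ // ℓ ∈ L} → Ty) :
      TyEq S A (.pechoice L r B) → (∀ i, TyEq S (As i) (.pechoice L (rs i) B)) →
      (∀ l, r.w l = ∑ i, p.w i * (rs i).w l) → WSumL S p As A
  | same : (∀ i, TyEq S (As i) A) → WSumL S p As A

/-- `Δ = ∑ᴸ_i p_i · Δ_i`, pointwise. -/
def CtxSum (S : Sig) {ι : Type} [Fintype ι] (p : FinDist ι) (Δs : ι → Ctx) (Δ : Ctx) : Prop :=
  ∀ x, (Δ x = none ∧ ∀ i, Δs i x = none) ∨
    ∃ (A : Ty) (As : ι → Ty), Δ x = some A ∧ (∀ i, Δs i x = some (As i)) ∧ WSumL S p As A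

/-! ### Typing of processes -/

open Name in
/-- `Typed S Δ q P z C` is the judgment `Δ ⊢^q P :: (z : C)`. A context `Δ, (x : A)` in the
conclusion of a rule is expressed by `Δ x = some A`. Bodies of binders are typed for all but
finitely many choices of the bound channel. -/
inductive Typed (S : Sig) : Ctx → ℚ≥0 → Proc → Chan → Ty → Prop
  /-- type identifiers may be silently replaced by their definitions -/
  | conv {Δ Δ' q P z A A'} : Typed S Δ q P z A → CtxEq S Δ Δ' → TyEq S A A' →
      Typed S Δ' q P z A'
  | weak {Δ q q' P z A} (r : ℚ≥0) : Typed S Δ q P z A → q' = q + r → Typed S Δ q' P z A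
  | echoiceR {Δ q z} {L : Finset Label} {P : {ℓ // ℓ ∈ L} → Proc} {A : {ℓ // ℓ ∈ L} → Ty} :
      Δ z = none → (∀ l, Typed S Δ q (P l) z (A l)) →
      Typed S Δ q (.caseL (chan z) L P) z (.echoice L A)
  | echoiceL {Δ q z C x k Q} {L : Finset Label} {A : {ℓ // ℓ ∈ L} → Ty} (hk : k ∈ L) :
      Δ x = some (.echoice L A) → Typed S (Δ.set x (A ⟨k, hk⟩)) q Q z C →
      Typed S Δ q (.sendL (chan x) k Q) z C
  | ichoiceR {Δ q z k P} {L : Finset Label} {A : {ℓ // ℓ ∈ L} → Ty} (hk : k ∈ L) :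
      Typed S Δ q P z (A ⟨k, hk⟩) → Typed S Δ q (.sendL (chan z) k P) z (.ichoice L A)
  | ichoiceL {Δ q z C x} {L : Finset Label} {Q : {ℓ // ℓ ∈ L} → Proc} {A : {ℓ // ℓ ∈ L} → Ty} :
      Δ z = none → Δ x = some (.ichoice L A) →
      (∀ l, Typed S (Δ.set x (A l)) q (Q l) z C) →
      Typed S Δ q (.caseL (chan x) L Q) z C
  | tensorR {Δ q z y P A B} : y ≠ z → Δ y = some A → Typed S (Δ.erase y) q P z B →
      Typed S Δ q (.sendC (chan z) (chan y) P) z (.tensor A B)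
  | tensorL {Δ q z C x Q A B} (F : Finset Chan) : Δ x = some (.tensor A B) →
      (∀ y, y ∉ F → Typed S ((Δ.set x B).set y A) q (Q.subst y) z C) →
      Typed S Δ q (.recvC (chan x) Q) z C
  | lolliR {Δ q z P A B} (F : Finset Chan) :
      (∀ y, y ∉ F → Typed S (Δ.set y A) q (P.subst y) z B) →
      Typed S Δ q (.recvC (chan z) P) z (.lolli A B)
  | lolliL {Δ q z C x y Q A B} : x ≠ y → y ≠ z → Δ x = some (.lolli A B) → Δ y = some A →
      Typed S ((Δ.erase y).set x B) q Q z C →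
      Typed S Δ q (.sendC (chan x) (chan y) Q) z C
  | oneR {z} : Typed S Ctx.empty 0 (.close (chan z)) z .one
  | oneL {Δ q z C x Q} : x ≠ z → Δ x = some .one → Typed S (Δ.erase x) q Q z C →
      Typed S Δ q (.wait (chan x) Q) z C
  | id {x y A} : x ≠ y → Typed S (Ctx.single y A) 0 (.fwd (chan x) (chan y)) x A
  | spawn {Δ Δ₀ : Ctx} {q r z C f Q} {D : PDef} {ys : List Chan} (F : Finset Chan) :
      S.pdef f = some D → ys.length = D.args.length → ys.Nodup → z ∉ ys →
      Δ₀.Disj (Ctx.ofList (ys.zip (D.args.map Prod.snd))) →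
      Δ = Δ₀.join (Ctx.ofList (ys.zip (D.args.map Prod.snd))) → r = D.pot + q →
      (∀ x, x ∉ F → Typed S (Δ₀.set x D.ty) q (Q.subst x) z C) →
      Typed S Δ r (.spawn f (ys.map chan) Q) z C
  | payR {Δ q q' z r P A} : Typed S Δ q' P z A → q = q' + r →
      Typed S Δ q (.pay (chan z) r P) z (.payPot r A)
  | payL {Δ q z C x r Q A} : Δ x = some (.payPot r A) →
      Typed S (Δ.set x A) (q + r) Q z C → Typed S Δ q (.get (chan x) r Q) z C
  | getR {Δ q z r P A} : Typed S Δ (q + r) P z A →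
      Typed S Δ q (.get (chan z) r P) z (.getPot r A)
  | getL {Δ q q' z C x r Q A} : Δ x = some (.getPot r A) →
      Typed S (Δ.set x A) q' Q z C → q = q' + r → Typed S Δ q (.pay (chan x) r Q) z C
  | work {Δ q q' z r P A} : Typed S Δ q' P z A → q = q' + r → Typed S Δ q (.work r P) z A
  | flip {Δ q z p hp PH PT A} {Δs : Fin 2 → Ctx} {qs : Fin 2 → ℚ≥0} {As : Fin 2 → Ty} :
      CtxSum S (FinDist.coin p hp) Δs Δ → WSumR S (FinDist.coin p hp) As A →
      q = p * qs 0 + (1 - p) * qs 1 →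
      Typed S (Δs 0) (qs 0) PH z (As 0) → Typed S (Δs 1) (qs 1) PT z (As 1) →
      Typed S Δ q (.flip p hp PH PT) z A
  | pichoiceL {Δ q z C x} {L : Finset Label} {p : FinDist {ℓ // ℓ ∈ L}}
      {Q : {ℓ // ℓ ∈ L} → Proc} {A Cs : {ℓ // ℓ ∈ L} → Ty} {Δs : {ℓ // ℓ ∈ L} → Ctx}
      {qs : {ℓ // ℓ ∈ L} → ℚ≥0} :
      Δ x = some (.pichoice L p A) →
      (∀ l, Typed S ((Δs l).set x (A l)) (qs l) (Q l) z (Cs l)) →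
      q = ∑ l, p.w l * qs l → CtxSum S p Δs (Δ.erase x) → WSumR S p Cs C →
      Typed S Δ q (.pcase (chan x) L Q) z C
  | pichoiceR {Δ q z k P} {L : Finset Label} {p : FinDist {ℓ // ℓ ∈ L}}
      {A : {ℓ // ℓ ∈ L} → Ty} (hk : k ∈ L) :
      p.w ⟨k, hk⟩ = 1 → (∀ l, l ≠ ⟨k, hk⟩ → p.w l = 0) → Typed S Δ q P z (A ⟨k, hk⟩) →
      Typed S Δ q (.psend (chan z) k P) z (.pichoice L p A)
  | pechoiceL {Δ q z C x k Q} {L : Finset Label} {p : FinDist {ℓ // ℓ ∈ L}}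
      {A : {ℓ // ℓ ∈ L} → Ty} (hk : k ∈ L) :
      p.w ⟨k, hk⟩ = 1 → (∀ l, l ≠ ⟨k, hk⟩ → p.w l = 0) → Δ x = some (.pechoice L p A) →
      Typed S (Δ.set x (A ⟨k, hk⟩)) q Q z C →
      Typed S Δ q (.psend (chan x) k Q) z C
  | pechoiceR {Δ q z} {L : Finset Label} {p : FinDist {ℓ // ℓ ∈ L}}
      {P : {ℓ // ℓ ∈ L} → Proc} {A : {ℓ // ℓ ∈ L} → Ty} {Δs : {ℓ // ℓ ∈ L} → Ctx}
      {qs : {ℓ // ℓ ∈ L} → ℚ≥0} :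
      (∀ l, Typed S (Δs l) (qs l) (P l) z (A l)) →
      q = ∑ l, p.w l * qs l → CtxSum S p Δs Δ →
      Typed S Δ q (.pcase (chan z) L P) z (.pechoice L p A)

/-- Well-formed signatures: type definitions are contractive and the body of every process
definition has the declared type. -/
structure Sig.WellFormed (S : Sig) : Prop where
  contractive : ∀ V W, S.tdef V ≠ .name W
  nodup : ∀ f D, S.pdef f = some D → (D.args.map Prod.fst).Nodup
  typed : ∀ f D, S.pdef f = some D → Typed S (Ctx.ofList D.args) D.pot D.body D.out D.ty

/-! ### Nested configurations -/

/-- Semantic objects: `proc(c, (w, P))`, a process that provides `c` and has done work `w`, or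
`proc(c, {C_i : p_i})`, a local distribution of configurations that provide `c`. A configuration is
a list of semantic objects. -/
inductive Obj : Type
  | proc (c : Chan) (w : ℚ≥0) (P : Proc)
  | dist (c : Chan) (n : ℕ) (p : FinDist (Fin n)) (C : Fin n → List Obj)

/-- Nested configurations `O_1 ∥ ⋯ ∥ O_n`; providers stand to the right of their clients. -/
abbrev Config := List Obj

/-- The channel that an object provides. -/
def Obj.chan : Obj → Chan
  | .proc c _ _ => c
  | .dist c _ _ _ => c

/-- `b` is the providing channel of an object of the configuration, at any depth. -/
inductive Provides (b : Chan) : Config → Prop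
  | head {O C} : O.chan = b → Provides b (O :: C)
  | inner {c n p C R} (i : Fin n) : Provides b (C i) → Provides b (.dist c n p C :: R)
  | tail {O C} : Provides b C → Provides b (O :: C)

/-- `b` occurs in the configuration, at any depth. -/
inductive Occurs (b : Chan) : Config → Prop
  | head {O C} : O.chan = b → Occurs b (O :: C)
  | body {c w P C} : b ∈ P.chans → Occurs b (.proc c w P :: C)
  | inner {c n p C R} (i : Fin n) : Occurs b (C i) → Occurs b (.dist c n p C :: R)
  | tail {O C} : Occurs b C → Occurs b (O :: C)

/-- `CTyped S Δ q C Γ` is the configuration typing judgment `Δ ⊨^q C :: Γ`. The side conditions of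
the rule `compose` say that the channels that are composed are distinct, including those that are
provided and consumed inside distribution objects. -/
inductive CTyped (S : Sig) : Ctx → ℚ≥0 → Config → Ctx → Prop
  | proc {Δ q q' w c P A Γ} : Typed S Δ q' P c A → q = q' + w → Γ = Ctx.single c A →
      CTyped S Δ q [.proc c w P] Γ
  | dist {Δ q c n p C A Γ} {Δs : Fin n → Ctx} {qs : Fin n → ℚ≥0} {As : Fin n → Ty} :
      (∀ i, CTyped S (Δs i) (qs i) (C i) (Ctx.single c (As i))) →
      CtxSum S p Δs Δ → WSumR S p As A → q = ∑ i, p.w i * qs i → Γ = Ctx.single c A →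
      CTyped S Δ q [.dist c n p C] Γ
  | compose {Δ Δ₁ Δ₂ Δ' Δ₁' Γ Γ₀ Γ₂ : Ctx} {q q₁ q₂ O c A C} :
      CTyped S Δ₁' q₁ [O] (Ctx.single c A) → CTyped S Δ₂ q₂ C Γ₂ →
      Δ₁.Disj Δ' → Δ₁' = Δ₁.join Δ' →
      Γ₀.Disj Δ' → Γ₂ = Γ₀.join Δ' →
      Δ₁.Disj Δ₂ → Δ = Δ₁.join Δ₂ →
      Γ₀ c = none → Γ = Γ₀.set c A →
      q = q₁ + q₂ →
      (∀ b, Provides b [O] → ¬ Provides b C) →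
      (∀ b, Provides b C → Δ₁ b = none) →
      (∀ b, Provides b [O] → Δ₂ b = none) →
      CTyped S Δ q (O :: C) Γ

/-! ### Nested-multiverse semantics -/

/-- Sorts of communication: deterministic, probabilistic internal choice, probabilistic external
choice. -/
inductive CommSort : Type
  | det
  | pint
  | pext

open Name in
/-- The client expression communicates next along its consumed channel `d`, with the given sort. -/
inductive Blocked (d : Chan) : CommSort → Proc → Prop
  | wait {Q} : Blocked d .det (.wait (chan d) Q)
  | caseL {L Q} : Blocked d .det (.caseL (chan d) L Q)
  | sendL {k Q} : Blocked d .det (.sendL (chan d) k Q)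
  | pcase {L Q} : Blocked d .pint (.pcase (chan d) L Q)
  | psend {k Q} : Blocked d .pext (.psend (chan d) k Q)
  | get {r Q} : Blocked d .det (.get (chan d) r Q)
  | pay {r Q} : Blocked d .det (.pay (chan d) r Q)
  | recvC {Q} : Blocked d .det (.recvC (chan d) Q)
  | sendC {y Q} : Blocked d .det (.sendC (chan d) y Q)

/-- Single-object steps `C ↦ C'`, with spawned channels chosen outside of `U`. -/
inductive EStep (S : Sig) (U : Set Chan) : Config → Config → Prop
  | spawn {c w f Q b} {D : PDef} {ds : List Chan} :
      S.pdef f = some D → ds.length = D.args.length → b ∉ U →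
      EStep S U [.proc c w (.spawn f (ds.map Name.chan) Q)]
        [.proc c w (Q.subst b), .proc b 0 (D.body.rename (D.ren b ds))]
  | work {c w r P} : EStep S U [.proc c w (.work r P)] [.proc c (w + r) P]
  | flip {c w p hp PH PT} :
      EStep S U [.proc c w (.flip p hp PH PT)]
        [.dist c 2 (FinDist.coin p hp) ![[.proc c w PH], [.proc c w PT]]]
  | dist {c n p} {C : Fin n → Config} {i : Fin n} {C' : Config} : EStep S U (C i) C' →
      EStep S U [.dist c n p C] [.dist c n p (Function.update C i C')]
  /-- rewriting inside a configuration -/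
  | frame {O R C₁ C₂} : EStep S U [O] R → EStep S U (C₁ ++ O :: C₂) (C₁ ++ R ++ C₂)

open Name in
/-- Communication steps along the channel `d` of a given sort. -/
inductive CStep (d : Chan) : CommSort → Config → Config → Prop
  | ichoice {c wc wd k P L Q} (hk : k ∈ L) :
      CStep d .det [.proc c wc (.caseL (chan d) L Q), .proc d wd (.sendL (chan d) k P)]
        [.proc c wc (Q ⟨k, hk⟩), .proc d wd P]
  | echoice {c wc wd k Q L P} (hk : k ∈ L) :
      CStep d .det [.proc c wc (.sendL (chan d) k Q), .proc d wd (.caseL (chan d) L P)]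
        [.proc c wc Q, .proc d wd (P ⟨k, hk⟩)]
  | tensor {c wc wd e Q P} :
      CStep d .det [.proc c wc (.recvC (chan d) Q), .proc d wd (.sendC (chan d) (chan e) P)]
        [.proc c wc (Q.subst e), .proc d wd P]
  | lolli {c wc wd e Q P} :
      CStep d .det [.proc c wc (.sendC (chan d) (chan e) Q), .proc d wd (.recvC (chan d) P)]
        [.proc c wc Q, .proc d wd (P.subst e)]
  | one {c wc wd Q} :
      CStep d .det [.proc c wc (.wait (chan d) Q), .proc d wd (.close (chan d))]
        [.proc c (wc + wd) Q]
  | id {κ c wc wd e Q} : Blocked d κ Q →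
      CStep d κ [.proc c wc Q, .proc d wd (.fwd (chan d) (chan e))]
        [.proc c (wc + wd) (Q.replace d e)]
  | payPot {c wc wd r Q P} :
      CStep d .det [.proc c wc (.get (chan d) r Q), .proc d wd (.pay (chan d) r P)]
        [.proc c wc Q, .proc d wd P]
  | getPot {c wc wd r Q P} :
      CStep d .det [.proc c wc (.pay (chan d) r Q), .proc d wd (.get (chan d) r P)]
        [.proc c wc Q, .proc d wd P]
  | pichoice {c wc wd k P L Q} (hk : k ∈ L) :
      CStep d .pint [.proc c wc (.pcase (chan d) L Q), .proc d wd (.psend (chan d) k P)]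
        [.proc c wc (Q ⟨k, hk⟩), .proc d wd P]
  | pechoice {c wc wd k Q L P} (hk : k ∈ L) :
      CStep d .pext [.proc c wc (.psend (chan d) k Q), .proc d wd (.pcase (chan d) L P)]
        [.proc c wc Q, .proc d wd (P ⟨k, hk⟩)]
  | dist {κ c n p} {C : Fin n → Config} {i : Fin n} {C' : Config} : CStep d κ (C i) C' →
      CStep d κ [.dist c n p C] [.dist c n p (Function.update C i C')]
  | sdistR {κ c w Q n p} {C : Fin n → Config} {C' : Config} :
      CStep d κ [.dist c n p (fun i => .proc c w Q :: C i)] C' →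
      CStep d κ [.proc c w Q, .dist d n p C] C'
  | sdistL {κ c w P n p} {C : Fin n → Config} {C' : Config} :
      CStep d κ [.dist c n p (fun i => C i ++ [.proc d w P])] C' →
      CStep d κ [.dist c n p C, .proc d w P] C'
  | bdistD {c n m} {p : FinDist (Fin n)} {p' : FinDist (Fin m)} {C : Fin n → Config}
      {C' : Fin m → Config} {C'' : Config} :
      CStep d .det [.dist c (n * m) (p.prod p')
        (fun k => C (finProdFinEquiv.symm k).1 ++ C' (finProdFinEquiv.symm k).2)] C'' →
      CStep d .det [.dist c n p C, .dist d m p' C'] C''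
  | bdistR {c n m} {p : FinDist (Fin n)} {p' : FinDist (Fin m)} {C : Fin n → Config}
      {C' : Fin m → Config} {C'' : Config} :
      CStep d .pext [.dist c m p' (fun j => .dist c n p C :: C' j)] C'' →
      CStep d .pext [.dist c n p C, .dist d m p' C'] C''
  | bdistL {c n m} {p : FinDist (Fin n)} {p' : FinDist (Fin m)} {C : Fin n → Config}
      {C' : Fin m → Config} {C'' : Config} :
      CStep d .pint [.dist c n p (fun i => C i ++ [.dist d m p' C'])] C'' →
      CStep d .pint [.dist c n p C, .dist d m p' C'] C''
  /-- rewriting of one object inside a configuration -/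
  | frame₁ {κ O R C₁ C₂} : CStep d κ [O] R → CStep d κ (C₁ ++ O :: C₂) (C₁ ++ R ++ C₂)
  /-- rewriting of a client and the provider of `d` inside a configuration -/
  | frame₂ {κ O O' R C₁ C₂ C₃} : O'.chan = d → CStep d κ [O, O'] R →
      CStep d κ (C₁ ++ O :: C₂ ++ O' :: C₃) (C₁ ++ R ++ C₂ ++ C₃)

/-- One step of the nested-multiverse semantics; spawned channels are fresh. -/
def Step (S : Sig) (C C' : Config) : Prop :=
  EStep S {b | Occurs b C} C C' ∨ ∃ d κ, CStep d κ C C'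

open Name in
/-- All processes communicate along the channels that they provide. -/
inductive Poised : Config → Prop
  | close {c w} : Poised [.proc c w (.close (chan c))]
  | sendL {c w k P} : Poised [.proc c w (.sendL (chan c) k P)]
  | caseL {c w L P} : Poised [.proc c w (.caseL (chan c) L P)]
  | psend {c w k P} : Poised [.proc c w (.psend (chan c) k P)]
  | pcase {c w L P} : Poised [.proc c w (.pcase (chan c) L P)]
  | pay {c w r P} : Poised [.proc c w (.pay (chan c) r P)]
  | get {c w r P} : Poised [.proc c w (.get (chan c) r P)]
  | sendC {c w y P} : Poised [.proc c w (.sendC (chan c) y P)]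
  | recvC {c w P} : Poised [.proc c w (.recvC (chan c) P)]
  | fwd {c w y} : Poised [.proc c w (.fwd (chan c) y)]
  | dist {c n p C} : (∀ i, Poised (C i)) → Poised [.dist c n p C]
  | compose {O C} : Poised [O] → Poised C → Poised (O :: C)

/-- An infinite execution from `C`: every configuration makes a step, or is poised (the execution is
over) and is repeated forever. -/
structure IsRun (S : Sig) (C : Config) (run : ℕ → Config) : Prop where
  zero : run 0 = C
  succ : ∀ n, Step S (run n) (run (n + 1)) ∨ (Poised (run n) ∧ run (n + 1) = run n)

/-! ### Flattened configurations and their probabilistic semantics -/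

/-- A process `proc(c, (w, P))` of a non-nested configuration. -/
structure FProc where
  chan : Chan
  w : ℚ≥0
  body : Proc

/-- Non-nested configurations `proc(c₁, (w₁, P₁)) ∥ ⋯ ∥ proc(cₙ, (wₙ, Pₙ))`, up to reordering. -/
abbrev FConf := Multiset FProc

instance : MeasurableSpace FConf := ⊤

/-- The total work done by a non-nested configuration. -/
def work (D : FConf) : ℚ≥0 := (D.map FProc.w).sum

/-- Total work as an extended nonnegative real number. -/
noncomputable def workE (D : FConf) : ℝ≥0∞ := ((work D : ℝ≥0) : ℝ≥0∞)

/-- The channels that occur in a non-nested configuration. -/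
def occ (D : FConf) : Set Chan := {b | ∃ x ∈ D, b = x.chan ∨ b ∈ x.body.chans}

/-- The flattening relation `C ≈ μ`. -/
inductive Flat : Config → PMF FConf → Prop
  | proc {c w P} : Flat [.proc c w P] (PMF.pure {⟨c, w, P⟩})
  | dist {c n p C} {μ : Fin n → PMF FConf} : (∀ i, Flat (C i) (μ i)) →
      Flat [.dist c n p C] (p.toPMF.bind μ)
  | compose {O C μ₁ μ₂} : Flat [O] μ₁ → Flat C μ₂ →
      Flat (O :: C) (μ₁.bind fun D₁ => μ₂.map fun D₂ => D₁ + D₂)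

open Name in
/-- Deterministic multiset-rewriting steps of non-nested configurations; `F` is the part that is not
rewritten. -/
inductive DetStep (S : Sig) : FConf → FConf → Prop
  | pichoice {F c wc wd d k P L Q} (hk : k ∈ L) :
      DetStep S (⟨c, wc, .psend (chan c) k P⟩ ::ₘ ⟨d, wd, .pcase (chan c) L Q⟩ ::ₘ F)
        (⟨c, wc, P⟩ ::ₘ ⟨d, wd, Q ⟨k, hk⟩⟩ ::ₘ F)
  | pechoice {F c wc wd d k Q} {L : Finset Label} {P : {ℓ // ℓ ∈ L} → Proc} (hk : k ∈ L) :
      DetStep S (⟨c, wc, .pcase (chan c) L P⟩ ::ₘ ⟨d, wd, .psend (chan c) k Q⟩ ::ₘ F)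
        (⟨c, wc, P ⟨k, hk⟩⟩ ::ₘ ⟨d, wd, Q⟩ ::ₘ F)
  | one {F c wc wd d Q} :
      DetStep S (⟨c, wc, .close (chan c)⟩ ::ₘ ⟨d, wd, .wait (chan c) Q⟩ ::ₘ F)
        (⟨d, wc + wd, Q⟩ ::ₘ F)
  | id {F c wc wd d e Q} : c ∈ Q.chans →
      DetStep S (⟨c, wc, .fwd (chan c) (chan e)⟩ ::ₘ ⟨d, wd, Q⟩ ::ₘ F)
        (⟨d, wc + wd, Q.replace c e⟩ ::ₘ F)
  | spawn {F c w f Q b} {D : PDef} {ds : List Chan} :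
      S.pdef f = some D → ds.length = D.args.length →
      b ∉ occ (⟨c, w, .spawn f (ds.map chan) Q⟩ ::ₘ F) →
      DetStep S (⟨c, w, .spawn f (ds.map chan) Q⟩ ::ₘ F)
        (⟨b, 0, D.body.rename (D.ren b ds)⟩ ::ₘ ⟨c, w, Q.subst b⟩ ::ₘ F)
  | tensor {F c wc wd d e P Q} :
      DetStep S (⟨c, wc, .sendC (chan c) (chan e) P⟩ ::ₘ ⟨d, wd, .recvC (chan c) Q⟩ ::ₘ F)
        (⟨c, wc, P⟩ ::ₘ ⟨d, wd, Q.subst e⟩ ::ₘ F)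
  | lolli {F c wc wd d e P Q} :
      DetStep S (⟨c, wc, .recvC (chan c) P⟩ ::ₘ ⟨d, wd, .sendC (chan c) (chan e) Q⟩ ::ₘ F)
        (⟨c, wc, P.subst e⟩ ::ₘ ⟨d, wd, Q⟩ ::ₘ F)
  | ichoice {F c wc wd d k P L Q} (hk : k ∈ L) :
      DetStep S (⟨c, wc, .sendL (chan c) k P⟩ ::ₘ ⟨d, wd, .caseL (chan c) L Q⟩ ::ₘ F)
        (⟨c, wc, P⟩ ::ₘ ⟨d, wd, Q ⟨k, hk⟩⟩ ::ₘ F)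
  | echoice {F c wc wd d k Q} {L : Finset Label} {P : {ℓ // ℓ ∈ L} → Proc} (hk : k ∈ L) :
      DetStep S (⟨c, wc, .caseL (chan c) L P⟩ ::ₘ ⟨d, wd, .sendL (chan c) k Q⟩ ::ₘ F)
        (⟨c, wc, P ⟨k, hk⟩⟩ ::ₘ ⟨d, wd, Q⟩ ::ₘ F)
  | payPot {F c wc wd d r P Q} :
      DetStep S (⟨c, wc, .pay (chan c) r P⟩ ::ₘ ⟨d, wd, .get (chan c) r Q⟩ ::ₘ F)
        (⟨c, wc, P⟩ ::ₘ ⟨d, wd, Q⟩ ::ₘ F)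
  | getPot {F c wc wd d r P Q} :
      DetStep S (⟨c, wc, .get (chan c) r P⟩ ::ₘ ⟨d, wd, .pay (chan c) r Q⟩ ::ₘ F)
        (⟨c, wc, P⟩ ::ₘ ⟨d, wd, Q⟩ ::ₘ F)
  | work {F c w r P} : DetStep S (⟨c, w, .work r P⟩ ::ₘ F) (⟨c, w + r, P⟩ ::ₘ F)

/-- The configuration-to-distribution step relation. -/
inductive ProbStep (S : Sig) : FConf → PMF FConf → Prop
  | det {D D'} : DetStep S D D' → ProbStep S D (PMF.pure D')
  | flip {F c w p hp PH PT} :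
      ProbStep S (⟨c, w, .flip p hp PH PT⟩ ::ₘ F)
        ((FinDist.coin p hp).toPMF.map ![⟨c, w, PH⟩ ::ₘ F, ⟨c, w, PT⟩ ::ₘ F])

/-- `ν` is a possible law of the successor of `D`: a (randomized) scheduler decides whether `D` rests
or makes one of its probabilistic steps. -/
def Scheduled (S : Sig) (D : FConf) (ν : PMF FConf) : Prop :=
  ∃ m : PMF (PMF FConf), (∀ ξ ∈ m.support, ξ = PMF.pure D ∨ ProbStep S D ξ) ∧ ν = m.bind _root_.id

/-- `X` is a (time-inhomogeneous) Markov chain on a discrete state space whose `n`-th transition is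
given by the kernel `K n`. -/
structure IsMarkovChain {Ω T : Type*} [MeasurableSpace Ω] [MeasurableSpace T]
    (Pr : MeasureTheory.Measure Ω) (X : ℕ → Ω → T) (K : ℕ → T → PMF T) : Prop where
  measurable : ∀ n, Measurable (X n)
  step : ∀ (n : ℕ) (x : ℕ → T),
    Pr {ω | ∀ i ≤ n + 1, X i ω = x i} = Pr {ω | ∀ i ≤ n, X i ω = x i} * K n (x n) (x (n + 1))

end PRast

namespace PRast

/-! ### Type equality -/

-- The link between the two semantics is the map `flatC`, which sends a nested configuration to the
-- law obtained by making all its local random choices independently. Decomposing distribution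
-- objects does not change this law (`flatC_dist_cons`, `flatC_dist_snoc`, `flatC_prod`), and every
-- other rule replaces some of the outcomes by the result of one non-nested step (`CStep.reach`,
-- `EStep.reach`). This gives a coupling of old outcomes with the steps they take. Conditioning it
-- on the old outcome (`exists_disintegration`) produces a transition kernel that carries the law of
-- `run n` to the law of `run (n + 1)`, and the Ionescu-Tulcea theorem turns the sequence of kernels
-- into a Markov chain.
--
-- The bound comes from typing: the potential `q` of a configuration covers the work already
-- recorded in it, averaged over its distributions (`CTyped.meanWork_le`). By preservation the same
-- `q` serves at every time. Steps never decrease work, so the expectations increase to a limit that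
-- is at most `q`.
--
-- Most of the proof is therefore type preservation and progress. Configuration typing is first
-- recast as `CT`, where every channel has one state and composition is a partial associative
-- operation on states; reordering objects, framing and copying then become pointwise facts.
--
-- The delicate point of preservation is copying an object into the branches of a distribution
-- object, because a probabilistic channel may have different probabilities in different branches.
-- If the sort of the communication does not match the side on which the branches were averaged, all
-- branch types are equal (`WSumR.tyEq`, `WSumL.tyEq`). Otherwise the copied process is a receiver
-- on that channel, or a forwarder. A receiver types its continuation separately for each label and
-- averages only afterwards, so one derivation can be averaged again with the probabilities of each
-- branch (`Typed.split_client`, `Typed.split_server`).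
--
-- Progress is an induction with the alternatives: ready, able to step, or blocked at a channel used
-- from outside (`CT.progress`). A closed configuration uses no channel, which excludes the last
-- alternative.

theorem HeadRel.mono {R R' : Ty → Ty → Prop} (h : ∀ A B, R A B → R' A B) {A B : Ty}
    (hAB : HeadRel R A B) : HeadRel R' A B := by
  cases hAB with
  | ichoice k => exact .ichoice fun l => h _ _ (k l)
  | echoice k => exact .echoice fun l => h _ _ (k l)
  | tensor k k' => exact .tensor (h _ _ k) (h _ _ k')
  | lolli k k' => exact .lolli (h _ _ k) (h _ _ k')
  | one => exact .one
  | payPot k => exact .payPot (h _ _ k)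
  | getPot k => exact .getPot (h _ _ k)
  | pichoice k => exact .pichoice fun l => h _ _ (k l)
  | pechoice k => exact .pechoice fun l => h _ _ (k l)

theorem HeadRel.flip {R : Ty → Ty → Prop} {A B : Ty} (h : HeadRel R A B) :
    HeadRel (fun A B => R B A) B A := by
  cases h <;> constructor <;> assumption

theorem HeadRel.comp {R R' : Ty → Ty → Prop} {A B C : Ty} (h : HeadRel R A B)
    (h' : HeadRel R' B C) : HeadRel (fun A C => ∃ B, R A B ∧ R' B C) A C := by
  cases h <;> cases h' <;> constructor <;> grind

theorem TyEq.head {S : Sig} {A B : Ty} (h : TyEq S A B) :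
    HeadRel (TyEq S) (S.unfold A) (S.unfold B) := by
  obtain ⟨R, hR, hAB⟩ := h
  exact (hR _ _ hAB).mono fun A B h => ⟨R, hR, h⟩

theorem TyEq.symm {S : Sig} {A B : Ty} (h : TyEq S A B) : TyEq S B A := by
  obtain ⟨R, hR, hAB⟩ := h
  exact ⟨fun A B => R B A, fun A B h => (hR _ _ h).flip, hAB⟩

theorem TyEq.trans {S : Sig} {A B C : Ty} (h : TyEq S A B) (h' : TyEq S B C) : TyEq S A C := by
  obtain ⟨R, hR, hAB⟩ := h
  obtain ⟨R', hR', hBC⟩ := h'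
  refine ⟨fun A C => ∃ B, R A B ∧ R' B C, ?_, B, hAB, hBC⟩
  rintro A C ⟨B, h, h'⟩
  exact (hR _ _ h).comp (hR' _ _ h')

/-- Contractivity enters here: one unfolding always exposes a proper constructor, so the identity
relation is a bisimulation. -/
theorem Sig.WellFormed.tyEq_refl {S : Sig} (hS : S.WellFormed) (A : Ty) : TyEq S A A := by
  refine ⟨Eq, ?_, rfl⟩
  rintro A _ rfl
  have : ∀ V, S.unfold A ≠ .name V := by
    intro V h
    cases A <;> simp [Sig.unfold] at h
    exact hS.contractive _ _ h
  generalize S.unfold A = B at this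
  cases B <;> first | exact absurd rfl (this _) | (constructor <;> simp)

/-- The relation that compares only the unfolded roots by `TyEq` is itself a bisimulation. This
allows equality to be proved one constructor at a time. -/
theorem TyEq.of_head {S : Sig} {A B : Ty} (h : HeadRel (TyEq S) (S.unfold A) (S.unfold B)) :
    TyEq S A B := by
  refine ⟨fun X Y => HeadRel (TyEq S) (S.unfold X) (S.unfold Y), ?_, h⟩
  intro X Y h
  exact h.mono fun A B => TyEq.head

/-- The outermost constructor of a type, with its label set or its amount of potential. The
probabilities of a probabilistic choice are forgotten. -/
inductive Shape : Type
  | ichoice (L : Finset Label)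
  | echoice (L : Finset Label)
  | tensor
  | lolli
  | one
  | payPot (r : ℚ≥0)
  | getPot (r : ℚ≥0)
  | pichoice (L : Finset Label)
  | pechoice (L : Finset Label)
  | name

/-- The shape of a type that is not a type identifier. -/
def Ty.shape : Ty → Shape
  | .ichoice L _ => .ichoice L
  | .echoice L _ => .echoice L
  | .tensor _ _ => .tensor
  | .lolli _ _ => .lolli
  | .one => .one
  | .name _ => .name
  | .payPot r _ => .payPot r
  | .getPot r _ => .getPot r
  | .pichoice L _ _ => .pichoice L
  | .pechoice L _ _ => .pechoice L

/-- The shape of the unfolding of a type. -/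
def Sig.shape (S : Sig) (A : Ty) : Shape := (S.unfold A).shape

/-- The sort of the communication along a channel of the given shape. -/
def Shape.sort : Shape → CommSort
  | .pichoice _ => .pint
  | .pechoice _ => .pext
  | _ => .det

theorem TyEq.shape_eq {S : Sig} {A B : Ty} (h : TyEq S A B) : S.shape A = S.shape B := by
  have := h.head
  unfold Sig.shape
  generalize S.unfold A = A' at this
  generalize S.unfold B = B' at this
  cases this <;> rfl

/-! ### Finite distributions -/

namespace FinDist

variable {ι κ : Type} [Fintype ι] [Fintype κ]

/-- The distribution obtained by drawing `k` from `r` and then an index from `rs k`. -/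
def bind (r : FinDist κ) (rs : κ → FinDist ι) : FinDist ι where
  w l := ∑ k, r.w k * (rs k).w l
  sum_eq := by
    rw [Finset.sum_comm]
    simp [← Finset.mul_sum, (rs _).sum_eq, r.sum_eq]

theorem nonempty (p : FinDist ι) : Nonempty ι := by
  by_contra h
  have := not_nonempty_iff.1 h
  simpa using p.sum_eq

/-- The image of `P` under `f` is `p`. -/
def Marginal (P : FinDist κ) (p : FinDist ι) (f : κ → ι) : Prop :=
  ∀ g : ι → ℚ≥0, ∑ k, P.w k * g (f k) = ∑ i, p.w i * g i

theorem prod_sum {n m : ℕ} (p : FinDist (Fin n)) (p' : FinDist (Fin m))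
    (g : Fin n → Fin m → ℚ≥0) :
    ∑ k, (p.prod p').w k * g (finProdFinEquiv.symm k).1 (finProdFinEquiv.symm k).2 =
      ∑ i, p.w i * ∑ j, p'.w j * g i j := by
  simp only [prod]
  rw [finProdFinEquiv.symm.sum_comp
    (fun x : Fin n × Fin m => p.w x.1 * p'.w x.2 * g x.1 x.2), Fintype.sum_prod_type]
  simp [Finset.mul_sum, mul_assoc]

theorem marginal_fst {n m : ℕ} (p : FinDist (Fin n)) (p' : FinDist (Fin m)) :
    Marginal (p.prod p') p fun k => (finProdFinEquiv.symm k).1 := by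
  intro g
  rw [prod_sum p p' fun i _ => g i]
  simp [← Finset.sum_mul, p'.sum_eq]

theorem marginal_snd {n m : ℕ} (p : FinDist (Fin n)) (p' : FinDist (Fin m)) :
    Marginal (p.prod p') p' fun k => (finProdFinEquiv.symm k).2 := by
  intro g
  rw [prod_sum p p' fun _ j => g j]
  simp [← Finset.sum_mul, p.sum_eq]

theorem sum_const (p : FinDist ι) (a : ℚ≥0) : ∑ i, p.w i * a = a := by
  rw [← Finset.sum_mul, p.sum_eq, one_mul]

theorem sum_add (p : FinDist ι) (f g : ι → ℚ≥0) :
    ∑ i, p.w i * (f i + g i) = ∑ i, p.w i * f i + ∑ i, p.w i * g i := by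
  simp [mul_add, Finset.sum_add_distrib]

theorem sum_add_const (p : FinDist ι) (f : ι → ℚ≥0) (a : ℚ≥0) :
    ∑ i, p.w i * (f i + a) = ∑ i, p.w i * f i + a := by
  rw [sum_add, sum_const]

/-- If `r = ∑ p_j r_j`, then averages over `r` are averages of the averages over the `r_j`. -/
theorem sum_mix {r : FinDist κ} {rj : ι → FinDist κ} {p : FinDist ι}
    (h : ∀ l, r.w l = ∑ j, p.w j * (rj j).w l) (g : κ → ℚ≥0) :
    ∑ l, r.w l * g l = ∑ j, p.w j * ∑ l, (rj j).w l * g l := by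
  simp only [h, Finset.sum_mul, Finset.mul_sum, mul_assoc]
  rw [Finset.sum_comm]

end FinDist

/-! ### Weighted sums of types -/

section WSum

variable {S : Sig} {ι κ : Type} [Fintype ι] [Fintype κ] {p : FinDist ι} {As : ι → Ty} {A : Ty}

theorem WSumR.conv {A' : Ty} (h : WSumR S p As A) (h' : TyEq S A A') : WSumR S p As A' := by
  cases h with
  | pichoice r rs B h₁ h₂ h₃ => exact .pichoice r rs B (h'.symm.trans h₁) h₂ h₃
  | same h => exact .same fun i => (h i).trans h'

theorem WSumL.conv {A' : Ty} (h : WSumL S p As A) (h' : TyEq S A A') : WSumL S p As A' := by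
  cases h with
  | pechoice r rs B h₁ h₂ h₃ => exact .pechoice r rs B (h'.symm.trans h₁) h₂ h₃
  | same h => exact .same fun i => (h i).trans h'

theorem WSumR.shape_eq (h : WSumR S p As A) (i : ι) : S.shape (As i) = S.shape A := by
  cases h with
  | pichoice r rs B h₁ h₂ h₃ =>
    rw [(h₂ i).shape_eq, h₁.shape_eq]; rfl
  | same h => exact (h i).shape_eq

theorem WSumL.shape_eq (h : WSumL S p As A) (i : ι) : S.shape (As i) = S.shape A := by
  cases h with
  | pechoice r rs B h₁ h₂ h₃ =>
    rw [(h₂ i).shape_eq, h₁.shape_eq]; rfl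
  | same h => exact (h i).shape_eq

/-- Only a probabilistic internal choice can be averaged on the provided side, so at every other
sort all the branch types agree. The dual statement is `WSumL.tyEq`. -/
theorem WSumR.tyEq (h : WSumR S p As A) (hA : (S.shape A).sort ≠ .pint) (i : ι) :
    TyEq S (As i) A := by
  cases h with
  | pichoice r rs B h₁ h₂ h₃ => exact absurd (by rw [h₁.shape_eq]; rfl) hA
  | same h => exact h i

theorem WSumL.tyEq (h : WSumL S p As A) (hA : (S.shape A).sort ≠ .pext) (i : ι) :
    TyEq S (As i) A := by
  cases h with
  | pechoice r rs B h₁ h₂ h₃ => exact absurd (by rw [h₁.shape_eq]; rfl) hA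
  | same h => exact h i

/-- Averages are integrals, and they are unchanged under reindexing along a map that pushes `P`
forward to `p`. It is applied to the two projections of a product distribution. -/
theorem WSumR.comap {P : FinDist κ} {f : κ → ι} (hP : P.Marginal p f) (h : WSumR S p As A) :
    WSumR S P (fun k => As (f k)) A := by
  cases h with
  | pichoice r rs B h₁ h₂ h₃ =>
    exact .pichoice r (fun k => rs (f k)) B h₁ (fun k => h₂ _)
      fun l => by rw [h₃, hP fun i => (rs i).w l]
  | same h => exact .same fun i => h _

theorem WSumL.comap {P : FinDist κ} {f : κ → ι} (hP : P.Marginal p f) (h : WSumL S p As A) :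
    WSumL S P (fun k => As (f k)) A := by
  cases h with
  | pechoice r rs B h₁ h₂ h₃ =>
    exact .pechoice r (fun k => rs (f k)) B h₁ (fun k => h₂ _)
      fun l => by rw [h₃, hP fun i => (rs i).w l]
  | same h => exact .same fun i => h _

/-- If `p` is a mixture of the `rj j`, averaging over `p` can be done in two stages, first inside
each `rj j` and then over `j`. The intermediate types have the averaged probabilities given by
`FinDist.bind`. -/
theorem WSumR.mix (hS : S.WellFormed) {rj : κ → FinDist ι} {p' : FinDist κ}
    (hp : ∀ l, p.w l = ∑ j, p'.w j * (rj j).w l) (h : WSumR S p As A) :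
    ∃ Aj : κ → Ty, (∀ j, WSumR S (rj j) As (Aj j)) ∧ WSumR S p' Aj A := by
  cases h with
  | pichoice r rs B h₁ h₂ h₃ =>
    refine ⟨fun j => .pichoice _ ((rj j).bind rs) B, fun j => ?_, ?_⟩
    · exact .pichoice _ rs B (hS.tyEq_refl _) h₂ fun l => rfl
    · exact .pichoice r _ B h₁ (fun j => hS.tyEq_refl _) fun l => by
        rw [h₃, FinDist.sum_mix hp]; rfl
  | same h => exact ⟨fun _ => A, fun j => .same h, .same fun _ => hS.tyEq_refl _⟩

theorem WSumL.mix (hS : S.WellFormed) {rj : κ → FinDist ι} {p' : FinDist κ}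
    (hp : ∀ l, p.w l = ∑ j, p'.w j * (rj j).w l) (h : WSumL S p As A) :
    ∃ Aj : κ → Ty, (∀ j, WSumL S (rj j) As (Aj j)) ∧ WSumL S p' Aj A := by
  cases h with
  | pechoice r rs B h₁ h₂ h₃ =>
    refine ⟨fun j => .pechoice _ ((rj j).bind rs) B, fun j => ?_, ?_⟩
    · exact .pechoice _ rs B (hS.tyEq_refl _) h₂ fun l => rfl
    · exact .pechoice r _ B h₁ (fun j => hS.tyEq_refl _) fun l => by
        rw [h₃, FinDist.sum_mix hp]; rfl
  | same h => exact ⟨fun _ => A, fun j => .same h, .same fun _ => hS.tyEq_refl _⟩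

end WSum

/-! ### Contexts -/

section Ctx

variable {S : Sig} {Δ Δ' : Ctx}

theorem CtxEq.refl (hS : S.WellFormed) (Δ : Ctx) : CtxEq S Δ Δ := by
  intro x
  cases Δ x with
  | none => exact .none
  | some A => exact .some (hS.tyEq_refl A)

theorem CtxEq.trans {Δ'' : Ctx} (h : CtxEq S Δ Δ') (h' : CtxEq S Δ' Δ'') : CtxEq S Δ Δ'' := by
  intro x
  have h := h x
  have h' := h' x
  generalize Δ x = o, Δ' x = o', Δ'' x = o'' at *
  cases h <;> cases h'
  · exact .some (.trans ‹_› ‹_›)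
  · exact .none

theorem CtxEq.none_iff (h : CtxEq S Δ Δ') (x : Chan) : Δ x = none ↔ Δ' x = none := by
  have := h x
  generalize Δ x = o, Δ' x = o' at *
  cases this <;> simp

theorem CtxEq.some_left (h : CtxEq S Δ Δ') {x : Chan} {A : Ty} (hx : Δ x = some A) :
    ∃ A', Δ' x = some A' ∧ TyEq S A A' := by
  have := h x
  rw [hx] at this
  generalize Δ' x = o at this
  cases this with | some h => exact ⟨_, rfl, h⟩

theorem CtxEq.some_right (h : CtxEq S Δ Δ') {x : Chan} {A' : Ty} (hx : Δ' x = some A') :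
    ∃ A, Δ x = some A ∧ TyEq S A A' := by
  have := h x
  rw [hx] at this
  generalize Δ x = o at this
  cases this with | some h => exact ⟨_, rfl, h⟩

theorem CtxEq.set (h : CtxEq S Δ Δ') (x : Chan) {A A' : Ty} (hA : TyEq S A A') :
    CtxEq S (Δ.set x A) (Δ'.set x A') := by
  intro y
  unfold Ctx.set
  split
  · exact .some hA
  · exact h y

theorem CtxEq.erase (h : CtxEq S Δ Δ') (x : Chan) : CtxEq S (Δ.erase x) (Δ'.erase x) := by
  intro y
  unfold Ctx.erase
  split
  · exact .none
  · exact h y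

variable {ι κ : Type} [Fintype ι] [Fintype κ] {p : FinDist ι} {Δs : ι → Ctx}

theorem CtxSum.conv (h : CtxSum S p Δs Δ) (h' : CtxEq S Δ Δ') : CtxSum S p Δs Δ' := by
  intro x
  rcases h x with ⟨h₁, h₂⟩ | ⟨A, As, h₁, h₂, h₃⟩
  · exact .inl ⟨(h'.none_iff x).1 h₁, h₂⟩
  · obtain ⟨A', h₄, h₅⟩ := h'.some_left h₁
    exact .inr ⟨A', As, h₄, h₂, h₃.conv h₅⟩

theorem CtxSum.const (hS : S.WellFormed) (p : FinDist ι) (Δ : Ctx) :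
    CtxSum S p (fun _ => Δ) Δ := by
  intro x
  cases h : Δ x with
  | none => exact .inl ⟨rfl, fun _ => h⟩
  | some A => exact .inr ⟨A, fun _ => A, rfl, fun _ => h, .same fun _ => hS.tyEq_refl _⟩

theorem CtxSum.mix (hS : S.WellFormed) {rj : κ → FinDist ι} {p' : FinDist κ}
    (hp : ∀ l, p.w l = ∑ j, p'.w j * (rj j).w l) (h : CtxSum S p Δs Δ) :
    ∃ Δj : κ → Ctx, (∀ j, CtxSum S (rj j) Δs (Δj j)) ∧ CtxSum S p' Δj Δ := by
  -- The two-stage average is built channel by channel; choice then assembles the intermediate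
  -- contexts.
  have : ∀ x, ∃ o : κ → Option Ty,
      (∀ j, (o j = none ∧ ∀ i, Δs i x = none) ∨ ∃ (A : Ty) (As : ι → Ty), o j = some A ∧
        (∀ i, Δs i x = some (As i)) ∧ WSumL S (rj j) As A) ∧
      ((Δ x = none ∧ ∀ j, o j = none) ∨ ∃ (A : Ty) (As : κ → Ty), Δ x = some A ∧
        (∀ j, o j = some (As j)) ∧ WSumL S p' As A) := by
    intro x
    rcases h x with ⟨h₁, h₂⟩ | ⟨A, As, h₁, h₂, h₃⟩
    · exact ⟨fun _ => none, fun j => .inl ⟨rfl, h₂⟩, .inl ⟨h₁, fun _ => rfl⟩⟩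
    · obtain ⟨Aj, h₄, h₅⟩ := h₃.mix hS hp
      exact ⟨fun j => some (Aj j), fun j => .inr ⟨_, As, rfl, h₂, h₄ j⟩,
        .inr ⟨A, Aj, h₁, fun _ => rfl, h₅⟩⟩
  choose o h₁ h₂ using this
  exact ⟨fun j x => o x j, fun j x => h₁ x j, fun x => h₂ x⟩

theorem CtxSum.none_iff (h : CtxSum S p Δs Δ) (i : ι) (x : Chan) :
    Δs i x = none ↔ Δ x = none := by
  rcases h x with ⟨h₁, h₂⟩ | ⟨A, As, h₁, h₂, h₃⟩ <;> simp [*]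

end Ctx

/-! ### Channels and renamings of process expressions -/

theorem Name.rename_inst (ρ : Chan → Chan) (k : ℕ) (e : Chan) (x : Name) :
    (x.inst k e).rename ρ = (x.rename ρ).inst k (ρ e) := by
  cases x with
  | chan c => rfl
  | bvar j => by_cases h : j = k <;> simp [Name.inst, Name.rename, h]

theorem Name.rename_congr {ρ ρ' : Chan → Chan} {x : Name} (h : ∀ c ∈ x.chans, ρ c = ρ' c) :
    x.rename ρ = x.rename ρ' := by
  cases x <;> simp_all [Name.rename, Name.chans]

theorem Name.rename_id (x : Name) : x.rename id = x := by
  cases x <;> rfl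

theorem Name.chans_subset_inst (k : ℕ) (e : Chan) (x : Name) : x.chans ⊆ (x.inst k e).chans := by
  cases x <;> simp [Name.inst, Name.chans]

theorem Name.finite_chans (x : Name) : x.chans.Finite := by
  cases x <;> simp [Name.chans]

namespace Proc

theorem rename_inst (ρ : Chan → Chan) (e : Chan) (P : Proc) :
    ∀ k, (inst e k P).rename ρ = inst (ρ e) k (P.rename ρ) := by
  induction P <;> intro k <;>
    simp_all [inst, rename, Name.rename_inst, Function.comp_def]

theorem rename_subst (ρ : Chan → Chan) (e : Chan) (P : Proc) :
    (P.subst e).rename ρ = (P.rename ρ).subst (ρ e) :=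
  rename_inst ρ e P 0

theorem rename_congr {ρ ρ' : Chan → Chan} {P : Proc} (h : ∀ c ∈ P.chans, ρ c = ρ' c) :
    P.rename ρ = P.rename ρ' := by
  induction P with
  | spawn f ys Q ih =>
    simp only [rename, chans, Set.mem_union, Set.mem_iUnion] at h ⊢
    rw [ih fun c hc => h c (.inr hc)]
    congr 1
    exact List.map_congr_left fun y hy =>
      Name.rename_congr fun c hc => h c (.inl ⟨y, hy, hc⟩)
  | caseL x L P ih =>
    simp only [rename, chans, Set.mem_union, Set.mem_iUnion] at h ⊢
    rw [Name.rename_congr fun c hc => h c (.inl hc)]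
    congr 1
    exact funext fun l => ih l fun c hc => h c (.inr ⟨l, hc⟩)
  | pcase x L P ih =>
    simp only [rename, chans, Set.mem_union, Set.mem_iUnion] at h ⊢
    rw [Name.rename_congr fun c hc => h c (.inl hc)]
    congr 1
    exact funext fun l => ih l fun c hc => h c (.inr ⟨l, hc⟩)
  | sendC x y P ih | fwd x y =>
    simp only [rename, chans, Set.mem_union] at h ⊢
    congr 1 <;> first
      | exact Name.rename_congr fun c hc => h c (by tauto)
      | exact ih fun c hc => h c (by tauto)
  | close x =>
    simp only [rename, chans] at h ⊢
    rw [Name.rename_congr h]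
  | work r P ih =>
    simp only [rename, chans] at h ⊢
    rw [ih h]
  | flip p hp PH PT ih ih' =>
    simp only [rename, chans, Set.mem_union] at h ⊢
    rw [ih fun c hc => h c (.inl hc), ih' fun c hc => h c (.inr hc)]
  | _ x =>
    rename_i ih
    simp only [rename, chans, Set.mem_union] at h ⊢
    rw [ih fun c hc => h c (.inr hc), Name.rename_congr fun c hc => h c (.inl hc)]

theorem rename_id (P : Proc) : P.rename id = P := by
  have : Name.rename id = id := funext Name.rename_id
  induction P <;> simp_all [rename]

/-- Instantiation only adds a channel. Thus a channel of the body of a binder is still visible in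
each instance that a typing rule mentions. -/
theorem chans_subset_inst (e : Chan) (P : Proc) : ∀ k, P.chans ⊆ (inst e k P).chans := by
  have key : ∀ k (x : Name), x.chans ⊆ (x.inst k e).chans :=
    fun k x => Name.chans_subset_inst k e x
  induction P with
  | spawn f ys Q ih =>
    intro k
    simp only [inst, chans]
    refine Set.union_subset_union ?_ (ih _)
    simp only [List.mem_map, Set.iUnion_exists, Set.biUnion_and', Set.iUnion_iUnion_eq_right]
    exact Set.iUnion₂_mono fun y _ => key k y
  | caseL x L P ih | pcase x L P ih =>
    intro k
    exact Set.union_subset_union (key k x) (Set.iUnion_mono fun l => ih l k)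
  | sendC x y P ih =>
    intro k
    exact Set.union_subset_union (Set.union_subset_union (key k x) (key k y)) (ih k)
  | fwd x y => intro k; exact Set.union_subset_union (key k x) (key k y)
  | close x => intro k; exact key k x
  | work r P ih => intro k; exact ih k
  | flip p hp PH PT ih ih' => intro k; exact Set.union_subset_union (ih k) (ih' k)
  | _ x =>
    rename_i ih
    intro k
    exact Set.union_subset_union (key k x) (ih _)

theorem chans_subset_subst (e : Chan) (P : Proc) : P.chans ⊆ (P.subst e).chans :=
  chans_subset_inst e P 0

theorem finite_chans (P : Proc) : P.chans.Finite := by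
  induction P with
  | spawn f ys Q ih =>
    refine Set.Finite.union ?_ ih
    exact Set.Finite.biUnion (s := {y | y ∈ ys}) (List.finite_toSet ys)
      fun y _ => y.finite_chans
  | caseL x L P ih | pcase x L P ih =>
    exact x.finite_chans.union (Set.finite_iUnion ih)
  | sendC x y P ih => exact (x.finite_chans.union y.finite_chans).union ih
  | fwd x y => exact x.finite_chans.union y.finite_chans
  | close x => exact x.finite_chans
  | work r P ih => exact ih
  | flip p hp PH PT ih ih' => exact ih.union ih'
  | _ x =>
    rename_i ih
    exact x.finite_chans.union ih

theorem rename_eq_self {ρ : Chan → Chan} {P : Proc} (h : ∀ c ∈ P.chans, ρ c = c) :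
    P.rename ρ = P :=
  (rename_congr h).trans P.rename_id

end Proc

/-! ### Renaming of contexts -/

namespace Ctx

theorem ofList_eq_none_iff {l : List (Chan × Ty)} {x : Chan} :
    ofList l x = none ↔ x ∉ l.map Prod.fst := by
  simp only [ofList, List.lookup_eq_none_iff, List.mem_map, not_exists, not_and]
  constructor
  · rintro h a ha rfl; simpa using h a ha
  · rintro h a ha; simpa using fun h' => h a ha h'.symm

theorem ofList_zip_eq_none {ys : List Chan} {As : List Ty} {x : Chan} (h : x ∉ ys) :
    ofList (ys.zip As) x = none := by
  rw [ofList_eq_none_iff]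
  intro h'
  obtain ⟨a, ha, rfl⟩ := List.mem_map.1 h'
  exact h (List.of_mem_zip ha).1

/-- Rename the channels of a context. -/
def perm (σ : Equiv.Perm Chan) (Δ : Ctx) : Ctx := fun x => Δ (σ.symm x)

variable (σ : Equiv.Perm Chan) (Δ Δ' : Ctx)

theorem perm_apply (x : Chan) : Δ.perm σ (σ x) = Δ x := by simp [perm]

theorem perm_set (x : Chan) (A : Ty) : (Δ.set x A).perm σ = (Δ.perm σ).set (σ x) A := by
  ext1 y; simp [perm, set, Equiv.symm_apply_eq]

theorem perm_erase (x : Chan) : (Δ.erase x).perm σ = (Δ.perm σ).erase (σ x) := by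
  ext1 y; simp [perm, erase, Equiv.symm_apply_eq]

theorem perm_single (x : Chan) (A : Ty) : (single x A).perm σ = single (σ x) A := by
  ext1 y; simp [perm, single, Equiv.symm_apply_eq]

theorem perm_join : (Δ.join Δ').perm σ = (Δ.perm σ).join (Δ'.perm σ) := rfl

theorem perm_ofList (l : List (Chan × Ty)) :
    (ofList l).perm σ = ofList (l.map fun a => (σ a.1, a.2)) := by
  ext1 y
  induction l with
  | nil => rfl
  | cons a l ih =>
    obtain ⟨a, A⟩ := a
    simp only [perm, ofList] at ih
    simp only [perm, ofList, List.lookup_cons, List.map_cons, ih]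
    by_cases h : y = σ a
    · simp [h]
    · have : σ.symm y ≠ a := fun h' => h (by simp [← h'])
      rw [beq_false_of_ne h, beq_false_of_ne this]

theorem perm_ofList_zip (ys : List Chan) (As : List Ty) :
    (ofList (ys.zip As)).perm σ = ofList ((ys.map σ).zip As) := by
  rw [perm_ofList, List.zip_map_left]; rfl

end Ctx

theorem CtxEq.perm {S : Sig} {Δ Δ' : Ctx} (σ : Equiv.Perm Chan) (h : CtxEq S Δ Δ') :
    CtxEq S (Δ.perm σ) (Δ'.perm σ) := fun _ => h _

theorem CtxSum.perm {S : Sig} {ι : Type} [Fintype ι] {p : FinDist ι} {Δs : ι → Ctx} {Δ : Ctx}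
    (σ : Equiv.Perm Chan) (h : CtxSum S p Δs Δ) :
    CtxSum S p (fun i => (Δs i).perm σ) (Δ.perm σ) := fun _ => h _

theorem exists_fresh (F G : Finset Chan) : ∃ x, x ∉ F ∧ x ∉ G := by
  obtain ⟨x, hx⟩ := Infinite.exists_notMem_finset (F ∪ G)
  exact ⟨x, by simp_all⟩

/-! ### Structural properties of process typing -/

section Typed

variable {S : Sig} {Δ : Ctx} {q : ℚ≥0} {P : Proc} {z : Chan} {A : Ty}

open Ctx in
-- The rules for deterministic `case` need the explicit premise `Δ z = none`, since with an empty
-- label set they have no typing premise to inherit this from. A probabilistic choice always has a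
-- label, because its weights sum to one.
theorem Typed.ctx_self (h : Typed S Δ q P z A) : Δ z = none := by
  induction h with
  | conv h hc ht ih => exact (hc.none_iff _).1 ih
  | weak r h hq ih => exact ih
  | echoiceR hz h ih => exact hz
  | ichoiceL hz hx h ih => exact hz
  | echoiceL hk hx h ih | payL hx h ih => grind [Ctx.set]
  | getL hx h hq ih => grind [Ctx.set]
  | ichoiceR hk h ih => exact ih
  | tensorR hy hA h ih => grind [Ctx.erase]
  | @tensorL Δ q z C x Q A B F hx h ih =>
    obtain ⟨y, hy, hz⟩ := exists_fresh F {z}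
    have := ih y hy
    grind [Ctx.set]
  | @lolliR Δ q z P A B F h ih =>
    obtain ⟨y, hy, hz⟩ := exists_fresh F {z}
    have := ih y hy
    grind [Ctx.set]
  | lolliL hxy hyz hx hy h ih => grind [Ctx.set, Ctx.erase]
  | oneR => rfl
  | oneL hxz hx h ih => grind [Ctx.erase]
  | id h => grind [Ctx.single]
  | @spawn Δ Δ₀ q r z C f Q D ys F hf hl hn hz hd hΔ hr h ih =>
    obtain ⟨y, hy, hz'⟩ := exists_fresh F {z}
    have h₁ := ih y hy
    have h₂ := ofList_zip_eq_none (As := D.args.map Prod.snd) hz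
    subst hΔ
    have : Δ₀ z = none := by grind [Ctx.set]
    simp [Ctx.join, this, h₂]
  | payR h hq ih => exact ih
  | getR h ih => exact ih
  | work h hq ih => exact ih
  | flip hs hw hq h₀ h₁ ih₀ ih₁ => exact (hs.none_iff 0 _).1 ih₀
  | @pichoiceL Δ q z C x L p Q A Cs Δs qs hx h hq hs hw ih =>
    obtain ⟨l⟩ := p.nonempty
    have h₁ := ih l
    have h₂ := hs.none_iff l z
    grind [Ctx.set, Ctx.erase]
  | pichoiceR hk hp hp' h ih => exact ih
  | pechoiceL hk hp hp' hx h ih => grind [Ctx.set]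
  | @pechoiceR Δ q z L p P A Δs qs h hq hs ih =>
    obtain ⟨l⟩ := p.nonempty
    exact (hs.none_iff l z).1 (ih l)

open Ctx in
-- For binders, the bound channel is chosen different from the channel in question. The converse
-- inclusion fails: a `case` with no branches along the provided channel is typed in every context
-- that omits that channel. In particular contexts need not be finite.
theorem Typed.chans (h : Typed S Δ q P z A) : ∀ c ∈ P.chans, c ≠ z → Δ c ≠ none := by
  induction h with
  | conv h hc ht ih => exact fun c hc' hz => fun h' => ih c hc' hz ((hc.none_iff _).2 h')
  | weak r h hq ih => exact ih
  | echoiceR hz h ih => grind [Proc.chans, Name.chans, Set.mem_iUnion]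
  | ichoiceL hz hx h ih => grind [Proc.chans, Name.chans, Set.mem_iUnion, Ctx.set]
  | echoiceL hk hx h ih | payL hx h ih | ichoiceR hk h ih | getR h ih =>
    grind [Ctx.set, Proc.chans, Name.chans]
  | getL hx h hq ih => grind [Ctx.set, Proc.chans, Name.chans]
  | tensorR hy hA h ih => grind [Ctx.erase, Proc.chans, Name.chans]
  | @tensorL Δ q z C x Q A B F hx h ih =>
    intro c hc hz
    obtain ⟨y, hy, hy'⟩ := exists_fresh F {c}
    have := ih y hy c
    have := @Proc.chans_subset_subst y Q c
    grind [Ctx.set, Proc.chans, Name.chans]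
  | @lolliR Δ q z P A B F h ih =>
    intro c hc hz
    obtain ⟨y, hy, hy'⟩ := exists_fresh F {c}
    have := ih y hy c
    have := @Proc.chans_subset_subst y P c
    grind [Ctx.set, Proc.chans, Name.chans]
  | lolliL hxy hyz hx hy h ih => grind [Ctx.set, Ctx.erase, Proc.chans, Name.chans]
  | oneR => grind [Proc.chans, Name.chans]
  | oneL hxz hx h ih => grind [Ctx.erase, Proc.chans, Name.chans]
  | id h => grind [Ctx.single, Proc.chans, Name.chans]
  | @spawn Δ Δ₀ q r z C f Q D ys F hf hl hn hz hd hΔ hr h ih =>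
    intro c hc hz
    obtain ⟨y, hy, hy'⟩ := exists_fresh F {c}
    have h₁ := ih y hy c
    have h₂ := @Proc.chans_subset_subst y Q c
    subst hΔ
    simp only [Ctx.join, ne_eq, Option.or_eq_none_iff, not_and]
    intro h₃
    have h₄ : c ∈ ys := by
      simp only [Proc.chans, List.mem_map, Set.iUnion_exists, Set.biUnion_and',
        Set.iUnion_iUnion_eq_right, Set.mem_union, Set.mem_iUnion] at hc
      rcases hc with ⟨i, hi, hc⟩ | hc
      · simp only [Name.chans, Set.mem_singleton_iff] at hc; exact hc ▸ hi
      · exact absurd h₃ (by grind [Ctx.set])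
    rw [ofList_eq_none_iff, not_not, List.map_fst_zip (by simp [hl])]
    exact h₄
  | payR h hq ih => grind [Proc.chans, Name.chans]
  | work h hq ih => exact ih
  | flip hs hw hq h₀ h₁ ih₀ ih₁ =>
    intro c hc hz
    rcases hc with hc | hc
    · exact fun h => ih₀ c hc hz ((hs.none_iff 0 _).2 h)
    · exact fun h => ih₁ c hc hz ((hs.none_iff 1 _).2 h)
  | @pichoiceL Δ q z C x L p Q A Cs Δs qs hx h hq hs hw ih =>
    intro c hc hz
    rcases hc with hc | hc
    · grind [Name.chans]
    · obtain ⟨l, hc⟩ := Set.mem_iUnion.1 hc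
      have h₁ := ih l c hc hz
      have h₂ := hs.none_iff l c
      grind [Ctx.set, Ctx.erase]
  | pichoiceR hk hp hp' h ih => grind [Proc.chans, Name.chans]
  | pechoiceL hk hp hp' hx h ih => grind [Ctx.set, Proc.chans, Name.chans]
  | @pechoiceR Δ q z L p P A Δs qs h hq hs ih =>
    intro c hc hz
    rcases hc with hc | hc
    · exact absurd hc hz
    · obtain ⟨l, hc⟩ := Set.mem_iUnion.1 hc
      exact fun h' => ih l c hc hz ((hs.none_iff l c).2 h')

open Ctx in
/-- Typing is equivariant. -/
theorem Typed.perm (σ : Equiv.Perm Chan) (h : Typed S Δ q P z A) :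
    Typed S (Δ.perm σ) q (P.rename σ) (σ z) A := by
  have mem : ∀ (F : Finset Chan) y, y ∉ F.map σ.toEmbedding → σ.symm y ∉ F := by
    intro F y hy h; exact hy (Finset.mem_map.2 ⟨_, h, by simp⟩)
  have pa := perm_apply σ
  induction h with
  | conv h hc ht ih => exact .conv ih (hc.perm σ) ht
  | weak r h hq ih => exact .weak r ih hq
  | echoiceR hz h ih => exact .echoiceR (by rw [pa, hz]) ih
  | echoiceL hk hx h ih => exact .echoiceL hk (by rw [pa, hx]) (perm_set .. ▸ ih)
  | ichoiceR hk h ih => exact .ichoiceR hk ih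
  | ichoiceL hz hx h ih =>
    exact .ichoiceL (by rw [pa, hz]) (by rw [pa, hx]) fun l => perm_set .. ▸ ih l
  | tensorR hy hA h ih =>
    exact .tensorR (by simpa using hy) (by rw [pa, hA]) (perm_erase .. ▸ ih)
  | @tensorL Δ q z C x Q A B F hx h ih =>
    refine .tensorL (F.map σ.toEmbedding) (by rw [pa, hx]) fun y hy => ?_
    have := ih _ (mem F y hy)
    rwa [perm_set, perm_set, Proc.rename_subst, Equiv.apply_symm_apply] at this
  | @lolliR Δ q z P A B F h ih =>
    refine .lolliR (F.map σ.toEmbedding) fun y hy => ?_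
    have := ih _ (mem F y hy)
    rwa [perm_set, Proc.rename_subst, Equiv.apply_symm_apply] at this
  | lolliL hxy hyz hx hy h ih =>
    rw [perm_set, perm_erase] at ih
    exact .lolliL (by simpa using hxy) (by simpa using hyz) (by rw [pa, hx]) (by rw [pa, hy]) ih
  | oneR => exact .oneR
  | oneL hxz hx h ih => exact .oneL (by simpa using hxz) (by rw [pa, hx]) (perm_erase .. ▸ ih)
  | id h => rw [perm_single]; exact .id (by simpa using h)
  | @spawn Δ Δ₀ q r z C f Q D ys F hf hl hn hz hd hΔ hr h ih =>
    have e : (ys.map Name.chan).map (Name.rename σ) = (ys.map σ).map Name.chan := by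
      simp [Name.rename, Function.comp_def]
    rw [Proc.rename, e]
    refine .spawn (Δ₀ := Δ₀.perm σ) (F.map σ.toEmbedding) hf (by simpa using hl)
      (hn.map σ.injective) (by simpa using hz) ?_ ?_ hr fun y hy => ?_
    · rw [← perm_ofList_zip]; exact fun x => hd _
    · rw [hΔ, ← perm_ofList_zip, perm_join]
    · have := ih _ (mem F y hy)
      rwa [perm_set, Proc.rename_subst, Equiv.apply_symm_apply] at this
  | payR h hq ih => exact .payR ih hq
  | payL hx h ih => exact .payL (by rw [pa, hx]) (perm_set .. ▸ ih)
  | getR h ih => exact .getR ih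
  | getL hx h hq ih => exact .getL (by rw [pa, hx]) (perm_set .. ▸ ih) hq
  | work h hq ih => exact .work ih hq
  | flip hs hw hq h₀ h₁ ih₀ ih₁ => exact .flip (hs.perm σ) hw hq ih₀ ih₁
  | @pichoiceL Δ q z C x L p Q A Cs Δs qs hx h hq hs hw ih =>
    exact .pichoiceL (Δs := fun l => (Δs l).perm σ) (by rw [pa, hx])
      (fun l => perm_set .. ▸ ih l) hq (perm_erase .. ▸ hs.perm σ) hw
  | pichoiceR hk hp hp' h ih => exact .pichoiceR hk hp hp' ih
  | pechoiceL hk hp hp' hx h ih =>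
    exact .pechoiceL hk hp hp' (by rw [pa, hx]) (perm_set .. ▸ ih)
  | @pechoiceR Δ q z L p P A Δs qs h hq hs ih =>
    exact .pechoiceR (Δs := fun l => (Δs l).perm σ) ih hq (hs.perm σ)

end Typed

/-! ### Inversion and substitution -/

open Name in
/-- The typing judgment with a last rule that is neither a conversion nor a weakening. -/
inductive TypedSD (S : Sig) : Ctx → ℚ≥0 → Proc → Chan → Ty → Prop
  | echoiceR {Δ q z} {L : Finset Label} {P : {ℓ // ℓ ∈ L} → Proc} {A : {ℓ // ℓ ∈ L} → Ty} :
      Δ z = none → (∀ l, Typed S Δ q (P l) z (A l)) →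
      TypedSD S Δ q (.caseL (chan z) L P) z (.echoice L A)
  | echoiceL {Δ q z C x k Q} {L : Finset Label} {A : {ℓ // ℓ ∈ L} → Ty} (hk : k ∈ L) :
      Δ x = some (.echoice L A) → Typed S (Δ.set x (A ⟨k, hk⟩)) q Q z C →
      TypedSD S Δ q (.sendL (chan x) k Q) z C
  | ichoiceR {Δ q z k P} {L : Finset Label} {A : {ℓ // ℓ ∈ L} → Ty} (hk : k ∈ L) :
      Typed S Δ q P z (A ⟨k, hk⟩) → TypedSD S Δ q (.sendL (chan z) k P) z (.ichoice L A)
  | ichoiceL {Δ q z C x} {L : Finset Label} {Q : {ℓ // ℓ ∈ L} → Proc} {A : {ℓ // ℓ ∈ L} → Ty} :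
      Δ z = none → Δ x = some (.ichoice L A) →
      (∀ l, Typed S (Δ.set x (A l)) q (Q l) z C) →
      TypedSD S Δ q (.caseL (chan x) L Q) z C
  | tensorR {Δ q z y P A B} : y ≠ z → Δ y = some A → Typed S (Δ.erase y) q P z B →
      TypedSD S Δ q (.sendC (chan z) (chan y) P) z (.tensor A B)
  | tensorL {Δ q z C x Q A B} (F : Finset Chan) : Δ x = some (.tensor A B) →
      (∀ y, y ∉ F → Typed S ((Δ.set x B).set y A) q (Q.subst y) z C) →
      TypedSD S Δ q (.recvC (chan x) Q) z C
  | lolliR {Δ q z P A B} (F : Finset Chan) :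
      (∀ y, y ∉ F → Typed S (Δ.set y A) q (P.subst y) z B) →
      TypedSD S Δ q (.recvC (chan z) P) z (.lolli A B)
  | lolliL {Δ q z C x y Q A B} : x ≠ y → y ≠ z → Δ x = some (.lolli A B) → Δ y = some A →
      Typed S ((Δ.erase y).set x B) q Q z C →
      TypedSD S Δ q (.sendC (chan x) (chan y) Q) z C
  | oneR {z} : TypedSD S Ctx.empty 0 (.close (chan z)) z .one
  | oneL {Δ q z C x Q} : x ≠ z → Δ x = some .one → Typed S (Δ.erase x) q Q z C →
      TypedSD S Δ q (.wait (chan x) Q) z C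
  | id {x y A} : x ≠ y → TypedSD S (Ctx.single y A) 0 (.fwd (chan x) (chan y)) x A
  | spawn {Δ Δ₀ : Ctx} {q r z C f Q} {D : PDef} {ys : List Chan} (F : Finset Chan) :
      S.pdef f = some D → ys.length = D.args.length → ys.Nodup → z ∉ ys →
      Δ₀.Disj (Ctx.ofList (ys.zip (D.args.map Prod.snd))) →
      Δ = Δ₀.join (Ctx.ofList (ys.zip (D.args.map Prod.snd))) → r = D.pot + q →
      (∀ x, x ∉ F → Typed S (Δ₀.set x D.ty) q (Q.subst x) z C) →
      TypedSD S Δ r (.spawn f (ys.map chan) Q) z C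
  | payR {Δ q q' z r P A} : Typed S Δ q' P z A → q = q' + r →
      TypedSD S Δ q (.pay (chan z) r P) z (.payPot r A)
  | payL {Δ q z C x r Q A} : Δ x = some (.payPot r A) →
      Typed S (Δ.set x A) (q + r) Q z C → TypedSD S Δ q (.get (chan x) r Q) z C
  | getR {Δ q z r P A} : Typed S Δ (q + r) P z A →
      TypedSD S Δ q (.get (chan z) r P) z (.getPot r A)
  | getL {Δ q q' z C x r Q A} : Δ x = some (.getPot r A) →
      Typed S (Δ.set x A) q' Q z C → q = q' + r → TypedSD S Δ q (.pay (chan x) r Q) z C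
  | work {Δ q q' z r P A} : Typed S Δ q' P z A → q = q' + r → TypedSD S Δ q (.work r P) z A
  | flip {Δ q z p hp PH PT A} {Δs : Fin 2 → Ctx} {qs : Fin 2 → ℚ≥0} {As : Fin 2 → Ty} :
      CtxSum S (FinDist.coin p hp) Δs Δ → WSumR S (FinDist.coin p hp) As A →
      q = p * qs 0 + (1 - p) * qs 1 →
      Typed S (Δs 0) (qs 0) PH z (As 0) → Typed S (Δs 1) (qs 1) PT z (As 1) →
      TypedSD S Δ q (.flip p hp PH PT) z A
  | pichoiceL {Δ q z C x} {L : Finset Label} {p : FinDist {ℓ // ℓ ∈ L}}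
      {Q : {ℓ // ℓ ∈ L} → Proc} {A Cs : {ℓ // ℓ ∈ L} → Ty} {Δs : {ℓ // ℓ ∈ L} → Ctx}
      {qs : {ℓ // ℓ ∈ L} → ℚ≥0} :
      Δ x = some (.pichoice L p A) →
      (∀ l, Typed S ((Δs l).set x (A l)) (qs l) (Q l) z (Cs l)) →
      q = ∑ l, p.w l * qs l → CtxSum S p Δs (Δ.erase x) → WSumR S p Cs C →
      TypedSD S Δ q (.pcase (chan x) L Q) z C
  | pichoiceR {Δ q z k P} {L : Finset Label} {p : FinDist {ℓ // ℓ ∈ L}}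
      {A : {ℓ // ℓ ∈ L} → Ty} (hk : k ∈ L) :
      p.w ⟨k, hk⟩ = 1 → (∀ l, l ≠ ⟨k, hk⟩ → p.w l = 0) → Typed S Δ q P z (A ⟨k, hk⟩) →
      TypedSD S Δ q (.psend (chan z) k P) z (.pichoice L p A)
  | pechoiceL {Δ q z C x k Q} {L : Finset Label} {p : FinDist {ℓ // ℓ ∈ L}}
      {A : {ℓ // ℓ ∈ L} → Ty} (hk : k ∈ L) :
      p.w ⟨k, hk⟩ = 1 → (∀ l, l ≠ ⟨k, hk⟩ → p.w l = 0) → Δ x = some (.pechoice L p A) →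
      Typed S (Δ.set x (A ⟨k, hk⟩)) q Q z C →
      TypedSD S Δ q (.psend (chan x) k Q) z C
  | pechoiceR {Δ q z} {L : Finset Label} {p : FinDist {ℓ // ℓ ∈ L}}
      {P : {ℓ // ℓ ∈ L} → Proc} {A : {ℓ // ℓ ∈ L} → Ty} {Δs : {ℓ // ℓ ∈ L} → Ctx}
      {qs : {ℓ // ℓ ∈ L} → ℚ≥0} :
      (∀ l, Typed S (Δs l) (qs l) (P l) z (A l)) →
      q = ∑ l, p.w l * qs l → CtxSum S p Δs Δ →
      TypedSD S Δ q (.pcase (chan z) L P) z (.pechoice L p A)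

section Typed

variable {S : Sig} {Δ : Ctx} {q : ℚ≥0} {P : Proc} {z : Chan} {A : Ty}

/-- Conversions and weakenings at the root of a derivation accumulate into one type equality, one
context equality and one amount `r` of discarded potential. -/
theorem Typed.inv (hS : S.WellFormed) (h : Typed S Δ q P z A) :
    ∃ Δ' q' A' r, TypedSD S Δ' q' P z A' ∧ CtxEq S Δ' Δ ∧ TyEq S A' A ∧ q = q' + r := by
  have rfl_ : ∀ {Δ q P z A}, TypedSD S Δ q P z A →
      ∃ Δ' q' A' r, TypedSD S Δ' q' P z A' ∧ CtxEq S Δ' Δ ∧ TyEq S A' A ∧ q = q' + r :=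
    fun h => ⟨_, _, _, 0, h, .refl hS _, hS.tyEq_refl _, (add_zero _).symm⟩
  induction h with
  | conv h hc ht ih =>
    obtain ⟨Δ', q', A', r, h₁, h₂, h₃, h₄⟩ := ih
    exact ⟨Δ', q', A', r, h₁, h₂.trans hc, h₃.trans ht, h₄⟩
  | weak r h hq ih =>
    obtain ⟨Δ', q', A', r', h₁, h₂, h₃, h₄⟩ := ih
    exact ⟨Δ', q', A', r' + r, h₁, h₂, h₃, by rw [hq, h₄, add_assoc]⟩
  | echoiceR h₁ h₂ => exact rfl_ (.echoiceR h₁ h₂)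
  | echoiceL h₁ h₂ h₃ => exact rfl_ (.echoiceL h₁ h₂ h₃)
  | ichoiceR h₁ h₂ => exact rfl_ (.ichoiceR h₁ h₂)
  | ichoiceL h₁ h₂ h₃ => exact rfl_ (.ichoiceL h₁ h₂ h₃)
  | tensorR h₁ h₂ h₃ => exact rfl_ (.tensorR h₁ h₂ h₃)
  | tensorL F h₁ h₂ => exact rfl_ (.tensorL F h₁ h₂)
  | lolliR F h₁ => exact rfl_ (.lolliR F h₁)
  | lolliL h₁ h₂ h₃ h₄ h₅ => exact rfl_ (.lolliL h₁ h₂ h₃ h₄ h₅)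
  | oneR => exact rfl_ .oneR
  | oneL h₁ h₂ h₃ => exact rfl_ (.oneL h₁ h₂ h₃)
  | id h₁ => exact rfl_ (.id h₁)
  | spawn F h₁ h₂ h₃ h₄ h₅ h₆ h₇ h₈ => exact rfl_ (.spawn F h₁ h₂ h₃ h₄ h₅ h₆ h₇ h₈)
  | payR h₁ h₂ => exact rfl_ (.payR h₁ h₂)
  | payL h₁ h₂ => exact rfl_ (.payL h₁ h₂)
  | getR h₁ => exact rfl_ (.getR h₁)
  | getL h₁ h₂ h₃ => exact rfl_ (.getL h₁ h₂ h₃)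
  | work h₁ h₂ => exact rfl_ (.work h₁ h₂)
  | flip h₁ h₂ h₃ h₄ h₅ => exact rfl_ (.flip h₁ h₂ h₃ h₄ h₅)
  | pichoiceL h₁ h₂ h₃ h₄ h₅ => exact rfl_ (.pichoiceL h₁ h₂ h₃ h₄ h₅)
  | pichoiceR h₁ h₂ h₃ h₄ => exact rfl_ (.pichoiceR h₁ h₂ h₃ h₄)
  | pechoiceL h₁ h₂ h₃ h₄ h₅ => exact rfl_ (.pechoiceL h₁ h₂ h₃ h₄ h₅)
  | pechoiceR h₁ h₂ h₃ => exact rfl_ (.pechoiceR h₁ h₂ h₃)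

/-- A body that is typed for fresh bound channels is typed for every unused channel. -/
theorem Typed.subst_of_cofinite {Q : Proc} {B : Ty} {e : Chan} {F : Finset Chan}
    (hΔ : {x | Δ x ≠ none}.Finite) (h : ∀ y, y ∉ F → Typed S (Δ.set y B) q (Q.subst y) z A)
    (he : e ≠ z) (he' : Δ e = none) : Typed S (Δ.set e B) q (Q.subst e) z A := by
  -- With `y` outside the context, the body and `{z, e}`, the transposition of `y` and `e` fixes
  -- everything except the bound channel. Finiteness of the context is what makes such a `y`
  -- available.
  obtain ⟨y, hy, hy'⟩ := exists_fresh F (hΔ.toFinset ∪ Q.finite_chans.toFinset ∪ {z, e})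
  simp only [Finset.mem_union, Set.Finite.mem_toFinset, Set.mem_ofPred_eq, Finset.mem_insert,
    Finset.mem_singleton, not_or, not_not] at hy'
  obtain ⟨⟨hyΔ, hyQ⟩, hyz, hye⟩ := hy'
  have heQ : e ∉ Q.chans := by
    intro hc
    have := (h y hy).chans e (Q.chans_subset_subst y hc) he
    simp [Ctx.set, Ne.symm hye, he'] at this
  have key := (h y hy).perm (Equiv.swap y e)
  rw [Proc.rename_subst, Proc.rename_eq_self, Equiv.swap_apply_left,
    Equiv.swap_apply_of_ne_of_ne (Ne.symm hyz) (Ne.symm he), Ctx.perm_set,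
    Equiv.swap_apply_left] at key
  · convert key using 2
    ext1 x
    simp only [Ctx.perm, Equiv.symm_swap]
    by_cases h₁ : x = y
    · simp [h₁, he', hyΔ]
    by_cases h₂ : x = e
    · simp [h₂, he', hyΔ]
    · rw [Equiv.swap_apply_of_ne_of_ne h₁ h₂]
  · intro c hc
    refine Equiv.swap_apply_of_ne_of_ne ?_ ?_ <;> rintro rfl <;> contradiction

/-- As `e` is not in the context and is not provided, it does not occur in `P`. Replacing `d` by `e`
therefore agrees with the transposition of the two, and equivariance applies. -/
theorem Typed.replace {d e : Chan} {B : Ty} (h : Typed S Δ q P z A) (hd : Δ d = some B)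
    (he : Δ e = none) (hez : e ≠ z) :
    Typed S ((Δ.erase d).set e B) q (P.replace d e) z A := by
  have hdz : d ≠ z := by rintro rfl; simp [h.ctx_self] at hd
  have hP : e ∉ P.chans := fun hc => h.chans e hc hez he
  have key := h.perm (Equiv.swap d e)
  rw [Equiv.swap_apply_of_ne_of_ne hdz.symm hez.symm] at key
  have hr : P.replace d e = P.rename (Equiv.swap d e) := by
    refine Proc.rename_congr fun c hc => ?_
    by_cases hcd : c = d
    · simp [hcd]
    · have hce : c ≠ e := fun h => hP (h ▸ hc)
      rw [Equiv.swap_apply_of_ne_of_ne hcd hce, if_neg hcd]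
  rw [hr]
  convert key using 1
  ext1 x
  simp only [Ctx.perm, Equiv.symm_swap, Ctx.set, Ctx.erase]
  by_cases h₁ : x = e
  · simp [h₁, hd]
  by_cases h₂ : x = d
  · rw [if_neg h₁, if_pos h₂, h₂, Equiv.swap_apply_left, he]
  · rw [if_neg h₁, if_neg h₂, Equiv.swap_apply_of_ne_of_ne h₂ h₁]

end Typed

/-- The symmetric group is multiply transitive. Hence instantiating the parameters of a definition
can be treated by equivariance under a permutation. -/
theorem exists_perm_map_eq {ks vs : List Chan} (hk : ks.Nodup) (hv : vs.Nodup)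
    (hl : ks.length = vs.length) : ∃ σ : Equiv.Perm Chan, ks.map σ = vs := by
  have := Equiv.Perm.isMultiplyPretransitive Chan ks.length
  let f : Fin ks.length ↪ Chan := ⟨ks.get, List.nodup_iff_injective_get.1 hk⟩
  let g : Fin ks.length ↪ Chan :=
    ⟨fun i => vs.get (i.cast hl), (List.nodup_iff_injective_get.1 hv).comp (Fin.cast_injective hl)⟩
  obtain ⟨σ, hσ⟩ := MulAction.exists_smul_eq (Equiv.Perm Chan) f g
  refine ⟨σ, List.ext_getElem (by simp [hl]) fun i h₁ h₂ => ?_⟩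
  have := DFunLike.congr_fun hσ ⟨i, by simpa using h₁⟩
  simpa [f, g] using this

theorem map_lookup_zip {ks vs : List Chan} (hk : ks.Nodup) (hl : ks.length = vs.length) :
    ks.map (fun y => ((ks.zip vs).lookup y).getD y) = vs := by
  induction ks generalizing vs with
  | nil => simpa using (List.length_eq_zero_iff.1 hl.symm).symm
  | cons k ks ih =>
    cases vs with
    | nil => simp at hl
    | cons v vs =>
      simp only [List.nodup_cons] at hk
      simp only [List.length_cons, add_left_inj] at hl
      simp only [List.map_cons, List.zip_cons_cons, List.lookup_cons, BEq.rfl, Option.getD_some,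
        List.cons.injEq, true_and]
      conv_rhs => rw [← ih hk.2 hl]
      refine List.map_congr_left fun y hy => ?_
      have hyk : y ≠ k := fun h => hk.1 (h ▸ hy)
      rw [beq_false_of_ne hyk]

/-- The body of a process definition, instantiated at a spawn. -/
theorem Sig.WellFormed.typed_body {S : Sig} (hS : S.WellFormed) {f : PName} {D : PDef}
    (hD : S.pdef f = some D) {ds : List Chan} {b : Chan} (hl : ds.length = D.args.length)
    (hn : ds.Nodup) (hb : b ∉ ds) :
    Typed S (Ctx.ofList (ds.zip (D.args.map Prod.snd))) D.pot (D.body.rename (D.ren b ds)) b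
      D.ty := by
  have ht := hS.typed f D hD
  have ho : D.out ∉ D.args.map Prod.fst := Ctx.ofList_eq_none_iff.1 ht.ctx_self
  have hl' : (D.args.map Prod.fst).length = ds.length := by simp [hl]
  -- The provided channel is put in the list with the arguments, so that one permutation performs
  -- the whole renaming. The two renamings need to agree only on the channels of the body, all of
  -- which are parameters.
  obtain ⟨σ, hσ⟩ := exists_perm_map_eq (ks := D.out :: D.args.map Prod.fst) (vs := b :: ds)
    (List.nodup_cons.2 ⟨ho, hS.nodup f D hD⟩) (List.nodup_cons.2 ⟨hb, hn⟩) (by simp [hl])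
  simp only [List.map_cons, List.cons.injEq] at hσ
  have hr : D.body.rename (D.ren b ds) = D.body.rename σ := by
    refine Proc.rename_congr fun c hc => ?_
    unfold PDef.ren
    split_ifs with h
    · rw [h, hσ.1]
    · have hc' : c ∈ D.args.map Prod.fst := by
        by_contra h'
        exact ht.chans c hc h (Ctx.ofList_eq_none_iff.2 h')
      exact List.map_inj_left.1 ((map_lookup_zip (hS.nodup f D hD) hl').trans hσ.2.symm) c hc'
  have key := ht.perm σ
  rw [hr]
  rw [Ctx.perm_ofList, hσ.1] at key
  convert key using 2
  rw [← hσ.2, List.map_map, List.zip_map']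
  rfl

/-! ### Splitting a process along a weighted sum -/

section Split

variable {S : Sig} {ι : Type} [Fintype ι] {p : FinDist ι} {As : ι → Ty} {A : Ty} {Δ : Ctx}
  {q : ℚ≥0}

/-- A receiver has one premise for each label, and the probabilities enter only through the averages
of potential, contexts and types. The same premises can be averaged with the probabilities `rs j` of
each branch, and the two-stage averages `CtxSum.mix` and `WSumR.mix` recover the original judgment.
If the branch types are all equal, constant families suffice. -/
theorem Typed.split_client (hS : S.WellFormed) {d c : Chan} {L : Finset Label}
    {Q : {ℓ // ℓ ∈ L} → Proc} {C : Ty} (h : Typed S Δ q (.pcase (.chan d) L Q) c C)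
    (hd : Δ d = some A) (hA : WSumR S p As A) :
    ∃ (Δj : ι → Ctx) (qj : ι → ℚ≥0) (Cj : ι → Ty),
      (∀ j, Typed S (Δj j) (qj j) (.pcase (.chan d) L Q) c (Cj j)) ∧
      (∀ j, Δj j d = some (As j)) ∧
      CtxSum S p (fun j => (Δj j).erase d) (Δ.erase d) ∧ WSumR S p Cj C ∧
      q = ∑ j, p.w j * qj j := by
  cases hA with
  | same hA =>
    refine ⟨fun j => Δ.set d (As j), fun _ => q, fun _ => C, fun j => ?_, fun j => ?_, ?_,
      .same fun _ => hS.tyEq_refl _, (p.sum_const q).symm⟩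
    · refine h.conv (fun x => ?_) (hS.tyEq_refl _)
      by_cases hx : x = d
      · simp only [hx, hd, Ctx.set, if_true]; exact .some (hA j).symm
      · simp only [hx, Ctx.set, if_false]; exact CtxEq.refl hS Δ x
    · simp [Ctx.set]
    · have : ∀ j, (Δ.set d (As j)).erase d = Δ.erase d := by
        intro j; ext1 x; by_cases hx : x = d <;> simp [Ctx.set, Ctx.erase, hx]
      simp only [this]
      exact CtxSum.const hS p (Δ.erase d)
  | @pichoice L' r rs B h₁ h₂ h₃ =>
    have hdc : d ≠ c := by rintro rfl; simp [h.ctx_self] at hd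
    obtain ⟨Δ', q', C', r', hsd, hΔ, hC, hq⟩ := h.inv hS
    cases hsd with
    | pechoiceR => exact absurd rfl hdc
    | @pichoiceL _ _ _ _ _ _ p₀ _ A₀ Cs Δs qs hd' ht hq' hs hw =>
    obtain ⟨A', hA', hAA'⟩ := hΔ.some_left hd'
    obtain rfl : A = A' := by rw [hd] at hA'; simpa using hA'
    have hh := (hAA'.trans h₁).head
    -- Equality of types determines the label set and the probabilities. The heterogeneous equality
    -- is needed until the label sets have been identified.
    have hB : L = L' ∧ HEq p₀ r ∧ ∀ (l : ℕ) (h : l ∈ L) (h' : l ∈ L'),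
        TyEq S (A₀ ⟨l, h⟩) (B ⟨l, h'⟩) := by
      simp only [Sig.unfold] at hh
      cases hh with
      | pichoice k => exact ⟨rfl, HEq.rfl, fun l h _ => k ⟨l, h⟩⟩
    obtain ⟨rfl, hr, hB⟩ := hB
    obtain rfl := eq_of_heq hr
    obtain ⟨Δj, hΔ₁, hΔ₂⟩ := hs.mix hS h₃
    obtain ⟨Cj, hC₁, hC₂⟩ := hw.mix hS h₃
    have hn : ∀ j, Δj j d = none := fun j => (hΔ₂.none_iff j d).2 (by simp [Ctx.erase])
    have he : ∀ j A, ((Δj j).set d A).erase d = Δj j := by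
      intro j A; ext1 x; by_cases hx : x = d <;> simp [Ctx.set, Ctx.erase, hx, hn]
    have hAB : ∀ j, TyEq S (.pichoice L (rs j) A₀) (.pichoice L (rs j) B) := by
      intro j; apply TyEq.of_head; exact .pichoice fun l => hB l l.2 l.2
    -- The potential in branch `j` is the `rs j`-average of the premises, plus the amount `r'` that
    -- inversion found to be discarded.
    refine ⟨fun j => (Δj j).set d (As j), fun j => ∑ l, (rs j).w l * qs l + r', Cj, fun j => ?_,
      fun j => by simp [Ctx.set], ?_, hC₂.conv hC, ?_⟩
    · refine .weak r' (.conv (Δ := (Δj j).set d (.pichoice L (rs j) A₀))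
        (.pichoiceL (by simp [Ctx.set]) ht rfl ((he j _).symm ▸ hΔ₁ j) (hC₁ j)) ?_
        (hS.tyEq_refl _)) rfl
      exact (CtxEq.refl hS _).set d ((hAB j).trans (h₂ j).symm)
    · simp only [he]
      exact hΔ₂.conv (hΔ.erase d)
    · rw [hq, hq', p.sum_add_const, FinDist.sum_mix h₃]

/-- For a receiver this is the same regrouping of averages as for a client. For a forwarder the type
of the provided channel is also the type of its single used channel, so the left-hand average passes
through unchanged. -/
theorem Typed.split_server (hS : S.WellFormed) {d : Chan} {P : Proc}
    (hP : (∃ L P', P = .pcase (.chan d) L P') ∨ ∃ e, P = .fwd (.chan d) (.chan e))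
    (h : Typed S Δ q P d A) (hA : WSumL S p As A) :
    ∃ (Δj : ι → Ctx) (qj : ι → ℚ≥0), (∀ j, Typed S (Δj j) (qj j) P d (As j)) ∧
      CtxSum S p Δj Δ ∧ q = ∑ j, p.w j * qj j := by
  cases hA with
  | same hA =>
    exact ⟨fun _ => Δ, fun _ => q, fun j => h.conv (.refl hS _) (hA j).symm,
      CtxSum.const hS p Δ, (p.sum_const q).symm⟩
  | @pechoice L' r rs B h₁ h₂ h₃ =>
    obtain ⟨Δ', q', C', r', hsd, hΔ, hC, hq⟩ := h.inv hS
    rcases hP with ⟨L, P', rfl⟩ | ⟨e, rfl⟩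
    · cases hsd with
      | @pichoiceL _ _ _ _ _ _ p₀ _ A₀ Cs Δs qs hd' ht hq' hs hw =>
        have := h.ctx_self
        rw [← hΔ.none_iff, hd'] at this
        cases this
      | @pechoiceR _ _ _ _ p₀ _ A₀ Δs qs ht hq' hs =>
      have hh := (hC.trans h₁).head
      have hB : L = L' ∧ HEq p₀ r ∧ ∀ (l : ℕ) (h : l ∈ L) (h' : l ∈ L'),
          TyEq S (A₀ ⟨l, h⟩) (B ⟨l, h'⟩) := by
        simp only [Sig.unfold] at hh
        cases hh with
        | pechoice k => exact ⟨rfl, HEq.rfl, fun l h _ => k ⟨l, h⟩⟩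
      obtain ⟨rfl, hr, hB⟩ := hB
      obtain rfl := eq_of_heq hr
      obtain ⟨Δj, hΔ₁, hΔ₂⟩ := hs.mix hS h₃
      have hAB : ∀ j, TyEq S (.pechoice L (rs j) A₀) (.pechoice L (rs j) B) := by
        intro j; apply TyEq.of_head; exact .pechoice fun l => hB l l.2 l.2
      refine ⟨Δj, fun j => ∑ l, (rs j).w l * qs l + r', fun j => ?_, hΔ₂.conv hΔ, ?_⟩
      · exact .weak r' (.conv (.pechoiceR ht rfl (hΔ₁ j)) (.refl hS _)
          ((hAB j).trans (h₂ j).symm)) rfl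
      · rw [hq, hq', p.sum_add_const, FinDist.sum_mix h₃]
    · cases hsd with
      | id hde =>
      -- Forwarding is typed at any type, so branch `j` simply uses `e : As j`.
      refine ⟨fun j => Ctx.single e (As j), fun _ => 0 + r',
        fun j => .weak r' (.id hde) rfl, ?_, by rw [p.sum_const, hq]⟩
      refine CtxSum.conv (fun x => ?_) hΔ
      by_cases hx : x = e
      · exact .inr ⟨C', As, by simp [Ctx.single, hx], by simp [Ctx.single, hx],
          (WSumL.pechoice r rs B h₁ h₂ h₃).conv hC.symm⟩
      · exact .inl ⟨by simp [Ctx.single, hx], by simp [Ctx.single, hx]⟩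

end Split

/-! ### Typing of configurations with one state for every channel

Instead of a pair of contexts, the following version of configuration typing assigns to every
channel one of four states. Composition of configurations is then a pointwise, partial and
associative operation on states. -/

/-- The state of a channel with respect to a configuration. -/
inductive St : Type
  /-- the channel does not belong to the configuration -/
  | absent
  /-- the channel is used from outside -/
  | used (A : Ty)
  /-- the channel is provided and used inside, or reserved for that -/
  | inner
  /-- the channel is provided to the outside -/
  | prov (A : Ty)

/-- `SComp s t u`: the composition of a client in state `s` and a provider in state `t` is in state
`u`. -/
inductive SComp : St → St → St → Prop
  | left (s : St) : SComp s .absent s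
  | right (s : St) : SComp .absent s s
  | link (A : Ty) : SComp (.used A) (.prov A) .inner

/-- The channel is neither used nor provided. -/
def St.Idle (s : St) : Prop := s = .absent ∨ s = .inner

/-- Equality up to equality of types; an absent channel may become reserved. -/
inductive StLe (S : Sig) : St → St → Prop
  | absent : StLe S .absent .absent
  | reserve : StLe S .absent .inner
  | inner : StLe S .inner .inner
  | used {A A'} : TyEq S A A' → StLe S (.used A) (.used A')
  | prov {A A'} : TyEq S A A' → StLe S (.prov A) (.prov A')

/-- The state of a channel of a distribution object, given its states in the branches. -/
inductive DSum (S : Sig) {ι : Type} [Fintype ι] (p : FinDist ι) (ss : ι → St) : St → Prop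
  | prov {A} (As : ι → Ty) : (∀ i, ss i = .prov (As i)) → WSumR S p As A → DSum S p ss (.prov A)
  | used {A} (As : ι → Ty) : (∀ i, ss i = .used (As i)) → WSumL S p As A → DSum S p ss (.used A)
  | inner : (∀ i, (ss i).Idle) → DSum S p ss .inner
  | absent : (∀ i, ss i = .absent) → DSum S p ss .absent

/-- The state of `x` with respect to a process with context `Δ` that provides `c : A`. -/
inductive ProcSt (c : Chan) (A : Ty) (Δ : Ctx) (x : Chan) : St → Prop
  | prov : x = c → ProcSt c A Δ x (.prov A)
  | used {B} : x ≠ c → Δ x = some B → ProcSt c A Δ x (.used B)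
  | inner : x ≠ c → Δ x = none → ProcSt c A Δ x .inner
  | absent : x ≠ c → Δ x = none → ProcSt c A Δ x .absent

/-- `c` is the only provided channel. -/
def Sole (c : Chan) (σ : Chan → St) : Prop := ∀ x, (∃ A, σ x = .prov A) ↔ x = c

/-- Configuration typing, with one state for every channel. -/
inductive CT (S : Sig) : (Chan → St) → ℚ≥0 → Config → Prop
  | nil {σ : Chan → St} {q} : (∀ x, (σ x).Idle) → CT S σ q []
  | proc {Δ A c w P R q q₁ q₂} {σ τ υ : Chan → St} : Typed S Δ q₁ P c A → (∀ x, ProcSt c A Δ x (σ x)) →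
      CT S τ q₂ R → (∀ x, SComp (σ x) (τ x) (υ x)) → q = q₁ + w + q₂ →
      CT S υ q (.proc c w P :: R)
  | dist {n c R q q₂} {σ τ υ : Chan → St} {p : FinDist (Fin n)} {C : Fin n → Config} {σs : Fin n → Chan → St}
      {qs : Fin n → ℚ≥0} : (∀ i, CT S (σs i) (qs i) (C i)) →
      (∀ x, DSum S p (fun i => σs i x) (σ x)) → Sole c σ → CT S τ q₂ R →
      (∀ x, SComp (σ x) (τ x) (υ x)) → q = ∑ i, p.w i * qs i + q₂ →
      CT S υ q (.dist c n p C :: R)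

-- Algebra of channel states.

section St

variable {S : Sig} {a b c s t u s' t' u' x y z : St}

/-- An internal channel composes only with an absent one, so a channel can be linked at most once.
Associativity is a finite check over the three composition rules. -/
theorem SComp.assoc_left (h : SComp b c y) (h' : SComp a y z) :
    ∃ x, SComp a b x ∧ SComp x c z := by
  cases h <;> cases h' <;> exact ⟨_, by constructor, by constructor⟩

theorem SComp.assoc_right (h : SComp a b x) (h' : SComp x c z) :
    ∃ y, SComp b c y ∧ SComp a y z := by
  cases h <;> cases h' <;> exact ⟨_, by constructor, by constructor⟩

/-- The provider `b` may be moved next to its client `a`. -/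
theorem SComp.exchange (h₁ : SComp b c x) (h₂ : SComp t x y) (h₃ : SComp a y z)
    (hb : ∀ A, b = .prov A → a = .used A) :
    ∃ u v, SComp a b u ∧ SComp t c v ∧ SComp u v z := by
  cases h₁ <;> cases h₂ <;> cases h₃ <;> simp at hb <;>
    exact ⟨_, _, by constructor, by constructor, by constructor⟩

theorem StLe.refl (hS : S.WellFormed) (s : St) : StLe S s s := by
  cases s <;> constructor <;> exact hS.tyEq_refl _

/-- A relaxation of the composite can be charged to one factor: to the one that carries the state,
or to neither when the channel is a link. -/
theorem SComp.lift (hS : S.WellFormed) (h : SComp s t u) (h' : StLe S u u') :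
    ∃ s' t', StLe S s s' ∧ StLe S t t' ∧ SComp s' t' u' := by
  cases h with
  | left => exact ⟨_, _, h', .absent, .left _⟩
  | right => exact ⟨_, _, .absent, h', .right _⟩
  | link A => cases h'; exact ⟨_, _, .refl hS _, .refl hS _, .link A⟩

/-- An idle factor contributes nothing except possibly a reservation, so it can be absorbed by
monotonicity. In this way the empty tail of a configuration is removed. -/
theorem SComp.le_left (hS : S.WellFormed) (h : SComp s t u) (ht : t.Idle) : StLe S s u := by
  rcases ht with rfl | rfl <;> cases h
  · exact .refl hS _
  · exact .refl hS _
  · exact .reserve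

theorem SComp.le_right (hS : S.WellFormed) (h : SComp s t u) (hs : s.Idle) : StLe S t u := by
  rcases hs with rfl | rfl <;> cases h
  · exact .refl hS _
  · exact .refl hS _
  · exact .reserve

theorem St.Idle.le (hs : s.Idle) (h : StLe S s t) : t.Idle := by
  rcases hs with rfl | rfl <;> cases h <;> simp [St.Idle]

theorem DSum.lift {ι : Type} [Fintype ι] {p : FinDist ι} {ss : ι → St} (h : DSum S p ss s)
    (h' : StLe S s s') : DSum S p ss s' := by
  cases h with
  | prov As h₁ h₂ => cases h' with | prov h => exact .prov As h₁ (h₂.conv h)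
  | used As h₁ h₂ => cases h' with | used h => exact .used As h₁ (h₂.conv h)
  | inner h => cases h'; exact .inner h
  | absent h =>
    cases h'
    · exact .absent h
    · exact .inner fun i => .inl (h i)

theorem DSum.const (hS : S.WellFormed) {ι : Type} [Fintype ι] (p : FinDist ι) (s : St) :
    DSum S p (fun _ => s) s := by
  cases s with
  | absent => exact .absent fun _ => rfl
  | used A => exact .used (fun _ => A) (fun _ => rfl) (.same fun _ => hS.tyEq_refl _)
  | inner => exact .inner fun _ => .inr rfl
  | prov A => exact .prov (fun _ => A) (fun _ => rfl) (.same fun _ => hS.tyEq_refl _)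

theorem DSum.comap {ι κ : Type} [Fintype ι] [Fintype κ] {p : FinDist ι} {ss : ι → St}
    {P : FinDist κ} {f : κ → ι} (hP : P.Marginal p f) (h : DSum S p ss s) :
    DSum S P (fun k => ss (f k)) s := by
  cases h with
  | prov As h₁ h₂ => exact .prov (fun k => As (f k)) (fun k => h₁ _) (h₂.comap hP)
  | used As h₁ h₂ => exact .used (fun k => As (f k)) (fun k => h₁ _) (h₂.comap hP)
  | inner h => exact .inner fun k => h _
  | absent h => exact .absent fun k => h _

/-- Averaging changes only outermost probabilities, and `Sig.shape` forgets these. -/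
theorem DSum.branch_used {ι : Type} [Fintype ι] {p : FinDist ι} {ss : ι → St}
    (h : DSum S p ss s) {i : ι} {A : Ty} (hi : ss i = .used A) :
    ∃ B, s = .used B ∧ S.shape A = S.shape B := by
  cases h with
  | prov As h₁ h₂ => simp [h₁] at hi
  | used As h₁ h₂ =>
    simp only [h₁, St.used.injEq] at hi
    exact ⟨_, rfl, by rw [← hi, h₂.shape_eq]⟩
  | inner h => rcases h i with h | h <;> simp [h] at hi
  | absent h => simp [h] at hi

theorem Sole.le {c : Chan} {σ σ' : Chan → St} (h : Sole c σ) (h' : ∀ x, StLe S (σ x) (σ' x)) :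
    Sole c σ' := by
  intro x
  rw [← h x]
  have := h' x
  generalize σ x = s, σ' x = s' at *
  cases this <;> simp

theorem ProcSt.sole {c : Chan} {A : Ty} {Δ : Ctx} {σ : Chan → St}
    (h : ∀ x, ProcSt c A Δ x (σ x)) : Sole c σ := by
  intro x
  have := h x
  generalize σ x = s at this
  cases this <;> simp [*]

end St

/-- The type of a used channel. -/
def St.usedTy : St → Option Ty
  | .used A => some A
  | _ => none

/-- The type of a provided channel. -/
def St.provTy : St → Option Ty
  | .prov A => some A
  | _ => none

/-- The context of the used channels. -/
def ctxU (σ : Chan → St) : Ctx := fun x => (σ x).usedTy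

/-- The context of the provided channels. -/
def ctxP (σ : Chan → St) : Ctx := fun x => (σ x).provTy

theorem ctxU_eq_some {σ : Chan → St} {x : Chan} {A : Ty} :
    ctxU σ x = some A ↔ σ x = .used A := by
  unfold ctxU; cases σ x <;> simp [St.usedTy]

theorem ctxP_eq_some {σ : Chan → St} {x : Chan} {A : Ty} :
    ctxP σ x = some A ↔ σ x = .prov A := by
  unfold ctxP; cases σ x <;> simp [St.provTy]

-- Structural rules of the state-based typing.

section CT

variable {S : Sig} {σ τ υ : Chan → St} {q q₁ q₂ : ℚ≥0} {C C₁ C₂ : Config} {O : Obj}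

/-- The context is read off the new states by `ctxU`. Newly reserved channels do not appear in it,
so the derivation changes only by conversion. -/
theorem ProcSt.lift {Δ : Ctx} {c : Chan} {P : Proc} {A : Ty}
    (ht : Typed S Δ q P c A) (hp : ∀ x, ProcSt c A Δ x (σ x)) (h : ∀ x, StLe S (σ x) (τ x)) :
    ∃ Δ' A', Typed S Δ' q P c A' ∧ (∀ x, ProcSt c A' Δ' x (τ x)) := by
  obtain ⟨A', hA, hA'⟩ : ∃ A', τ c = .prov A' ∧ TyEq S A A' := by
    have h₁ := hp c
    have h₂ := h c
    generalize σ c = s, τ c = s' at *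
    cases h₁ <;> cases h₂ <;> simp_all
  refine ⟨ctxU τ, A', ht.conv (fun x => ?_) hA', fun x => ?_⟩
  · have h₁ := hp x
    have h₂ := h x
    have h₃ := ht.ctx_self
    unfold ctxU
    generalize σ x = s, τ x = s' at *
    cases h₁ <;> cases h₂ <;> simp_all [St.usedTy]
  · have h₁ := hp x
    have h₂ := h x
    have h₃ : ctxU τ x = (τ x).usedTy := rfl
    by_cases hx : x = c
    · rw [hx, hA]; exact .prov rfl
    · generalize σ x = s, τ x = s' at *
      cases h₁ <;> cases h₂ <;> first
        | exact absurd ‹_› hx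
        | (constructor <;> simp_all [St.usedTy])

/-- Besides conversion of types, this permits reserving channels that do not belong to the
configuration. Reservations let a state assignment survive the disappearance of a provider. -/
theorem CT.mono (hS : S.WellFormed) (h : CT S σ q C) :
    ∀ {σ'}, (∀ x, StLe S (σ x) (σ' x)) → CT S σ' q C := by
  induction h with
  | nil hi => exact fun h => .nil fun x => (hi x).le (h x)
  | @proc Δ A c w P R q q₁ q₂ σ τ υ ht hp hR hc hq ih =>
    intro υ' h
    choose σ' τ' h₁ h₂ h₃ using fun x => (hc x).lift hS (h x)
    obtain ⟨Δ', A', ht', hp'⟩ := ProcSt.lift ht hp h₁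
    exact .proc ht' hp' (ih h₂) h₃ hq
  | dist hC hs hp hR hc hq ihC ihR =>
    intro υ' h
    choose σ' τ' h₁ h₂ h₃ using fun x => (hc x).lift hS (h x)
    exact .dist hC (fun x => (hs x).lift (h₁ x)) (hp.le h₁) (ihR h₂) h₃ hq

/-- Extra potential is passed down to the empty tail, which may hold any amount. -/
theorem CT.weak (r : ℚ≥0) (h : CT S σ q C) : CT S σ (q + r) C := by
  induction h with
  | nil hi => exact .nil hi
  | proc ht hp hR hc hq ih => exact .proc ht hp ih hc (by rw [hq, add_assoc])
  | dist hC hs hp hR hc hq ihC ihR => exact .dist hC hs hp ihR hc (by rw [hq, add_assoc])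

theorem CT.of_cons (h : CT S υ q (O :: C)) :
    ∃ σ τ q₁ q₂, CT S σ q₁ [O] ∧ CT S τ q₂ C ∧ (∀ x, SComp (σ x) (τ x) (υ x)) ∧
      q = q₁ + q₂ := by
  cases h with
  | proc ht hp hR hc hq =>
    exact ⟨_, _, _, _, .proc ht hp (.nil (σ := fun _ => .absent) fun _ => .inl rfl)
      (fun _ => .left _) (add_zero _).symm, hR, hc, hq⟩
  | dist hC hs hp hR hc hq =>
    exact ⟨_, _, _, _, .dist hC hs hp (.nil (σ := fun _ => .absent) fun _ => .inl rfl)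
      (fun _ => .left _) (add_zero _).symm, hR, hc, hq⟩

theorem CT.idle (h : CT S σ q []) (x : Chan) : (σ x).Idle := by
  cases h with | nil h => exact h x

/-- The singleton ends in an empty tail with its own reservations and potential; reassociating the
composition moves both into the tail `C`. -/
theorem CT.cons (hS : S.WellFormed) (h₁ : CT S σ q₁ [O]) (h₂ : CT S τ q₂ C)
    (hc : ∀ x, SComp (σ x) (τ x) (υ x)) : CT S υ (q₁ + q₂) (O :: C) := by
  cases h₁ with
  | @proc _ _ _ _ _ _ _ _ r _ _ _ ht hp hR hc' hq =>
    choose τ' h₃ h₄ using fun x => (hc' x).assoc_right (hc x)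
    refine .proc ht hp ((h₂.mono hS fun x => (h₃ x).le_right hS (hR.idle x)).weak r) h₄ ?_
    rw [hq]; ring
  | @dist _ _ _ _ r _ _ _ _ _ _ _ hC hs hp hR hc' hq =>
    choose τ' h₃ h₄ using fun x => (hc' x).assoc_right (hc x)
    refine .dist hC hs hp ((h₂.mono hS fun x => (h₃ x).le_right hS (hR.idle x)).weak r) h₄ ?_
    rw [hq]; ring

theorem CT.append (hS : S.WellFormed) (h₁ : CT S σ q₁ C₁) (h₂ : CT S τ q₂ C₂)
    (hc : ∀ x, SComp (σ x) (τ x) (υ x)) : CT S υ (q₁ + q₂) (C₁ ++ C₂) := by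
  induction C₁ generalizing σ q₁ υ with
  | nil =>
    rw [add_comm]
    exact (h₂.mono hS fun x => (hc x).le_right hS (h₁.idle x)).weak _
  | cons O C ih =>
    obtain ⟨σ₁, σ₂, r₁, r₂, h₃, h₄, h₅, rfl⟩ := h₁.of_cons
    choose τ' h₆ h₇ using fun x => (h₅ x).assoc_right (hc x)
    rw [add_assoc]
    exact .cons hS h₃ (ih h₄ h₆) h₇

/-- With states the interface between two parts of a configuration is given by associativity, with
no explicit splitting of contexts. -/
theorem CT.of_append (hS : S.WellFormed) (h : CT S υ q (C₁ ++ C₂)) :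
    ∃ σ τ q₁ q₂, CT S σ q₁ C₁ ∧ CT S τ q₂ C₂ ∧ (∀ x, SComp (σ x) (τ x) (υ x)) ∧
      q = q₁ + q₂ := by
  induction C₁ generalizing υ q with
  | nil => exact ⟨fun _ => .absent, υ, 0, q, .nil fun _ => .inl rfl, h, fun _ => .right _,
      (zero_add q).symm⟩
  | cons O C ih =>
    obtain ⟨σ₁, σ₂, r₁, r₂, h₁, h₂, h₃, rfl⟩ := h.of_cons
    obtain ⟨σ, τ, q₁, q₂, h₄, h₅, h₆, rfl⟩ := ih h₂
    choose σ' h₇ h₈ using fun x => (h₆ x).assoc_left (h₃ x)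
    exact ⟨σ', τ, r₁ + q₁, q₂, .cons hS h₁ h₄ h₇, h₅, h₈, (add_assoc _ _ _).symm⟩

/-- Replacement of one part of a configuration. -/
theorem CT.frame (hS : S.WellFormed) {R : Config} (h : CT S υ q (C₁ ++ O :: C₂))
    (hR : ∀ σ r, CT S σ r [O] → (∀ x, υ x = .absent → σ x = .absent) → CT S σ r R) :
    CT S υ q (C₁ ++ R ++ C₂) := by
  obtain ⟨a, y, r₁, r₂, h₁, h₂, h₃, rfl⟩ := h.of_append hS
  obtain ⟨o, c, r₃, r₄, h₄, h₅, h₆, rfl⟩ := h₂.of_cons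
  rw [List.append_assoc]
  refine h₁.append hS ((hR o r₃ h₄ fun x hx => ?_).append hS h₅ h₆) h₃
  have h₃ := h₃ x
  have h₆ := h₆ x
  rw [hx] at h₃
  generalize o x = ox, y x = yx, c x = cx, a x = ax at *
  cases h₃ <;> cases h₆ <;> rfl

theorem CT.proc_inv (hS : S.WellFormed) {c : Chan} {w : ℚ≥0} {P : Proc}
    (h : CT S υ q [.proc c w P]) :
    ∃ Δ q₁ A, Typed S Δ q₁ P c A ∧ (∀ x, ProcSt c A Δ x (υ x)) ∧ q = q₁ + w := by
  cases h with
  | @proc Δ A c w P R q q₁ q₂ σ τ υ ht hp hR hc hq =>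
    obtain ⟨Δ', A', ht', hp'⟩ := ProcSt.lift ht hp fun x => (hc x).le_left hS (hR.idle x)
    exact ⟨Δ', q₁ + q₂, A', ht'.weak q₂ rfl, hp', by rw [hq]; ring⟩

theorem CT.proc_intro {c : Chan} {w : ℚ≥0} {P : Proc} {Δ : Ctx} {A : Ty}
    (ht : Typed S Δ q₁ P c A) (hp : ∀ x, ProcSt c A Δ x (υ x)) :
    CT S υ (q₁ + w) [.proc c w P] :=
  .proc ht hp (.nil (σ := fun _ => .absent) (q := 0) fun _ => .inl rfl) (fun _ => .left _)
    (add_zero _).symm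

theorem CT.dist_inv (hS : S.WellFormed) {c : Chan} {n : ℕ} {p : FinDist (Fin n)}
    {C : Fin n → Config} (h : CT S υ q [.dist c n p C]) :
    ∃ (σs : Fin n → Chan → St) (qs : Fin n → ℚ≥0), (∀ i, CT S (σs i) (qs i) (C i)) ∧
      (∀ x, DSum S p (fun i => σs i x) (υ x)) ∧ Sole c υ ∧ q = ∑ i, p.w i * qs i := by
  cases h with
  | @dist n c R q q₂ σ τ υ p C σs qs hC hs hp hR hc hq =>
    have hle : ∀ x, StLe S (σ x) (υ x) := fun x => (hc x).le_left hS (hR.idle x)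
    -- The potential of the empty tail is added to every branch; an average increases by the same
    -- constant.
    exact ⟨σs, fun i => qs i + q₂, fun i => (hC i).weak q₂, fun x => (hs x).lift (hle x),
      hp.le hle, by rw [hq, p.sum_add_const]⟩

theorem CT.dist_intro {c : Chan} {n : ℕ} {p : FinDist (Fin n)} {C : Fin n → Config}
    {σs : Fin n → Chan → St} {qs : Fin n → ℚ≥0} (hC : ∀ i, CT S (σs i) (qs i) (C i))
    (hs : ∀ x, DSum S p (fun i => σs i x) (υ x)) (hc : Sole c υ)
    (hq : q = ∑ i, p.w i * qs i) : CT S υ q [.dist c n p C] :=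
  .dist hC hs hc (.nil (σ := fun _ => .absent) (q := 0) fun _ => .inl rfl) (fun _ => .left _)
    (by rw [hq, add_zero])

theorem CT.sole (hS : S.WellFormed) (h : CT S σ q [O]) : Sole O.chan σ := by
  cases O with
  | proc c w P =>
    obtain ⟨Δ, q₁, A, ht, hp, hq⟩ := h.proc_inv hS
    exact ProcSt.sole hp
  | dist c n p C =>
    obtain ⟨σs, qs, hC, hs, hc, hq⟩ := h.dist_inv hS
    exact hc

/-- Replacement of a client and its provider. -/
theorem CT.frame_pair (hS : S.WellFormed) {O' : Obj} {R C₃ : Config}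
    (h : CT S υ q (C₁ ++ O :: C₂ ++ O' :: C₃))
    (hO : ∀ σ r, CT S σ r [O] → σ O'.chan ≠ .absent)
    (hR : ∀ σ r, CT S σ r [O, O'] → (∀ x, υ x = .absent → σ x = .absent) → CT S σ r R) :
    CT S υ q (C₁ ++ R ++ C₂ ++ C₃) := by
  rw [List.append_assoc] at h
  obtain ⟨a, y₃, r₁, r₂, ha, h', hc₁, rfl⟩ := h.of_append hS
  obtain ⟨o, y₂, r₃, r₄, ho, g₁, hc₂, rfl⟩ := h'.of_cons
  obtain ⟨b, y₁, r₅, r₆, hb, g₂, hc₃, rfl⟩ := CT.of_append (C₁ := C₂) hS g₁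
  obtain ⟨o', c, r₇, r₈, ho', hc, hc₄, rfl⟩ := g₂.of_cons
  -- The provider exposes only `O'.chan`. If the client's state there is not absent, the intervening
  -- objects cannot have consumed the channel, and the only admissible composition is a link. This
  -- is the hypothesis that `SComp.exchange` needs to move the provider past `C₂`.
  have hlink : ∀ x A, o' x = .prov A → o x = .used A := by
    intro x A hx
    obtain rfl : x = O'.chan := (ho'.sole hS x).1 ⟨A, hx⟩
    have h₀ := hO o r₃ ho
    have h₂ := hc₂ O'.chan
    have h₃ := hc₃ O'.chan
    have h₄ := hc₄ O'.chan
    generalize o' O'.chan = s₁, o O'.chan = s₂, y₁ O'.chan = s₃, y₂ O'.chan = s₄,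
      y₃ O'.chan = s₅, b O'.chan = s₆, c O'.chan = s₇ at *
    subst hx
    cases h₄
    cases h₃ <;> cases h₂ <;> simp_all
  choose u v hu hv huv using fun x => (hc₄ x).exchange (hc₃ x) (hc₂ x) (hlink x)
  rw [List.append_assoc, List.append_assoc]
  have habs : ∀ x, υ x = .absent → u x = .absent := by
    intro x hx
    have h₁ := hc₁ x
    have h₂ := huv x
    rw [hx] at h₁
    generalize u x = s₁, v x = s₂, y₃ x = s₃, a x = s₄ at *
    cases h₁ <;> cases h₂ <;> rfl
  have hpair : CT S u (r₃ + r₇) [O, O'] := .cons hS ho ho' hu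
  have := ha.append hS ((hR u _ hpair habs).append hS (hb.append hS hc hv) huv) hc₁
  convert this using 1
  ring

end CT

/-! ### The two versions of configuration typing -/

theorem provides_cons {b : Chan} {O : Obj} {C : Config} :
    Provides b (O :: C) ↔ Provides b [O] ∨ Provides b C := by
  constructor
  · intro h
    cases h with
    | head h => exact .inl (.head h)
    | inner i h => exact .inl (.inner i h)
    | tail h => exact .inr h
  · rintro (h | h)
    · cases h with
      | head h => exact .head h
      | inner i h => exact .inner i h
      | tail h => cases h
    · exact .tail h

theorem provides_proc {b c : Chan} {w : ℚ≥0} {P : Proc} :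
    Provides b [.proc c w P] ↔ b = c := by
  constructor
  · intro h
    cases h with
    | head h => exact h.symm
    | tail h => cases h
  · rintro rfl; exact .head rfl

theorem provides_dist {b c : Chan} {n : ℕ} {p : FinDist (Fin n)} {C : Fin n → Config} :
    Provides b [.dist c n p C] ↔ b = c ∨ ∃ i, Provides b (C i) := by
  constructor
  · intro h
    cases h with
    | head h => exact .inl h.symm
    | inner i h => exact .inr ⟨i, h⟩
    | tail h => cases h
  · rintro (rfl | ⟨i, h⟩)
    · exact .head rfl
    · exact .inner i h

open Classical in
/-- The states given by the contexts of used and provided channels and the set of the channels that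
are provided at some depth. -/
noncomputable def mkSt (Δ Γ : Ctx) (V : Set Chan) (x : Chan) : St :=
  match Γ x, Δ x with
  | some A, _ => .prov A
  | none, some B => .used B
  | none, none => if x ∈ V then .inner else .absent

section

variable {S : Sig} {Δ Γ : Ctx} {q : ℚ≥0} {C : Config}

/-- In a distribution object every used channel is used in all branches, so a channel provided
inside any single branch cannot be used by the object. -/
theorem CTyped.provides (h : CTyped S Δ q C Γ) :
    (∀ x, Γ x ≠ none → Provides x C) ∧ (∀ x, Provides x C → Δ x = none) := by
  induction h with
  | proc ht hq hΓ =>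
    subst hΓ
    refine ⟨fun x hx => provides_proc.2 ?_, fun x hx => ?_⟩
    · by_contra h; simp [Ctx.single, h] at hx
    · rw [provides_proc.1 hx]; exact ht.ctx_self
  | @dist Δ q c n p C A Γ Δs qs As hC hs hw hq hΓ ih =>
    subst hΓ
    refine ⟨fun x hx => provides_dist.2 (.inl ?_), fun x hx => ?_⟩
    · by_contra h; simp [Ctx.single, h] at hx
    · have : ∃ i, Provides x (C i) := by
        rcases provides_dist.1 hx with rfl | h
        · obtain ⟨i⟩ := p.nonempty
          exact ⟨i, (ih i).1 _ (by simp [Ctx.single])⟩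
        · exact h
      obtain ⟨i, hi⟩ := this
      exact (hs.none_iff i x).1 ((ih i).2 x hi)
  | compose hO hC h₁ h₂ h₃ h₄ h₅ h₆ h₇ h₈ hq h₉ h₁₀ h₁₁ ihO ihC =>
    subst h₂ h₄ h₆ h₈
    refine ⟨fun x hx => ?_, fun x hx => ?_⟩
    · have := ihO.1 x
      have := ihC.1 x
      rw [provides_cons]
      grind [Ctx.single, Ctx.set, Ctx.join]
    · simp only [Ctx.join, Option.or_eq_none_iff]
      rcases provides_cons.1 hx with hx | hx
      · exact ⟨(Option.or_eq_none_iff.1 (ihO.2 x hx)).1, h₁₁ x hx⟩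
      · exact ⟨h₁₀ x hx, ihC.2 x hx⟩

/-- The side conditions of `compose` are pointwise, which reduces composition to a case analysis at
a single channel. The distinctness conditions ensure that a channel hidden in one part is absent
from the other. -/
theorem CTyped.toCT (hS : S.WellFormed) (h : CTyped S Δ q C Γ) : CT S (mkSt Δ Γ {x | Provides x C}) q C := by
  induction h with
  | @proc Δ q q' w c P A Γ ht hq hΓ =>
    subst hΓ hq
    refine .proc_intro ht fun x => ?_
    by_cases hx : x = c
    · simp only [mkSt, Ctx.single, hx, if_true]; exact .prov rfl
    · cases hΔ : Δ x with
      | some B => simp only [mkSt, Ctx.single, hx, if_false, hΔ]; exact .used hx hΔ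
      | none =>
        simp only [mkSt, Ctx.single, hx, if_false, hΔ]
        split
        · exact .inner hx hΔ
        · exact .absent hx hΔ
  | @dist Δ q c n p C A Γ Δs qs As hC hs hw hq hΓ ih =>
    subst hΓ
    refine .dist_intro ih (fun x => ?_) (fun x => ?_) hq
    · by_cases hx : x = c
      · simp only [mkSt, Ctx.single, hx, if_true]
        exact .prov As (fun i => rfl) hw
      · rcases hs x with ⟨h₁, h₂⟩ | ⟨B, Bs, h₁, h₂, h₃⟩
        · simp only [mkSt, Ctx.single, hx, if_false, h₁, h₂, Set.mem_ofPred_eq]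
          split
          · exact .inner fun i => by split <;> simp [St.Idle]
          · rename_i h
            exact .absent fun i => if_neg fun h' => h (provides_dist.2 (.inr ⟨i, h'⟩))
        · simp only [mkSt, Ctx.single, hx, if_false, h₁, h₂]
          exact .used Bs (fun i => rfl) h₃
    · by_cases hx : x = c
      · simp [mkSt, Ctx.single, hx]
      · simp only [mkSt, Ctx.single, hx, if_false, iff_false, not_exists]
        intro A; split <;> simp_all; split <;> simp
  | @compose Δ Δ₁ Δ₂ Δ' Δ₁' Γ Γ₀ Γ₂ q q₁ q₂ O c A C hO hC h₁ h₂ h₃ h₄ h₅ h₆ h₇ h₈ hq h₉ h₁₀ h₁₁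
      ihO ihC =>
    subst h₂ h₄ h₆ h₈ hq
    refine .cons hS ihO ihC fun x => ?_
    have hO' := hO.provides
    have hC' := hC.provides
    have hcO : Provides c [O] := hO'.1 c (by simp [Ctx.single])
    have e : x ∈ {x | Provides x (O :: C)} ↔ Provides x [O] ∨ Provides x C := provides_cons
    have hO₁ := hO'.2 x
    have hC₁ := hC'.1 x
    have hC₂ := hC'.2 x
    have h₁ := h₁ x
    have h₃ := h₃ x
    have h₅ := h₅ x
    have h₉ := h₉ x
    have h₁₀ := h₁₀ x
    have h₁₁ := h₁₁ x
    simp only [mkSt, Set.mem_ofPred_eq] at e ⊢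
    have e₁ : Provides x [O] → Provides x (O :: C) := fun h => e.2 (.inl h)
    have e₂ : Provides x C → Provides x (O :: C) := fun h => e.2 (.inr h)
    have e₃ : ¬ Provides x [O] → ¬ Provides x C → ¬ Provides x (O :: C) :=
      fun h h' h'' => (e.1 h'').elim h h'
    clear e
    by_cases hx : x = c
    · subst hx
      have h₁₂ : ¬ Provides x C := h₉ hcO
      have h₁₃ : Γ₀ x = none ∧ Δ' x = none := by
        have := mt hC₁ h₁₂
        simpa only [Ctx.join, not_not, ne_eq, Option.or_eq_none_iff] using this
      simp only [Ctx.single, Ctx.set, Ctx.join, if_true, h₁₃, h₁₁ hcO, h₁₂, if_false,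
        Option.or_none]
      exact .left _
    · simp only [Ctx.single, Ctx.set, Ctx.join, hx, if_false] at *
      generalize Δ₁ x = a, Δ₂ x = b, Δ' x = d, Γ₀ x = g at *
      clear ihO ihC hO hC hO' hC' h₇
      by_cases hp : Provides x [O] <;> by_cases hp' : Provides x C <;>
        cases a <;> cases b <;> cases d <;> cases g <;> 
          simp [hp, hp'] at * <;> (try simp [*]) <;> constructor

/-- A channel that is provided at some depth is provided or reserved. -/
theorem CT.provides {σ : Chan → St} (h : CT S σ q C) {x : Chan} (hx : Provides x C) :
    σ x = .inner ∨ ∃ A, σ x = .prov A := by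
  induction h with
  | nil => cases hx
  | @proc Δ A c w P R q q₁ q₂ σ τ υ ht hp hR hc hq ih =>
    have h₁ := hc x
    rcases provides_cons.1 hx with hx | hx
    · obtain rfl := provides_proc.1 hx
      have h₂ := hp x
      generalize σ x = s, τ x = t, υ x = u at *
      cases h₂ <;> first | contradiction | (cases h₁; simp)
    · have h₂ := ih hx
      generalize σ x = s, τ x = t, υ x = u at *
      cases h₁ <;> simp_all
  | @dist n c R q q₂ σ τ υ p C σs qs hC hs hp hR hc hq ihC ihR =>
    have h₁ := hc x
    rcases provides_cons.1 hx with hx | hx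
    · rcases provides_dist.1 hx with rfl | ⟨i, hx⟩
      · obtain ⟨A, h₂⟩ := (hp x).2 rfl
        rw [h₂] at h₁
        generalize τ x = t, υ x = u at *
        cases h₁; simp
      · have h₂ := hs x
        have h₃ := ihC i hx
        generalize σ x = s, τ x = t, υ x = u at *
        cases h₂ with
        | prov => cases h₁; simp
        | used As h₄ => simp [h₄] at h₃
        | inner h₄ => cases h₁; simp
        | absent h₄ => simp [h₄] at h₃
    · have h₂ := ihR hx
      generalize σ x = s, τ x = t, υ x = u at *
      cases h₁ <;> simp_all

theorem CTyped.weak (h : CTyped S Δ q C Γ) (r : ℚ≥0) : CTyped S Δ (q + r) C Γ := by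
  induction h generalizing r with
  | proc ht hq hΓ => exact .proc (ht.weak r rfl) (by rw [hq]; ring) hΓ
  | @dist Δ q c n p C A Γ Δs qs As hC hs hw hq hΓ ih =>
    exact .dist (fun i => ih i r) hs hw (by rw [hq, p.sum_add_const]) hΓ
  | compose hO hC h₁ h₂ h₃ h₄ h₅ h₆ h₇ h₈ hq h₉ h₁₀ h₁₁ ihO ihC =>
    exact .compose hO (ihC r) h₁ h₂ h₃ h₄ h₅ h₆ h₇ h₈ (by rw [hq]; ring) h₉ h₁₀ h₁₁

theorem SComp.ctxU_apply {σ τ υ : Chan → St} {x : Chan} (h : SComp (σ x) (τ x) (υ x)) :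
    ctxU υ x = (if (τ x).provTy = none then (σ x).usedTy else none).or (ctxU τ x) := by
  simp only [ctxU]
  generalize σ x = s, τ x = t, υ x = u at *
  cases h with
  | left => cases s <;> rfl
  | right => cases t <;> rfl
  | link => rfl

theorem SComp.ctxP_apply {σ τ υ : Chan → St} {x : Chan} (h : SComp (σ x) (τ x) (υ x)) :
    ctxP υ x = (ctxP σ x).or (if (σ x).usedTy = none then (τ x).provTy else none) := by
  simp only [ctxP]
  generalize σ x = s, τ x = t, υ x = u at *
  cases h with
  | left => cases s <;> rfl
  | right => cases t <;> rfl
  | link => rfl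

theorem Sole.ctxP_eq {c : Chan} {σ : Chan → St} (h : Sole c σ) :
    ∃ A, σ c = .prov A ∧ ctxP σ = Ctx.single c A := by
  obtain ⟨A, hA⟩ := (h c).2 rfl
  refine ⟨A, hA, funext fun x => ?_⟩
  by_cases hx : x = c
  · rw [hx, ctxP_eq_some.2 hA]; simp [Ctx.single]
  · have : ctxP σ x = none := by
      rw [Option.eq_none_iff_forall_ne_some]
      exact fun B hB => hx ((h x).1 ⟨B, ctxP_eq_some.1 hB⟩)
    simp [Ctx.single, hx, this]

/-- States record enough to recover the contexts of `compose`. Its distinctness conditions hold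
because a channel provided at any depth is in state `inner` or `prov`, and such a state does not
compose with another occurrence except at a link. -/
theorem CTyped.of_comp {σ τ υ : Chan → St} {q₁ q₂ : ℚ≥0} {O : Obj}
    (hO : CTyped S (ctxU σ) q₁ [O] (ctxP σ)) (hO' : CT S σ q₁ [O]) (hσ : Sole O.chan σ)
    (hC : CTyped S (ctxU τ) q₂ C (ctxP τ)) (hC' : CT S τ q₂ C)
    (hc : ∀ x, SComp (σ x) (τ x) (υ x)) :
    CTyped S (ctxU υ) (q₁ + q₂) (O :: C) (ctxP υ) := by
  obtain ⟨A, hA, hP⟩ := hσ.ctxP_eq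
  rw [hP] at hO
  have key : ∀ x, (Provides x [O] → σ x = .inner ∨ ∃ A, σ x = .prov A) ∧
      (Provides x C → τ x = .inner ∨ ∃ A, τ x = .prov A) :=
    fun x => ⟨hO'.provides, hC'.provides⟩
  -- The channels used by `O` are divided according to whether `C` provides them; `Γ₀` consists of
  -- the provisions of `C` that `O` does not consume.
  refine .compose (Δ₁ := fun x => if (τ x).provTy = none then (σ x).usedTy else none)
    (Δ' := fun x => if (τ x).provTy = none then none else (σ x).usedTy)
    (Γ₀ := fun x => if (σ x).usedTy = none then (τ x).provTy else none) hO hC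
    (fun x => ?_) (funext fun x => ?_) (fun x => ?_) (funext fun x => ?_) (fun x => ?_)
    (funext fun x => hc x |>.ctxU_apply) ?_ (funext fun x => ?_) rfl (fun x h h' => ?_)
    (fun x h => ?_) (fun x h => ?_)
  · dsimp only; split <;> simp
  · simp only [Ctx.join, ctxU]; split <;> simp
  · have := hc x
    dsimp only
    generalize σ x = s, τ x = t, υ x = u at *
    cases this with
    | left => cases s <;> simp [St.usedTy, St.provTy]
    | right => cases t <;> simp [St.usedTy, St.provTy]
    | link => simp [St.usedTy, St.provTy]
  · have := hc x
    simp only [ctxP, Ctx.join]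
    generalize σ x = s, τ x = t, υ x = u at *
    cases this with
    | left => cases s <;> simp [St.usedTy, St.provTy]
    | right => cases t <;> simp [St.usedTy, St.provTy]
    | link => simp [St.usedTy, St.provTy]
  · have := hc x
    simp only [ctxU]
    generalize σ x = s, τ x = t, υ x = u at *
    cases this with
    | left => cases s <;> simp [St.usedTy, St.provTy]
    | right => cases t <;> simp [St.usedTy, St.provTy]
    | link => simp [St.usedTy, St.provTy]
  · have := hc O.chan
    rw [hA] at this ⊢
    generalize τ O.chan = t, υ O.chan = u at *
    cases this; simp [St.provTy]
  · rw [(hc x).ctxP_apply, hP]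
    by_cases hx : x = O.chan <;> simp [Ctx.set, Ctx.single, hx]
  · have h₁ := (key x).1 h
    have h₂ := (key x).2 h'
    have := hc x
    generalize σ x = s, τ x = t, υ x = u at *
    cases this <;> simp_all
  · have h₂ := (key x).2 h
    have := hc x
    generalize σ x = s, τ x = t, υ x = u at *
    cases this <;> simp_all [St.usedTy]
    simp [St.provTy]
  · have h₂ := (key x).1 h
    have := hc x
    simp only [ctxU]
    generalize σ x = s, τ x = t, υ x = u at *
    cases this <;> simp_all [St.usedTy]

theorem ProcSt.ctxU_eq {c : Chan} {A : Ty} {σ : Chan → St} {P : Proc}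
    (ht : Typed S Δ q P c A) (h : ∀ x, ProcSt c A Δ x (σ x)) : ctxU σ = Δ := by
  ext1 x
  have h₁ := h x
  have h₂ := ht.ctx_self
  unfold ctxU
  generalize σ x = s at *
  cases h₁ <;> simp_all [St.usedTy]

/-- The empty tail of the last object is absorbed by relaxing states and discarding potential.
Reserved channels leave no trace in the contexts. -/
theorem CT.toCTyped (hS : S.WellFormed) {σ : Chan → St} (h : CT S σ q C) (hC : C ≠ []) :
    CTyped S (ctxU σ) q C (ctxP σ) := by
  induction h with
  | nil => exact absurd rfl hC
  | @proc Δ A c w P R q q₁ q₂ σ τ υ ht hp hR hc hq ih =>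
    have hone : ∀ {σ q₁ A Δ}, Typed S Δ q₁ P c A → (∀ x, ProcSt c A Δ x (σ x)) →
        CTyped S (ctxU σ) (q₁ + w) [.proc c w P] (ctxP σ) := by
      intro σ q₁ A Δ ht hp
      obtain ⟨B, hB, hP⟩ := (ProcSt.sole hp).ctxP_eq
      have : B = A := by
        have := hp c
        rw [hB] at this
        cases this; rfl
      rw [ProcSt.ctxU_eq ht hp]
      exact .proc ht rfl (this ▸ hP)
    cases R with
    | nil =>
      obtain ⟨Δ', A', ht', hp'⟩ := ProcSt.lift ht hp fun x => (hc x).le_left hS (hR.idle x)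
      rw [hq]
      exact (hone ht' hp').weak q₂
    | cons O R =>
      rw [hq]
      exact .of_comp (hone ht hp) (.proc_intro ht hp) (ProcSt.sole hp) (ih (by simp)) hR hc
  | @dist n c R q q₂ σ τ υ p C σs qs hC' hs hp hR hc hq ihC ihR =>
    -- Each branch provides `c`, which an idle empty configuration cannot do.
    have hne : ∀ i, C i ≠ [] := by
      intro i hi
      obtain ⟨A, hA⟩ := (hp c).2 rfl
      have h₁ := hs c
      rw [hA] at h₁
      cases h₁ with | prov As h₁ _ => ?_
      have h₂ := hC' i
      rw [hi] at h₂
      rcases h₂.idle c with h | h <;> simp [h₁] at h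
    have hone : ∀ {υ}, (∀ x, DSum S p (fun i => σs i x) (υ x)) → Sole c υ →
        CTyped S (ctxU υ) (∑ i, p.w i * qs i) [.dist c n p C] (ctxP υ) := by
      intro υ hs hp
      obtain ⟨A, hA, hP⟩ := hp.ctxP_eq
      have h₁ := hs c
      rw [hA] at h₁
      cases h₁ with | prov As h₁ hw => ?_
      refine .dist (Δs := fun i => ctxU (σs i)) (As := As) (fun i => ?_) (fun x => ?_) hw rfl hP
      · have hsole : Sole c (σs i) := by
          intro x
          rw [← hp x]
          constructor
          · rintro ⟨A, hA⟩
            have := hs x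
            generalize υ x = u at this
            cases this with
            | prov => exact ⟨_, rfl⟩
            | used As h => simp [h] at hA
            | inner h => rcases h i with h | h <;> simp [h] at hA
            | absent h => simp [h] at hA
          · intro h
            rw [(hp x).1 h]
            exact ⟨_, h₁ i⟩
        obtain ⟨B, hB, hP⟩ := hsole.ctxP_eq
        rw [h₁ i] at hB
        cases hB
        rw [← hP]
        exact ihC i (hne i)
      · have := hs x
        simp only [ctxU]
        generalize υ x = u at this
        cases this with
        | prov As h => exact .inl ⟨rfl, fun i => by rw [h i]; rfl⟩
        | used As h hw => exact .inr ⟨_, As, rfl, fun i => by rw [h i]; rfl, hw⟩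
        | inner h => exact .inl ⟨rfl, fun i => by rcases h i with h | h <;> rw [h] <;> rfl⟩
        | absent h => exact .inl ⟨rfl, fun i => by rw [h i]; rfl⟩
    cases R with
    | nil =>
      have hle : ∀ x, StLe S (σ x) (υ x) := fun x => (hc x).le_left hS (hR.idle x)
      rw [hq]
      exact (hone (fun x => (hs x).lift (hle x)) (hp.le hle)).weak q₂
    | cons O R =>
      rw [hq]
      exact .of_comp (hone hs hp) (.dist_intro hC' hs hp rfl) hp (ihR (by simp)) hR hc

end

/-! ### Separation of the provided channels -/

theorem provides_append {b : Chan} {C₁ C₂ : Config} :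
    Provides b (C₁ ++ C₂) ↔ Provides b C₁ ∨ Provides b C₂ := by
  induction C₁ with
  | nil =>
    simp only [List.nil_append, iff_or_self]
    intro h; cases h
  | cons O C ih =>
    rw [List.cons_append, provides_cons, ih, provides_cons (C := C), or_assoc]

/-- Composed objects provide different channels, at every depth. -/
inductive Separated : Config → Prop
  | nil : Separated []
  | proc {c w P R} : ¬ Provides c R → Separated R → Separated (.proc c w P :: R)
  | dist {c n p R} {C : Fin n → Config} : (∀ i, Separated (C i)) →
      (∀ b, Provides b [.dist c n p C] → ¬ Provides b R) → Separated R →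
      Separated (.dist c n p C :: R)

theorem provides_nil {b : Chan} : ¬ Provides b [] := fun h => by cases h

theorem separated_cons {O : Obj} {C : Config} : Separated (O :: C) ↔
    Separated [O] ∧ Separated C ∧ ∀ b, Provides b [O] → ¬ Provides b C := by
  constructor
  · intro h
    cases h with
    | proc h₁ h₂ =>
      exact ⟨.proc provides_nil .nil, h₂, fun b hb => by rwa [provides_proc.1 hb]⟩
    | dist h₀ h₁ h₂ => exact ⟨.dist h₀ (fun _ _ => provides_nil) .nil, h₂, h₁⟩
  · rintro ⟨h, h', h''⟩
    cases h with
    | proc h₁ h₂ => exact .proc (h'' _ (.head rfl)) h'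
    | dist h₀ h₁ h₂ => exact .dist h₀ h'' h'

theorem separated_append {C₁ C₂ : Config} : Separated (C₁ ++ C₂) ↔
    Separated C₁ ∧ Separated C₂ ∧ ∀ b, Provides b C₁ → ¬ Provides b C₂ := by
  induction C₁ with
  | nil => exact ⟨fun h => ⟨.nil, h, fun b hb => by cases hb⟩, fun h => h.2.1⟩
  | cons O C ih =>
    rw [List.cons_append, separated_cons, ih, separated_cons (C := C)]
    have h₁ : ∀ b, Provides b (C ++ C₂) ↔ Provides b C ∨ Provides b C₂ :=
      fun b => provides_append
    have h₂ : ∀ b, Provides b (O :: C) ↔ Provides b [O] ∨ Provides b C := fun b => provides_cons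
    grind

theorem separated_dist {c : Chan} {n : ℕ} {p : FinDist (Fin n)} {C : Fin n → Config} :
    Separated [.dist c n p C] ↔ ∀ i, Separated (C i) :=
  ⟨fun h => by cases h with | dist h _ _ => exact h,
    fun h => .dist h (fun _ _ => provides_nil) .nil⟩

/-- A channel provided on both sides of a composition would have state `inner` or `prov` on both
sides, and no composition rule allows that. -/
theorem CT.separated {S : Sig} {σ : Chan → St} {q : ℚ≥0} {C : Config} (h : CT S σ q C) :
    Separated C := by
  have key : ∀ {σ τ υ : Chan → St} {q₁ q₂ : ℚ≥0} {O : Obj} {C : Config},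
      CT S σ q₁ [O] → CT S τ q₂ C → (∀ x, SComp (σ x) (τ x) (υ x)) →
      ∀ b, Provides b [O] → ¬ Provides b C := by
    intro σ τ υ q₁ q₂ O C h₁ h₂ hc b hb hb'
    have h₃ := h₁.provides hb
    have h₄ := h₂.provides hb'
    have := hc b
    generalize σ b = s, τ b = t, υ b = u at *
    cases this <;> simp_all
  induction h with
  | nil => exact .nil
  | proc ht hp hR hc hq ih =>
    exact .proc (key (.proc_intro (w := 0) ht hp) hR hc _ (.head rfl)) ih
  | dist hC hs hp hR hc hq ihC ihR =>
    exact .dist ihC (key (.dist_intro hC hs hp rfl) hR hc) ihR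

/-! ### Processes inside objects -/

/-- Some process inside the object has the property `φ`. -/
inductive Deep (φ : Chan → Proc → Prop) : Obj → Prop
  | proc {c w P} : φ c P → Deep φ (.proc c w P)
  | dist {c n p} {C : Fin n → Config} {O : Obj} (i : Fin n) : O ∈ C i → Deep φ O →
      Deep φ (.dist c n p C)

/-- Some process inside the configuration has the property `φ`. -/
def DeepC (φ : Chan → Proc → Prop) (C : Config) : Prop := ∃ O ∈ C, Deep φ O

section Deep

variable {φ : Chan → Proc → Prop} {O O' : Obj} {C C₁ C₂ : Config}

theorem deepC_cons : DeepC φ (O :: C) ↔ Deep φ O ∨ DeepC φ C := by simp [DeepC]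

theorem deepC_append : DeepC φ (C₁ ++ C₂) ↔ DeepC φ C₁ ∨ DeepC φ C₂ := by
  simp [DeepC, or_and_right, exists_or]

theorem deepC_nil : ¬ DeepC φ [] := by simp [DeepC]

theorem deepC_singleton : DeepC φ [O] ↔ Deep φ O := by simp [DeepC]

theorem deep_proc {c : Chan} {w : ℚ≥0} {P : Proc} : Deep φ (.proc c w P) ↔ φ c P :=
  ⟨fun h => by cases h with | proc h => exact h, .proc⟩

theorem deep_dist {c : Chan} {n : ℕ} {p : FinDist (Fin n)} {C : Fin n → Config} :
    Deep φ (.dist c n p C) ↔ ∃ i, DeepC φ (C i) :=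
  ⟨fun h => by cases h with | dist i h h' => exact ⟨i, _, h, h'⟩,
    fun ⟨i, _, h, h'⟩ => .dist i h h'⟩

theorem provides_of_mem {b : Chan} (h : O ∈ C) (hb : Provides b [O]) : Provides b C := by
  obtain ⟨C₁, C₂, rfl⟩ := List.append_of_mem h
  exact provides_append.2 (.inr (provides_cons.2 (.inl hb)))

theorem Deep.provides (h : Deep φ O) : ∃ c P, φ c P ∧ Provides c [O] := by
  induction h with
  | proc h => exact ⟨_, _, h, .head rfl⟩
  | dist i h h' ih =>
    obtain ⟨c, P, h₁, h₂⟩ := ih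
    exact ⟨c, P, h₁, provides_dist.2 (.inr ⟨i, provides_of_mem h h₂⟩)⟩

end Deep

/-- The process is a client that is ready to communicate along `d`. -/
def Client (d : Chan) (κ : CommSort) (c : Chan) (Q : Proc) : Prop := c ≠ d ∧ Blocked d κ Q

/-- A process that provides `d`; in the case of a probabilistic external choice, it receives or
forwards. -/
def Server (d : Chan) (κ : CommSort) (c : Chan) (P : Proc) : Prop :=
  c = d ∧ (κ = .pext →
    (∃ L P', P = .pcase (.chan d) L P') ∨ ∃ e, P = .fwd (.chan d) (.chan e))

/-- The decomposition rules only rearrange the processes, so the induction finds the two processes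
that finally synchronize among the original ones. Separation shows that the client does not itself
provide `d`. The restriction on servers for `pext` is kept because exactly then a provider must be
retyped when it is copied. -/
theorem CStep.deep {d : Chan} {κ : CommSort} {C C' : Config} (h : CStep d κ C C')
    (hC : Separated C) : DeepC (Client d κ) C ∧ DeepC (Server d κ) C := by
  have base : ∀ {κ c wc wd Q P}, Separated [.proc c wc Q, .proc d wd P] → Blocked d κ Q →
      (κ = .pext →
        (∃ L P', P = .pcase (.chan d) L P') ∨ ∃ e, P = .fwd (.chan d) (.chan e)) →
      DeepC (Client d κ) [.proc c wc Q, .proc d wd P] ∧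
      DeepC (Server d κ) [.proc c wc Q, .proc d wd P] := by
    intro κ c wc wd Q P hs hQ hP
    simp only [deepC_cons, deep_proc]
    refine ⟨.inl ⟨fun h => ?_, hQ⟩, .inr (.inl ⟨rfl, hP⟩)⟩
    exact (separated_cons.1 hs).2.2 c (.head rfl) (.head h.symm)
  induction h with
  | ichoice hk => exact base hC .caseL (by simp)
  | echoice hk => exact base hC .sendL (by simp)
  | tensor => exact base hC .recvC (by simp)
  | lolli => exact base hC .sendC (by simp)
  | one => exact base hC .wait (by simp)
  | id hQ => exact base hC hQ fun _ => .inr ⟨_, rfl⟩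
  | payPot => exact base hC .get (by simp)
  | getPot => exact base hC .pay (by simp)
  | pichoice hk => exact base hC .pcase (by simp)
  | pechoice hk => exact base hC .psend fun _ => .inl ⟨_, _, rfl⟩
  | @dist κ c n p C i C' h ih =>
    have := ih (separated_dist.1 hC i)
    simp only [deepC_singleton, deep_dist]
    exact ⟨⟨i, this.1⟩, ⟨i, this.2⟩⟩
  | @sdistR κ c w Q n p C C' h ih =>
    obtain ⟨h₁, h₂, h₃⟩ := separated_cons.1 hC
    have := ih (separated_dist.2 fun i => separated_cons.2
      ⟨h₁, separated_dist.1 h₂ i, fun b hb hb' => h₃ b hb (.inner i hb')⟩)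
    simp only [deepC_cons, deep_dist, deepC_nil, or_false, deep_proc] at this ⊢
    grind
  | @sdistL κ c w P n p C C' h ih =>
    obtain ⟨h₁, h₂, h₃⟩ := separated_cons.1 hC
    have := ih (separated_dist.2 fun i => separated_append.2
      ⟨separated_dist.1 h₁ i, h₂, fun b hb hb' => h₃ b (.inner i hb) hb'⟩)
    simp only [deepC_cons, deepC_append, deep_dist, deepC_nil, or_false, deep_proc] at this ⊢
    grind
  | @bdistD c n m p p' C D C'' h ih =>
    obtain ⟨h₁, h₂, h₃⟩ := separated_cons.1 hC
    have := ih (separated_dist.2 fun k => separated_append.2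
      ⟨separated_dist.1 h₁ _, separated_dist.1 h₂ _,
        fun b hb hb' => h₃ b (.inner _ hb) (.inner _ hb')⟩)
    simp only [deepC_cons, deepC_append, deep_dist, deepC_nil, or_false] at this ⊢
    grind
  | @bdistR c n m p p' C D C'' h ih =>
    obtain ⟨h₁, h₂, h₃⟩ := separated_cons.1 hC
    have := ih (separated_dist.2 fun j => separated_cons.2
      ⟨h₁, separated_dist.1 h₂ _, fun b hb hb' => h₃ b hb (.inner _ hb')⟩)
    simp only [deepC_cons, deep_dist, deepC_nil, or_false] at this ⊢
    grind
  | @bdistL c n m p p' C D C'' h ih =>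
    obtain ⟨h₁, h₂, h₃⟩ := separated_cons.1 hC
    have := ih (separated_dist.2 fun j => separated_append.2
      ⟨separated_dist.1 h₁ _, h₂, fun b hb hb' => h₃ b (.inner _ hb) hb'⟩)
    simp only [deepC_cons, deepC_append, deep_dist, deepC_nil, or_false] at this ⊢
    grind
  | @frame₁ κ O R C₁ C₂ h ih =>
    have := ih (separated_cons.1 (separated_append.1 hC).2.1).1
    simp only [deepC_append, deepC_cons, deepC_nil, or_false] at this ⊢
    tauto
  | @frame₂ κ O O' R C₁ C₂ C₃ hd h ih =>
    have h₁ := (separated_append.1 hC).1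
    have h₂ := separated_cons.1 (separated_append.1 hC).2.1
    have h₃ := separated_cons.1 (separated_append.1 h₁).2.1
    have h₄ := (separated_append.1 hC).2.2
    have := ih (separated_cons.2 ⟨h₃.1, h₂.1, fun b hb hb' => h₄ b
      (provides_of_mem (O := O) (by simp) hb) (provides_cons.2 (.inl hb'))⟩)
    simp only [deepC_append, deepC_cons, deepC_nil, or_false] at this ⊢
    tauto

/-! ### Clients use the channel along which they communicate -/

section Link

variable {S : Sig}

/-- The syntactic sort of a communication is determined by the shape of the channel's type, and
shapes are stable under type equality. -/
theorem Typed.blocked (hS : S.WellFormed) {Δ : Ctx} {q : ℚ≥0} {Q : Proc} {c d : Chan} {C : Ty}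
    {κ : CommSort} (h : Typed S Δ q Q c C) (hc : c ≠ d) (hQ : Blocked d κ Q) :
    ∃ A, Δ d = some A ∧ (S.shape A).sort = κ := by
  obtain ⟨Δ', q', C', r, h, hΔ, -, -⟩ := h.inv hS
  suffices ∃ A, Δ' d = some A ∧ (S.shape A).sort = κ by
    obtain ⟨A, h₁, h₂⟩ := this
    obtain ⟨A', h₃, h₄⟩ := hΔ.some_left h₁
    exact ⟨A', h₃, by rw [← h₄.shape_eq, h₂]⟩
  cases hQ <;> cases h <;> first
    | exact absurd rfl hc
    | exact ⟨_, ‹_›, rfl⟩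

/-- On the way outwards a used channel either stays used, with the same shape, or becomes internal.
It is never provided to the outside. -/
theorem CT.deep_client (hS : S.WellFormed) {σ : Chan → St} {q : ℚ≥0} {C : Config} {d : Chan}
    {κ : CommSort} (h : CT S σ q C) (hC : DeepC (Client d κ) C) :
    σ d = .inner ∨ ∃ A, σ d = .used A ∧ (S.shape A).sort = κ := by
  have comp : ∀ {s t u : St}, SComp s t u →
      ((s = .inner ∨ ∃ A, s = .used A ∧ (S.shape A).sort = κ) ∨
        (t = .inner ∨ ∃ A, t = .used A ∧ (S.shape A).sort = κ)) →
      (u = .inner ∨ ∃ A, u = .used A ∧ (S.shape A).sort = κ) := by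
    intro s t u h h'
    cases h <;> simp_all
  induction h with
  | nil => exact absurd hC deepC_nil
  | @proc Δ A c w P R q q₁ q₂ σ τ υ ht hp hR hc hq ih =>
    refine comp (hc d) ((deepC_cons.1 hC).imp (fun h => .inr ?_) ih)
    obtain ⟨h₁, h₂⟩ := deep_proc.1 h
    obtain ⟨A, h₃, h₄⟩ := ht.blocked hS h₁ h₂
    have := hp d
    generalize σ d = s at this
    cases this <;> simp_all
  | @dist n c R q q₂ σ τ υ p C σs qs hC' hs hp hR hc hq ihC ihR =>
    refine comp (hc d) ((deepC_cons.1 hC).imp (fun h => ?_) ihR)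
    obtain ⟨i, h⟩ := deep_dist.1 h
    have h₁ := ihC i h
    have h₂ := hs d
    generalize σ d = s at *
    rcases h₁ with h₁ | ⟨A, h₁, h₃⟩
    · cases h₂ <;> simp_all
    · obtain ⟨B, h₄, h₅⟩ := h₂.branch_used h₁
      exact .inr ⟨B, h₄, by rw [← h₅, h₃]⟩

/-- If two objects communicate, then the first one uses the channel that the second one
provides. -/
theorem CStep.link (hS : S.WellFormed) {d : Chan} {κ : CommSort} {O O' : Obj} {R : Config}
    (h : CStep d κ [O, O'] R) (hd : O'.chan = d) {σ τ υ : Chan → St} {q q' : ℚ≥0}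
    (hO : CT S σ q [O]) (hO' : CT S τ q' [O']) (hc : ∀ x, SComp (σ x) (τ x) (υ x)) :
    (∃ A, σ d = .used A ∧ τ d = .prov A ∧ (S.shape A).sort = κ) ∧ Deep (Server d κ) O' := by
  have hs := (CT.cons hS hO hO' hc).separated
  obtain ⟨h₁, h₂⟩ := h.deep hs
  obtain ⟨B, hB⟩ := (hO'.sole hS d).2 hd.symm
  have h₃ := hc d
  constructor
  · rcases deepC_cons.1 h₁ with h₁ | h₁
    · rcases hO.deep_client hS (deepC_singleton.2 h₁) with h | ⟨A, h, h'⟩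
      · rw [h, hB] at h₃
        cases h₃
      · rw [h, hB] at h₃
        generalize υ d = u at h₃
        cases h₃
        exact ⟨_, h, hB, h'⟩
    · rcases hO'.deep_client hS h₁ with h | ⟨A, h, h'⟩ <;> simp [h] at hB
  · rcases deepC_cons.1 h₂ with h₂ | h₂
    · obtain ⟨c, P, ⟨rfl, _⟩, h₄⟩ := h₂.provides
      exact absurd (.head hd) ((separated_cons.1 hs).2.2 _ h₄)
    · exact deepC_singleton.1 h₂

end Link

/-! ### Decomposition of distribution objects -/

/-- The states of a channel in the branches of a distribution object whose branches are composed of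
two parts. -/
inductive Branching (S : Sig) {ι : Type} [Fintype ι] (p : FinDist ι) (ss ts : ι → St) : St → Prop
  | link (As : ι → Ty) : (∀ k, ss k = .used (As k)) → (∀ k, ts k = .prov (As k)) →
      Branching S p ss ts .inner
  | left {u} : (∀ k, ts k = .absent) → DSum S p ss u → Branching S p ss ts u
  | right {u} : (∀ k, ss k = .absent) → DSum S p ts u → Branching S p ss ts u

theorem Branching.comp {S : Sig} {ι : Type} [Fintype ι] {p : FinDist ι} {ss ts : ι → St} {u : St}
    (h : Branching S p ss ts u) :
    ∃ us : ι → St, (∀ k, SComp (ss k) (ts k) (us k)) ∧ DSum S p us u := by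
  cases h with
  | link As h₁ h₂ =>
    exact ⟨fun _ => .inner, fun k => by rw [h₁, h₂]; exact .link _, .inner fun _ => .inr rfl⟩
  | left h₁ h₂ => exact ⟨ss, fun k => by rw [h₁]; exact .left _, h₂⟩
  | right h₁ h₂ => exact ⟨ts, fun k => by rw [h₁]; exact .right _, h₂⟩

theorem DSum.eq_absent {S : Sig} {ι : Type} [Fintype ι] {p : FinDist ι} {ss : ι → St}
    (h : DSum S p ss .absent) (i : ι) : ss i = .absent := by
  cases h with | absent h => exact h i

section Decompose

variable {S : Sig}

theorem CT.dist_comp (hS : S.WellFormed) {N : ℕ} {p : FinDist (Fin N)} {c : Chan}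
    {C₁ C₂ : Fin N → Config} {σs τs : Fin N → Chan → St} {qs qs' : Fin N → ℚ≥0} {υ : Chan → St}
    {q : ℚ≥0} (h₁ : ∀ k, CT S (σs k) (qs k) (C₁ k)) (h₂ : ∀ k, CT S (τs k) (qs' k) (C₂ k))
    (hs : ∀ x, Branching S p (fun k => σs k x) (fun k => τs k x) (υ x)) (hc : Sole c υ)
    (hq : q = ∑ k, p.w k * (qs k + qs' k)) :
    CT S υ q [.dist c N p (fun k => C₁ k ++ C₂ k)] := by
  choose us h₃ h₄ using fun x => (hs x).comp
  exact .dist_intro (fun k => (h₁ k).append hS (h₂ k) fun x => h₃ x k) h₄ hc hq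

/-- The provider exposes only `d`, and the link turns `d` into an internal channel; the composite
exposes what the client exposes. -/
theorem Sole.comp {c d : Chan} {σ τ υ : Chan → St} {A : Ty} (hσ : Sole c σ) (hτ : Sole d τ)
    (hd : σ d = .used A) (hc : ∀ x, SComp (σ x) (τ x) (υ x)) : Sole c υ := by
  intro x
  have h₁ := hc x
  have h₂ := hτ x
  rw [← hσ x]
  by_cases hx : x = d
  · subst hx
    rw [hd] at h₁ ⊢
    obtain ⟨B, hB⟩ := h₂.2 rfl
    rw [hB] at h₁
    generalize υ x = u at *
    cases h₁; simp
  · generalize σ x = s, τ x = t, υ x = u at *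
    cases h₁ <;> simp_all

/-- An object `O` with state `σ` whose used channel `d` may have the type `As j` in branch `j`. -/
def SplitsClient (S : Sig) {ι : Type} [Fintype ι] (p : FinDist ι) (As : ι → Ty) (d : Chan)
    (σ : Chan → St) (q : ℚ≥0) (O : Obj) : Prop :=
  ∃ (σs : ι → Chan → St) (qs : ι → ℚ≥0), (∀ j, CT S (σs j) (qs j) [O]) ∧
    (∀ j, σs j d = .used (As j)) ∧ (∀ x, x ≠ d → DSum S p (fun j => σs j x) (σ x)) ∧
    q = ∑ j, p.w j * qs j

/-- An object `O` with state `τ` whose provided channel `d` may have the type `As j` in branch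
`j`. -/
def SplitsServer (S : Sig) {ι : Type} [Fintype ι] (p : FinDist ι) (As : ι → Ty) (d : Chan)
    (τ : Chan → St) (q : ℚ≥0) (O : Obj) : Prop :=
  ∃ (τs : ι → Chan → St) (qs : ι → ℚ≥0), (∀ j, CT S (τs j) (qs j) [O]) ∧
    (∀ j, τs j d = .prov (As j)) ∧ (∀ x, x ≠ d → DSum S p (fun j => τs j x) (τ x)) ∧
    q = ∑ j, p.w j * qs j

variable {ι : Type} [Fintype ι] {p : FinDist ι} {As : ι → Ty} {A : Ty} {d : Chan}
  {σ τ υ : Chan → St} {q q' : ℚ≥0} {O O' : Obj}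

/-- When all branch types equal `A`, copies with constant potential suffice and only a conversion at
`d` is required. -/
theorem CT.splitsClient (hS : S.WellFormed) (h : CT S σ q [O]) (hd : σ d = .used A)
    (hA : ∀ i, TyEq S (As i) A) : SplitsClient S p As d σ q O := by
  refine ⟨fun j => Function.update σ d (.used (As j)), fun _ => q, fun j => h.mono hS fun x => ?_,
    fun j => by simp, fun x hx => ?_, (p.sum_const q).symm⟩
  · by_cases hx : x = d
    · subst hx; rw [hd]; simpa using .used (hA j).symm
    · simpa [hx] using .refl hS _
  · simpa [hx] using .const hS p _

theorem CT.splitsServer (hS : S.WellFormed) (h : CT S τ q [O]) (hd : τ d = .prov A)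
    (hA : ∀ i, TyEq S (As i) A) : SplitsServer S p As d τ q O := by
  refine ⟨fun j => Function.update τ d (.prov (As j)), fun _ => q, fun j => h.mono hS fun x => ?_,
    fun j => by simp, fun x hx => ?_, (p.sum_const q).symm⟩
  · by_cases hx : x = d
    · subst hx; rw [hd]; simpa using .prov (hA j).symm
    · simpa [hx] using .refl hS _
  · simpa [hx] using .const hS p _

/-- The states of a process with context `Δ` that provides `c : A`; the idle channels are reserved
as in `σ`. -/
def procSt (c : Chan) (A : Ty) (Δ : Ctx) (σ : Chan → St) (x : Chan) : St :=
  if x = c then .prov A else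
    match Δ x, σ x with
    | some B, _ => .used B
    | none, .inner => .inner
    | none, _ => .absent

theorem procSt_spec (c : Chan) (A : Ty) (Δ : Ctx) (σ : Chan → St) (x : Chan) :
    ProcSt c A Δ x (procSt c A Δ σ x) := by
  unfold procSt
  split
  · exact .prov ‹_›
  · split
    · exact .used ‹_› ‹_›
    · exact .inner ‹_› ‹_›
    · exact .absent ‹_› ‹_›

/-- Idle channels of the branches copy their status from `σ`: an absent channel has to be absent in
every branch, and an existing reservation is retained. -/
theorem procSt_dsum {c : Chan} {C : Ty} {Δ : Ctx} {Δs : ι → Ctx} {Cs : ι → Ty} {x : Chan}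
    (hσ : ProcSt c C Δ x (σ x)) (hw : WSumR S p Cs C)
    (hs : (Δ x = none ∧ ∀ i, Δs i x = none) ∨
      ∃ (A : Ty) (As : ι → Ty), Δ x = some A ∧ (∀ i, Δs i x = some (As i)) ∧ WSumL S p As A) :
    DSum S p (fun j => procSt c (Cs j) (Δs j) σ x) (σ x) := by
  unfold procSt
  generalize σ x = s at *
  cases hσ with
  | prov hx => exact .prov Cs (fun i => if_pos hx) hw
  | used hx hB =>
    rcases hs with ⟨h₁, h₂⟩ | ⟨A, As, h₁, h₂, h₃⟩
    · simp [h₁] at hB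
    · rw [h₁, Option.some.injEq] at hB
      subst hB
      exact .used As (fun i => by simp [hx, h₂]) h₃
  | inner hx hB =>
    have h₂ : ∀ i, Δs i x = none := by
      rcases hs with ⟨h₁, h₂⟩ | ⟨A, As, h₁, h₂, h₃⟩
      · exact h₂
      · simp [h₁] at hB
    exact .inner fun i => by simp [hx, h₂, St.Idle]
  | absent hx hB =>
    have h₂ : ∀ i, Δs i x = none := by
      rcases hs with ⟨h₁, h₂⟩ | ⟨A, As, h₁, h₂, h₃⟩
      · exact h₂
      · simp [h₁] at hB
    exact .absent fun i => by simp [hx, h₂]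

/-- This is the case in which the branches really differ; it lifts `Typed.split_client` from
contexts to states. The recorded work is the same constant in every branch. -/
theorem CT.splitsClient_pcase (hS : S.WellFormed) {c : Chan} {w : ℚ≥0} {L : Finset Label}
    {Q : {ℓ // ℓ ∈ L} → Proc} (h : CT S σ q [.proc c w (.pcase (.chan d) L Q)])
    (hd : σ d = .used A) (hA : WSumR S p As A) :
    SplitsClient S p As d σ q (.proc c w (.pcase (.chan d) L Q)) := by
  obtain ⟨Δ, q₁, C, ht, hp, rfl⟩ := h.proc_inv hS
  have hΔ : d ≠ c ∧ Δ d = some A := by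
    have := hp d
    rw [hd] at this
    cases this with | used h₁ h₂ => exact ⟨h₁, h₂⟩
  obtain ⟨Δj, qj, Cj, h₁, h₂, h₃, h₄, rfl⟩ := ht.split_client hS hΔ.2 hA
  refine ⟨fun j => procSt c (Cj j) (Δj j) σ, fun j => qj j + w,
    fun j => .proc_intro (h₁ j) (procSt_spec _ _ _ _), fun j => ?_, fun x hx => ?_,
    (p.sum_add_const _ _).symm⟩
  · simp [procSt, hΔ.1, h₂]
  · exact procSt_dsum (hp x) h₄ (by simpa [Ctx.erase, hx] using h₃ x)

theorem CT.splitsServer_proc (hS : S.WellFormed) {w : ℚ≥0} {P : Proc}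
    (hP : (∃ L P', P = .pcase (.chan d) L P') ∨ ∃ e, P = .fwd (.chan d) (.chan e))
    (h : CT S τ q [.proc d w P]) (hd : τ d = .prov A) (hA : WSumL S p As A) :
    SplitsServer S p As d τ q (.proc d w P) := by
  obtain ⟨Δ, q₁, C, ht, hp, rfl⟩ := h.proc_inv hS
  obtain rfl : A = C := by
    have := hp d
    rw [hd] at this
    cases this; rfl
  obtain ⟨Δj, qj, h₁, h₂, rfl⟩ := ht.split_server hS hP hA
  refine ⟨fun j => procSt d (As j) (Δj j) τ, fun j => qj j + w,
    fun j => .proc_intro (h₁ j) (procSt_spec _ _ _ _), fun j => ?_, fun x hx => ?_,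
    (p.sum_add_const _ _).symm⟩
  · simp [procSt]
  · have h₃ := procSt_dsum (S := S) (p := p) (Δs := Δj) (Cs := fun _ => A) (hp x)
      (.same fun _ => hS.tyEq_refl _) (h₂ x)
    simpa [procSt, hx] using h₃

/-- The client is copied into the branches of its provider. -/
theorem CT.push_client (hS : S.WellFormed) {m : ℕ} {p : FinDist (Fin m)} {C : Fin m → Config}
    (hO : CT S σ q [O]) (hO' : CT S τ q' [.dist d m p C])
    (hc : ∀ x, SComp (σ x) (τ x) (υ x)) (hd : σ d = .used A) (hd' : τ d = .prov A)
    (hsplit : ∀ As, WSumR S p As A → SplitsClient S p As d σ q O) :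
    CT S υ (q + q') [.dist O.chan m p (fun j => O :: C j)] := by
  obtain ⟨τs, qs', h₁, h₂, h₃, rfl⟩ := hO'.dist_inv hS
  have h₄ := h₂ d
  rw [hd'] at h₄
  -- `As` are the types at which the individual branches provide `d`. Each copy of the client has to
  -- be retyped against its own `As j`, which is what `hsplit` supplies.
  cases h₄ with | prov As h₄ hA => ?_
  obtain ⟨σs, qs, h₅, h₆, h₇, rfl⟩ := hsplit As hA
  refine CT.dist_comp (C₁ := fun _ => [O]) hS h₅ h₁ (fun x => ?_)
    ((hO.sole hS).comp h₃ hd hc) (p.sum_add _ _).symm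
  have h₈ := hc x
  by_cases hx : x = d
  · subst hx
    rw [hd, hd'] at h₈
    generalize υ x = u at *
    cases h₈
    exact .link As h₆ h₄
  · have h₉ := h₂ x
    have h₁₀ := h₇ x hx
    have h₁₁ := (h₃ x).1
    generalize υ x = u, σ x = s, τ x = t at *
    cases h₈ with
    | left => exact .left h₉.eq_absent h₁₀
    | right => exact .right h₁₀.eq_absent h₉
    | link B => exact absurd (h₁₁ ⟨B, rfl⟩) hx

/-- The provider is copied into the branches of its client. -/
theorem CT.push_server (hS : S.WellFormed) {c : Chan} {n : ℕ} {p : FinDist (Fin n)}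
    {C : Fin n → Config} (hO : CT S σ q [.dist c n p C]) (hO' : CT S τ q' [O'])
    (hc : ∀ x, SComp (σ x) (τ x) (υ x)) (hchan : O'.chan = d) (hd : σ d = .used A)
    (hd' : τ d = .prov A)
    (hsplit : ∀ As, WSumL S p As A → SplitsServer S p As d τ q' O') :
    CT S υ (q + q') [.dist c n p (fun i => C i ++ [O'])] := by
  obtain ⟨σs, qs, h₁, h₂, h₃, rfl⟩ := hO.dist_inv hS
  have h₄ := h₂ d
  rw [hd] at h₄
  cases h₄ with | used As h₄ hA => ?_
  obtain ⟨τs, qs', h₅, h₆, h₇, rfl⟩ := hsplit As hA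
  have hτ : Sole d τ := hchan ▸ hO'.sole hS
  refine CT.dist_comp (C₂ := fun _ => [O']) hS h₁ h₅ (fun x => ?_) (h₃.comp hτ hd hc)
    (p.sum_add _ _).symm
  have h₈ := hc x
  by_cases hx : x = d
  · subst hx
    rw [hd, hd'] at h₈
    generalize υ x = u at *
    cases h₈
    exact .link As h₄ h₆
  · have h₉ := h₂ x
    have h₁₀ := h₇ x hx
    have h₁₁ := (hτ x).1
    generalize υ x = u, σ x = s, τ x = t at *
    cases h₈ with
    | left => exact .left h₁₀.eq_absent h₉
    | right => exact .right h₉.eq_absent h₁₀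
    | link B => exact absurd (h₁₁ ⟨B, rfl⟩) hx

/-- Two distribution objects are replaced by their product. -/
theorem CT.push_prod (hS : S.WellFormed) {c : Chan} {n m : ℕ} {p : FinDist (Fin n)}
    {p' : FinDist (Fin m)} {C : Fin n → Config} {C' : Fin m → Config}
    (hO : CT S σ q [.dist c n p C]) (hO' : CT S τ q' [.dist d m p' C'])
    (hc : ∀ x, SComp (σ x) (τ x) (υ x)) (hd : σ d = .used A) (hd' : τ d = .prov A)
    (hA : (S.shape A).sort = .det) :
    CT S υ (q + q') [.dist c (n * m) (p.prod p')
      (fun k => C (finProdFinEquiv.symm k).1 ++ C' (finProdFinEquiv.symm k).2)] := by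
  obtain ⟨σs, qs, h₁, h₂, h₃, rfl⟩ := hO.dist_inv hS
  obtain ⟨τs, qs', h₁', h₂', h₃', rfl⟩ := hO'.dist_inv hS
  have h₄ := h₂ d
  rw [hd] at h₄
  cases h₄ with | used As h₄ hAs => ?_
  have h₄' := h₂' d
  rw [hd'] at h₄'
  cases h₄' with | prov Bs h₄' hBs => ?_
  -- For deterministic communication all branch types equal `A`. Both families are retyped at `A`
  -- itself, so that every client branch fits every provider branch.
  have e₁ : ∀ i, CT S (Function.update (σs i) d (.used A)) (qs i) (C i) := by
    refine fun i => (h₁ i).mono hS fun x => ?_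
    by_cases hx : x = d
    · subst hx; rw [h₄ i]; simpa using .used (hAs.tyEq (by simp [hA]) i)
    · simpa [hx] using .refl hS _
  have e₂ : ∀ j, CT S (Function.update (τs j) d (.prov A)) (qs' j) (C' j) := by
    refine fun j => (h₁' j).mono hS fun x => ?_
    by_cases hx : x = d
    · subst hx; rw [h₄' j]; simpa using .prov (hBs.tyEq (by simp [hA]) j)
    · simpa [hx] using .refl hS _
  refine CT.dist_comp hS (fun k => e₁ _) (fun k => e₂ _) (fun x => ?_) (h₃.comp h₃' hd hc) ?_
  · have h₈ := hc x
    by_cases hx : x = d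
    · subst hx
      rw [hd, hd'] at h₈
      generalize υ x = u at *
      cases h₈
      exact .link (fun _ => A) (fun k => by simp) fun k => by simp
    · have h₉ := (h₂ x).comap (FinDist.marginal_fst p p')
      have h₁₀ := (h₂' x).comap (FinDist.marginal_snd p p')
      have h₁₁ := (h₃' x).1
      simp only [Function.update_of_ne hx]
      generalize υ x = u, σ x = s, τ x = t at *
      cases h₈ with
      | left => exact .left h₁₀.eq_absent h₉
      | right => exact .right h₉.eq_absent h₁₀
      | link B => exact absurd (h₁₁ ⟨B, rfl⟩) hx
  · rw [FinDist.sum_add, FinDist.marginal_fst p p' qs, FinDist.marginal_snd p p' qs']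

end Decompose

/-! ### Preservation for communication between processes -/

/-- The state of `x` with respect to a client that provides `c : C` and a provider of `d`; `o` is the
type of `x` in the contexts of the two processes. -/
inductive PairSt (c : Chan) (C : Ty) (d : Chan) (o : Option Ty) (x : Chan) : St → Prop
  | prov : x = c → PairSt c C d o x (.prov C)
  | link : x ≠ c → x = d → PairSt c C d o x .inner
  | used {B} : x ≠ c → x ≠ d → o = some B → PairSt c C d o x (.used B)
  | idle {s} : x ≠ c → x ≠ d → o = none → s.Idle → PairSt c C d o x s

/-- A typed client `Q` and a typed provider `P` of the channel `d : A`. -/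
structure Linked (S : Sig) (c : Chan) (C : Ty) (d : Chan) (A : Ty) (Q P : Proc) (q q' : ℚ≥0)
    (Δ Δ' : Ctx) : Prop where
  client : Typed S Δ q Q c C
  server : Typed S Δ' q' P d A
  link : Δ d = some A
  provided : Δ' c = none
  disj : Δ.Disj Δ'

section

variable {S : Sig} {c d : Chan} {C A : Ty} {Q P : Proc} {q q' : ℚ≥0} {Δ Δ' : Ctx}

theorem Linked.ne (h : Linked S c C d A Q P q q' Δ Δ') : c ≠ d := by
  rintro rfl
  have := h.client.ctx_self
  rw [h.link] at this
  cases this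

/-- `CStep.link` shows that `d` is a genuine link between the two processes. At every other channel
at most one of them has a non-absent state, which gives disjoint contexts and the combined state
`PairSt`. -/
theorem CT.linked (hS : S.WellFormed) {υ : Chan → St} {r : ℚ≥0} {wc wd : ℚ≥0} {R : Config}
    {κ : CommSort} (h : CT S υ r [.proc c wc Q, .proc d wd P])
    (hstep : CStep d κ [.proc c wc Q, .proc d wd P] R) :
    ∃ C A q q' Δ Δ', Linked S c C d A Q P q q' Δ Δ' ∧
      (∀ x, PairSt c C d ((Δ x).or (Δ' x)) x (υ x)) ∧ r = q + wc + (q' + wd) := by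
  obtain ⟨σ, τ, r, r', h₁, h₂, hc, rfl⟩ := h.of_cons
  obtain ⟨⟨A, hd, hd', -⟩, -⟩ := hstep.link hS rfl h₁ h₂ hc
  obtain ⟨Δ, q, C, ht, hp, rfl⟩ := h₁.proc_inv hS
  obtain ⟨Δ', q', A', ht', hp', rfl⟩ := h₂.proc_inv hS
  have h₃ := hp d
  rw [hd] at h₃
  cases h₃ with | used hdc hΔ => ?_
  have h₄ := hp' d
  rw [hd'] at h₄
  cases h₄
  have key : ∀ x, (Δ x = none ∨ Δ' x = none) ∧ (x = c → Δ' x = none) ∧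
      PairSt c C d ((Δ x).or (Δ' x)) x (υ x) := by
    intro x
    have h₁ := hc x
    have h₂ := hp x
    have h₃ := hp' x
    have h₄ := ht.ctx_self
    have h₅ := ht'.ctx_self
    by_cases hxd : x = d
    · subst hxd
      rw [hd, hd'] at h₁
      generalize υ x = u at *
      cases h₁
      exact ⟨.inr h₅, fun h => absurd h hdc, .link hdc rfl⟩
    · generalize σ x = s, τ x = t, υ x = u at *
      cases h₂ with
      | prov hxc =>
        cases h₁ with
        | left => cases h₃ with | absent _ h => exact ⟨.inr h, fun _ => h, .prov hxc⟩
      | used hxc hΔ =>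
        cases h₁ with
        | left =>
          cases h₃ with | absent _ h => exact ⟨.inr h, fun _ => h, .used hxc hxd (by simp [hΔ])⟩
        | link => cases h₃; contradiction
      | inner hxc hΔ =>
        cases h₁
        cases h₃ with
          | absent _ h => exact ⟨.inr h, fun _ => h, .idle hxc hxd (by simp [hΔ, h]) (.inr rfl)⟩
      | absent hxc hΔ =>
        have : t = u := by cases h₁ <;> rfl
        subst this
        refine ⟨.inl hΔ, fun h => absurd h hxc, ?_⟩
        cases h₃ with
        | prov h => exact absurd h hxd
        | used _ h => exact .used hxc hxd (by simp [hΔ, h])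
        | inner _ h => exact .idle hxc hxd (by simp [hΔ, h]) (.inr rfl)
        | absent _ h => exact .idle hxc hxd (by simp [hΔ, h]) (.inl rfl)
  exact ⟨C, A, q, q', Δ, Δ', ⟨ht, ht', hΔ, (key c).2.1 rfl, fun x => (key x).1⟩,
    fun x => (key x).2.2, rfl⟩

/-- The combined states are distributed again: `d` becomes the link, used channels go to the process
whose context contains them, and reservations are assigned to the client. -/
theorem Linked.toCT (hS : S.WellFormed) (h : Linked S c C d A Q P q q' Δ Δ') {υ : Chan → St}
    (hυ : ∀ x, PairSt c C d ((Δ x).or (Δ' x)) x (υ x)) (wc wd : ℚ≥0) :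
    CT S υ (q + wc + (q' + wd)) [.proc c wc Q, .proc d wd P] := by
  have key : ∀ x, ∃ s t, ProcSt c C Δ x s ∧ ProcSt d A Δ' x t ∧ SComp s t (υ x) := by
    intro x
    have h₁ := hυ x
    have h₂ := h.disj x
    generalize υ x = u at *
    cases h₁ with
    | prov hx =>
      subst hx
      exact ⟨_, _, .prov rfl, .absent h.ne h.provided, .left _⟩
    | link hx hx' =>
      subst hx'
      exact ⟨_, _, .used hx h.link, .prov rfl, .link A⟩
    | @used B hx hx' ho =>
      cases hΔ : Δ x with
      | some B' =>
        have : Δ' x = none := by simpa [hΔ] using h₂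
        obtain rfl : B' = B := by simpa [hΔ, this] using ho
        exact ⟨_, _, .used hx hΔ, .absent hx' this, .left _⟩
      | none =>
        exact ⟨_, _, .absent hx hΔ, .used hx' (by simpa [hΔ] using ho), .right _⟩
    | idle hx hx' ho hi =>
      obtain ⟨h₃, h₄⟩ := Option.or_eq_none_iff.1 ho
      rcases hi with rfl | rfl
      · exact ⟨_, _, .absent hx h₃, .absent hx' h₄, .left _⟩
      · exact ⟨_, _, .inner hx h₃, .absent hx' h₄, .left _⟩
  choose σ τ h₁ h₂ h₃ using key
  exact .cons hS (.proc_intro h.client h₁) (.proc_intro h.server h₂) h₃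

/-- A step of a client and its provider that changes the type of their channel. -/
theorem CT.pair_step (hS : S.WellFormed) {υ : Chan → St} {r : ℚ≥0} {wc wd : ℚ≥0} {R : Config}
    {κ : CommSort} {Q' P' : Proc} (hfin : {x | υ x ≠ .absent}.Finite)
    (h : CT S υ r [.proc c wc Q, .proc d wd P])
    (hstep : CStep d κ [.proc c wc Q, .proc d wd P] R)
    (H : ∀ C A q q' Δ Δ', Linked S c C d A Q P q q' Δ Δ' → {x | Δ x ≠ none}.Finite →
      {x | Δ' x ≠ none}.Finite → ∃ A₁ q₁ q₁' Δ₁ Δ₁', Linked S c C d A₁ Q' P' q₁ q₁' Δ₁ Δ₁' ∧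
        (∀ x, x ≠ c → x ≠ d → (Δ₁ x).or (Δ₁' x) = (Δ x).or (Δ' x)) ∧ q₁ + q₁' = q + q') :
    CT S υ r [.proc c wc Q', .proc d wd P'] := by
  obtain ⟨C, A, q, q', Δ, Δ', hl, hυ, rfl⟩ := h.linked hS hstep
  have hsub : ∀ x, υ x = .absent → (Δ x).or (Δ' x) = none := by
    intro x hx
    have := hυ x
    rw [hx] at this
    cases this with | idle _ _ h => exact h
  obtain ⟨A₁, q₁, q₁', Δ₁, Δ₁', hl', ho, hq⟩ := H C A q q' Δ Δ' hl
    (hfin.subset fun x hx hx' => hx (Option.or_eq_none_iff.1 (hsub x hx')).1)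
    (hfin.subset fun x hx hx' => hx (Option.or_eq_none_iff.1 (hsub x hx')).2)
  have : q + wc + (q' + wd) = q₁ + wc + (q₁' + wd) := by
    rw [add_add_add_comm, ← hq]; ring
  rw [this]
  refine hl'.toCT hS (fun x => ?_) wc wd
  have := hυ x
  generalize υ x = u at *
  cases this with
  | prov h => exact .prov h
  | link h h' => exact .link h h'
  | used h h' h'' => exact .used h h' (by rw [ho x h h', h''])
  | idle h h' h'' hi => exact .idle h h' (by rw [ho x h h', h'']) hi

/-- A step of a client and its provider in which the provider terminates. -/
theorem CT.merge_step (hS : S.WellFormed) {υ : Chan → St} {r : ℚ≥0} {wc wd : ℚ≥0} {R : Config}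
    {κ : CommSort} {Q' : Proc} (h : CT S υ r [.proc c wc Q, .proc d wd P])
    (hstep : CStep d κ [.proc c wc Q, .proc d wd P] R)
    (H : ∀ C A q q' Δ Δ', Linked S c C d A Q P q q' Δ Δ' → ∃ Δ₁, Typed S Δ₁ (q + q') Q' c C ∧
        Δ₁ d = none ∧ (∀ x, x ≠ c → x ≠ d → Δ₁ x = (Δ x).or (Δ' x))) :
    CT S υ r [.proc c (wc + wd) Q'] := by
  obtain ⟨C, A, q, q', Δ, Δ', hl, hυ, rfl⟩ := h.linked hS hstep
  obtain ⟨Δ₁, ht, hd, ho⟩ := H C A q q' Δ Δ' hl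
  rw [add_add_add_comm]
  refine .proc_intro ht fun x => ?_
  have := hυ x
  generalize υ x = u at *
  cases this with
  | prov h => exact .prov h
  -- No process provides `d` any longer, but it remains reserved. Thus the state assignment seen
  -- from outside is unchanged.
  | link h h' => exact .inner h (h' ▸ hd)
  | used h h' h'' => exact .used h (by rw [ho x h h', h''])
  | idle h h' h'' hi =>
    rcases hi with rfl | rfl
    · exact .absent h (by rw [ho x h h', h''])
    · exact .inner h (by rw [ho x h h', h''])

/-- The types of the channel at which the two processes communicate are equal. -/
theorem Linked.inv (hS : S.WellFormed) (h : Linked S c C d A Q P q q' Δ Δ') :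
    ∃ Δ₀ Δ₀' q₀ q₀' r r' C₀ A₀ A₀', TypedSD S Δ₀ q₀ Q c C₀ ∧ TypedSD S Δ₀' q₀' P d A₀' ∧
      CtxEq S Δ₀ Δ ∧ CtxEq S Δ₀' Δ' ∧ TyEq S C₀ C ∧ Δ₀ d = some A₀ ∧ TyEq S A₀ A₀' ∧
      TyEq S A₀' A ∧ Δ₀ c = none ∧ Δ₀' d = none ∧ q = q₀ + r ∧ q' = q₀' + r' := by
  obtain ⟨Δ₀, q₀, C₀, r, h₁, h₂, h₃, h₄⟩ := h.client.inv hS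
  obtain ⟨Δ₀', q₀', A₀', r', h₁', h₂', h₃', h₄'⟩ := h.server.inv hS
  obtain ⟨A₀, h₅, h₆⟩ := h₂.some_right h.link
  exact ⟨Δ₀, Δ₀', q₀, q₀', r, r', C₀, A₀, A₀', h₁, h₁', h₂, h₂', h₃, h₅, h₆.trans h₃'.symm, h₃',
    (h₂.none_iff c).2 h.client.ctx_self, (h₂'.none_iff d).2 h.server.ctx_self, h₄, h₄'⟩

/-- The continuation of a step in which only the type of the common channel changes. -/
theorem Linked.next (h : Linked S c C d A Q P q q' Δ Δ') {Δ₀ Δ₀' : Ctx} {q₁ q₁' : ℚ≥0}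
    {A₁ A₁' C₀ : Ty} {Q' P' : Proc} (hS : S.WellFormed) (hc : CtxEq S Δ₀ Δ)
    (hc' : CtxEq S Δ₀' Δ') (hC : TyEq S C₀ C) (hQ : Typed S (Δ₀.set d A₁) q₁ Q' c C₀)
    (hP : Typed S Δ₀' q₁' P' d A₁') (hA : TyEq S A₁ A₁') (hq : q₁ + q₁' = q + q') :
    ∃ A₁ q₁ q₁' Δ₁ Δ₁', Linked S c C d A₁ Q' P' q₁ q₁' Δ₁ Δ₁' ∧
        (∀ x, x ≠ c → x ≠ d → (Δ₁ x).or (Δ₁' x) = (Δ x).or (Δ' x)) ∧ q₁ + q₁' = q + q' := by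
  refine ⟨A₁', q₁, q₁', Δ.set d A₁', Δ', ⟨hQ.conv (hc.set d hA) hC,
    hP.conv hc' (hS.tyEq_refl _), by simp [Ctx.set], h.provided, fun x => ?_⟩, fun x _ hx => ?_, hq⟩
  · by_cases hx : x = d
    · subst hx; exact .inr h.server.ctx_self
    · simpa [Ctx.set, hx] using h.disj x
  · simp [Ctx.set, hx]

end

/-! ### Weighted sums that are concentrated at one point -/

section Concentrated

variable {S : Sig} {ι : Type} [Fintype ι] {p : FinDist ι} {k : ι}

theorem FinDist.sum_concentrated (h₁ : p.w k = 1) (h₀ : ∀ l, l ≠ k → p.w l = 0) (f : ι → ℚ≥0) :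
    ∑ l, p.w l * f l = f k := by
  rw [Finset.sum_eq_single k (fun l _ hl => by rw [h₀ l hl, zero_mul]) (by simp), h₁, one_mul]

theorem FinDist.ext_w {p' : FinDist ι} (h : ∀ i, p.w i = p'.w i) : p = p' := by
  cases p; cases p'; congr; exact funext h

/-- A sender must give its label probability one, so the receiver's average reduces to the chosen
branch. This lets the receiver continue at the type and context originally promised. -/
theorem WSumR.of_concentrated {As : ι → Ty} {A : Ty} (h : WSumR S p As A) (h₁ : p.w k = 1)
    (h₀ : ∀ l, l ≠ k → p.w l = 0) : TyEq S (As k) A := by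
  cases h with
  | pichoice r rs B h h' h'' =>
    have : r = rs k := FinDist.ext_w fun l => by rw [h'' l, FinDist.sum_concentrated h₁ h₀]
    exact (h' k).trans (this ▸ h.symm)
  | same h => exact h k

theorem WSumL.of_concentrated {As : ι → Ty} {A : Ty} (h : WSumL S p As A) (h₁ : p.w k = 1)
    (h₀ : ∀ l, l ≠ k → p.w l = 0) : TyEq S (As k) A := by
  cases h with
  | pechoice r rs B h h' h'' =>
    have : r = rs k := FinDist.ext_w fun l => by rw [h'' l, FinDist.sum_concentrated h₁ h₀]
    exact (h' k).trans (this ▸ h.symm)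
  | same h => exact h k

theorem CtxSum.of_concentrated {Δs : ι → Ctx} {Δ : Ctx} (h : CtxSum S p Δs Δ) (h₁ : p.w k = 1)
    (h₀ : ∀ l, l ≠ k → p.w l = 0) : CtxEq S (Δs k) Δ := by
  intro x
  rcases h x with ⟨h, h'⟩ | ⟨A, As, h, h', h''⟩
  · rw [h, h' k]; exact .none
  · rw [h, h' k]; exact .some (h''.of_concentrated h₁ h₀)

end Concentrated

theorem Ctx.set_erase (Δ : Ctx) (x : Chan) (A : Ty) : (Δ.erase x).set x A = Δ.set x A := by
  funext y
  by_cases h : y = x <;> simp [Ctx.set, Ctx.erase, h]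

/-! ### Communication between two processes -/

section

variable {S : Sig} {c d e : Chan} {C A : Ty} {Q P : Proc} {q q' : ℚ≥0} {Δ Δ' : Ctx}
  {υ : Chan → St} {r wc wd : ℚ≥0}

theorem CT.ichoice_step (hS : S.WellFormed) (hfin : {x | υ x ≠ .absent}.Finite) {k : Label}
    {L : Finset Label} {Q : {ℓ // ℓ ∈ L} → Proc} (hk : k ∈ L)
    (h : CT S υ r [.proc c wc (.caseL (.chan d) L Q), .proc d wd (.sendL (.chan d) k P)]) :
    CT S υ r [.proc c wc (Q ⟨k, hk⟩), .proc d wd P] := by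
  refine h.pair_step hS hfin (.ichoice hk) fun C A q q' Δ Δ' hl hf hf' => ?_
  obtain ⟨Δ₀, Δ₀', q₀, q₀', r, r', C₀, A₀, A₀', hQ, hP, hΔ, hΔ', hC, h₁, h₂, h₃, h₄, h₅, rfl, rfl⟩ :=
    hl.inv hS
  cases hQ with
  | echoiceR => exact absurd rfl hl.ne
  | ichoiceL h₆ h₇ h₈ =>
    cases hP with
    | echoiceL hk h₉ => rw [h₅] at h₉; cases h₉
    | ichoiceR hk h₉ =>
      rw [h₁, Option.some.injEq] at h₇
      subst h₇
      cases h₂.head with | ichoice g => ?_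
      exact hl.next hS hΔ hΔ' hC ((h₈ ⟨k, hk⟩).weak r rfl) (h₉.weak r' rfl) (g _) rfl

theorem CT.echoice_step (hS : S.WellFormed) (hfin : {x | υ x ≠ .absent}.Finite) {k : Label}
    {L : Finset Label} {P : {ℓ // ℓ ∈ L} → Proc} (hk : k ∈ L)
    (h : CT S υ r [.proc c wc (.sendL (.chan d) k Q), .proc d wd (.caseL (.chan d) L P)]) :
    CT S υ r [.proc c wc Q, .proc d wd (P ⟨k, hk⟩)] := by
  refine h.pair_step hS hfin (.echoice hk) fun C A q q' Δ Δ' hl hf hf' => ?_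
  obtain ⟨Δ₀, Δ₀', q₀, q₀', r, r', C₀, A₀, A₀', hQ, hP, hΔ, hΔ', hC, h₁, h₂, h₃, h₄, h₅, rfl, rfl⟩ :=
    hl.inv hS
  cases hQ with
  | ichoiceR => exact absurd rfl hl.ne
  | echoiceL hk' h₇ h₈ =>
    cases hP with
    | ichoiceL _ h₉ => rw [h₅] at h₉; cases h₉
    | echoiceR _ h₉ =>
      rw [h₁, Option.some.injEq] at h₇
      subst h₇
      cases h₂.head with | echoice h₂ => ?_
      exact hl.next hS hΔ hΔ' hC (h₈.weak r rfl) ((h₉ ⟨k, hk⟩).weak r' rfl) (h₂ _) rfl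

theorem CT.payPot_step (hS : S.WellFormed) (hfin : {x | υ x ≠ .absent}.Finite) {s : ℚ≥0}
    (h : CT S υ r [.proc c wc (.get (.chan d) s Q), .proc d wd (.pay (.chan d) s P)]) :
    CT S υ r [.proc c wc Q, .proc d wd P] := by
  refine h.pair_step hS hfin .payPot fun C A q q' Δ Δ' hl hf hf' => ?_
  obtain ⟨Δ₀, Δ₀', q₀, q₀', r, r', C₀, A₀, A₀', hQ, hP, hΔ, hΔ', hC, h₁, h₂, h₃, h₄, h₅, rfl, rfl⟩ :=
    hl.inv hS
  cases hQ with
  | getR => exact absurd rfl hl.ne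
  | payL h₇ h₈ =>
    cases hP with
    | getL h₉ => rw [h₅] at h₉; cases h₉
    | payR h₉ h₁₀ =>
      rw [h₁, Option.some.injEq] at h₇
      subst h₇
      cases h₂.head with | payPot h₂ => ?_
      exact hl.next hS hΔ hΔ' hC (h₈.weak r rfl) (h₉.weak r' rfl) h₂ (by rw [h₁₀]; ring)

theorem CT.getPot_step (hS : S.WellFormed) (hfin : {x | υ x ≠ .absent}.Finite) {s : ℚ≥0}
    (h : CT S υ r [.proc c wc (.pay (.chan d) s Q), .proc d wd (.get (.chan d) s P)]) :
    CT S υ r [.proc c wc Q, .proc d wd P] := by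
  refine h.pair_step hS hfin .getPot fun C A q q' Δ Δ' hl hf hf' => ?_
  obtain ⟨Δ₀, Δ₀', q₀, q₀', r, r', C₀, A₀, A₀', hQ, hP, hΔ, hΔ', hC, h₁, h₂, h₃, h₄, h₅, rfl, rfl⟩ :=
    hl.inv hS
  cases hQ with
  | payR => exact absurd rfl hl.ne
  | getL h₇ h₈ h₁₀ =>
    cases hP with
    | payL h₉ => rw [h₅] at h₉; cases h₉
    | getR h₉ =>
      rw [h₁, Option.some.injEq] at h₇
      subst h₇
      cases h₂.head with | getPot h₂ => ?_
      exact hl.next hS hΔ hΔ' hC (h₈.weak r rfl) (h₉.weak r' rfl) h₂ (by rw [h₁₀]; ring)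

theorem CT.pichoice_step (hS : S.WellFormed) (hfin : {x | υ x ≠ .absent}.Finite) {k : Label}
    {L : Finset Label} {Q : {ℓ // ℓ ∈ L} → Proc} (hk : k ∈ L)
    (h : CT S υ r [.proc c wc (.pcase (.chan d) L Q), .proc d wd (.psend (.chan d) k P)]) :
    CT S υ r [.proc c wc (Q ⟨k, hk⟩), .proc d wd P] := by
  refine h.pair_step hS hfin (.pichoice hk) fun C A q q' Δ Δ' hl hf hf' => ?_
  obtain ⟨Δ₀, Δ₀', q₀, q₀', r, r', C₀, A₀, A₀', hQ, hP, hΔ, hΔ', hC, h₁, h₂, h₃, h₄, h₅, rfl, rfl⟩ :=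
    hl.inv hS
  cases hQ with
  | pechoiceR => exact absurd rfl hl.ne
  | pichoiceL h₇ h₈ h₉ h₁₀ h₁₁ =>
    cases hP with
    | pechoiceL _ _ _ h₉ => rw [h₅] at h₉; cases h₉
    | pichoiceR hk h₁₂ h₁₃ h₁₄ =>
      rw [h₁, Option.some.injEq] at h₇
      subst h₇
      cases h₂.head with | pichoice g => ?_
      rw [FinDist.sum_concentrated h₁₂ h₁₃] at h₉
      subst h₉
      refine hl.next hS hΔ hΔ' hC (((h₈ ⟨k, hk⟩).conv ?_ (h₁₁.of_concentrated h₁₂ h₁₃)).weak r rfl)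
        (h₁₄.weak r' rfl) (g _) rfl
      rw [← Ctx.set_erase Δ₀]
      exact (h₁₀.of_concentrated h₁₂ h₁₃).set d (hS.tyEq_refl _)

theorem CT.pechoice_step (hS : S.WellFormed) (hfin : {x | υ x ≠ .absent}.Finite) {k : Label}
    {L : Finset Label} {P : {ℓ // ℓ ∈ L} → Proc} (hk : k ∈ L)
    (h : CT S υ r [.proc c wc (.psend (.chan d) k Q), .proc d wd (.pcase (.chan d) L P)]) :
    CT S υ r [.proc c wc Q, .proc d wd (P ⟨k, hk⟩)] := by
  refine h.pair_step hS hfin (.pechoice hk) fun C A q q' Δ Δ' hl hf hf' => ?_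
  obtain ⟨Δ₀, Δ₀', q₀, q₀', r, r', C₀, A₀, A₀', hQ, hP, hΔ, hΔ', hC, h₁, h₂, h₃, h₄, h₅, rfl, rfl⟩ :=
    hl.inv hS
  cases hQ with
  | pichoiceR => exact absurd rfl hl.ne
  | pechoiceL hk' h₆ h₇ h₈ h₁₀ =>
    cases hP with
    | pichoiceL h₉ => rw [h₅] at h₉; cases h₉
    | pechoiceR h₁₁ h₁₂ h₁₃ =>
      rw [h₁, Option.some.injEq] at h₈
      subst h₈
      cases h₂.head with | pechoice h₂ => ?_
      rw [FinDist.sum_concentrated h₆ h₇] at h₁₂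
      subst h₁₂
      exact hl.next hS hΔ hΔ' hC (h₁₀.weak r rfl)
        (((h₁₁ ⟨k, hk⟩).conv (h₁₃.of_concentrated h₆ h₇) (hS.tyEq_refl _)).weak r' rfl) (h₂ _) rfl

theorem CT.one_step (hS : S.WellFormed)
    (h : CT S υ r [.proc c wc (.wait (.chan d) Q), .proc d wd (.close (.chan d))]) :
    CT S υ r [.proc c (wc + wd) Q] := by
  refine h.merge_step hS .one fun C A q q' Δ Δ' hl => ?_
  obtain ⟨Δ₀, Δ₀', q₀, q₀', r, r', C₀, A₀, A₀', hQ, hP, hΔ, hΔ', hC, h₁, h₂, h₃, h₄, h₅, rfl, rfl⟩ :=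
    hl.inv hS
  cases hP
  have hn : ∀ x, Δ' x = none := fun x => (hΔ'.none_iff x).1 rfl
  cases hQ with | oneL h₆ h₇ h₈ => ?_
  refine ⟨Δ.erase d, ((h₈.conv (hΔ.erase d) hC).weak (r + (0 + r')) (by ring)), by simp [Ctx.erase],
    fun x _ hx => by simp [Ctx.erase, hx, hn]⟩

/-- The client's channel `d` is renamed to the forwarded channel `e`. Disjointness of the two
contexts makes `e` new for the client. -/
theorem CT.id_step (hS : S.WellFormed) {κ : CommSort} (hQ : Blocked d κ Q)
    (h : CT S υ r [.proc c wc Q, .proc d wd (.fwd (.chan d) (.chan e))]) :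
    CT S υ r [.proc c (wc + wd) (Q.replace d e)] := by
  refine h.merge_step hS (.id hQ) fun C A q q' Δ Δ' hl => ?_
  obtain ⟨Δ₀, Δ₀', q₀, q₀', r, r', C₀, A₀, A₀', -, hP, hΔ, hΔ', hC, h₁, h₂, h₃, h₄, h₅, rfl, rfl⟩ :=
    hl.inv hS
  cases hP with | id hde => ?_
  obtain ⟨A₁, h₆, h₇⟩ := hΔ'.some_left (x := e) (A := A₀') (by simp [Ctx.single])
  have he : Δ e = none := (hl.disj e).resolve_right (by simp [h₆])
  have hec : e ≠ c := by rintro rfl; simp [hl.provided] at h₆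
  have hn : ∀ x, x ≠ e → Δ' x = none := fun x hx =>
    (hΔ'.none_iff x).1 (by simp [Ctx.single, hx])
  refine ⟨(Δ.erase d).set e A₁, ((hl.client.replace hl.link he hec).conv
    ((CtxEq.refl hS _).set e (h₃.symm.trans h₇)) (hS.tyEq_refl _)).weak (0 + r') rfl,
    by simp [Ctx.set, Ctx.erase, hde], fun x _ hx => ?_⟩
  by_cases hxe : x = e
  · subst hxe
    simp [Ctx.set, he, h₆]
  · simp [Ctx.set, Ctx.erase, hx, hxe, hn]

/-- Ownership of `e` moves from the provider's context to the client's, so the union of the two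
contexts away from `d` is unchanged. `CT.lolli_step` moves it in the other direction. -/
theorem CT.tensor_step (hS : S.WellFormed) (hfin : {x | υ x ≠ .absent}.Finite)
    (h : CT S υ r [.proc c wc (.recvC (.chan d) Q), .proc d wd (.sendC (.chan d) (.chan e) P)]) :
    CT S υ r [.proc c wc (Q.subst e), .proc d wd P] := by
  refine h.pair_step hS hfin .tensor fun C A q q' Δ Δ' hl hf hf' => ?_
  obtain ⟨Δ₀, Δ₀', q₀, q₀', r, r', C₀, A₀, A₀', hQ, hP, hΔ, hΔ', hC, h₁, h₂, h₃, h₄, h₅, rfl, rfl⟩ :=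
    hl.inv hS
  cases hQ with
  | lolliR => exact absurd rfl hl.ne
  | tensorL F h₆ h₇ =>
    cases hP with
    | lolliL _ _ h₉ => rw [h₅] at h₉; cases h₉
    | tensorR hed h₈ h₉ =>
      rw [h₁, Option.some.injEq] at h₆
      subst h₆
      cases h₂.head with | tensor g g' => ?_
      obtain ⟨A₁, h₁₀, h₁₁⟩ := hΔ'.some_left h₈
      have he : Δ e = none := (hl.disj e).resolve_right (by simp [h₁₀])
      have hec : e ≠ c := by rintro rfl; simp [hl.provided] at h₁₀
      -- The client does not own `e` yet, so the body, typed for almost all channels, is typed for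
      -- `e` in particular.
      have h₁₂ := Typed.subst_of_cofinite (e := e) ?_ h₇ hec
        (by simpa [Ctx.set, hed] using (hΔ.none_iff e).2 he)
      · refine ⟨_, _, _, (Δ.set d _).set e A₁, Δ'.erase e, ⟨(h₁₂.conv ((hΔ.set d g').set e
          (g.trans h₁₁)) hC).weak r rfl, (h₉.conv (hΔ'.erase e) (hS.tyEq_refl _)).weak r' rfl,
          by simp [Ctx.set, hed.symm], by simp [Ctx.erase, hl.provided], fun x => ?_⟩,
          fun x hx hx' => ?_, rfl⟩
        · by_cases hxe : x = e
          · exact .inr (by simp [Ctx.erase, hxe])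
          by_cases hxd : x = d
          · exact .inr (by simp [Ctx.erase, hxd, hl.server.ctx_self])
          · simpa [Ctx.set, Ctx.erase, hxe, hxd] using hl.disj x
        · by_cases hxe : x = e
          · subst hxe
            simp [Ctx.set, he, h₁₀]
          · simp [Ctx.set, Ctx.erase, hxe, hx']
      · refine (hf.insert d).subset fun x hx => ?_
        by_cases hxd : x = d
        · exact .inl hxd
        · exact .inr fun hx' => hx (by simpa [Ctx.set, hxd] using (hΔ.none_iff x).2 hx')

theorem CT.lolli_step (hS : S.WellFormed) (hfin : {x | υ x ≠ .absent}.Finite)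
    (h : CT S υ r [.proc c wc (.sendC (.chan d) (.chan e) Q), .proc d wd (.recvC (.chan d) P)]) :
    CT S υ r [.proc c wc Q, .proc d wd (P.subst e)] := by
  refine h.pair_step hS hfin .lolli fun C A q q' Δ Δ' hl hf hf' => ?_
  obtain ⟨Δ₀, Δ₀', q₀, q₀', r, r', C₀, A₀, A₀', hQ, hP, hΔ, hΔ', hC, h₁, h₂, h₃, h₄, h₅, rfl, rfl⟩ :=
    hl.inv hS
  cases hQ with
  | tensorR => exact absurd rfl hl.ne
  | lolliL hde hec h₆ h₇ h₈ =>
    cases hP with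
    | tensorL _ h₉ => rw [h₅] at h₉; cases h₉
    | lolliR F h₉ =>
      rw [h₁, Option.some.injEq] at h₆
      subst h₆
      cases h₂.head with | lolli g g' => ?_
      obtain ⟨A₁, h₁₀, h₁₁⟩ := hΔ.some_left h₇
      have he : Δ' e = none := (hl.disj e).resolve_left (by simp [h₁₀])
      have h₁₂ := Typed.subst_of_cofinite (e := e) ?_ h₉ hde.symm ((hΔ'.none_iff e).2 he)
      · refine ⟨_, _, _, (Δ.erase e).set d _, Δ'.set e A₁, ⟨(h₈.conv ((hΔ.erase e).set d g')
          hC).weak r rfl, (h₁₂.conv (hΔ'.set e (g.symm.trans h₁₁)) (hS.tyEq_refl _)).weak r' rfl,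
          by simp [Ctx.set], by simp [Ctx.set, hl.provided, hec.symm], fun x => ?_⟩,
          fun x hx hx' => ?_, rfl⟩
        · by_cases hxe : x = e
          · exact .inl (by simp [Ctx.erase, Ctx.set, hxe, hde.symm])
          by_cases hxd : x = d
          · exact .inr (by simp [Ctx.set, hxd, hde, hl.server.ctx_self])
          · simpa [Ctx.set, Ctx.erase, hxe, hxd] using hl.disj x
        · by_cases hxe : x = e
          · subst hxe
            simp [Ctx.set, Ctx.erase, h₁₀, hx']
          · simp [Ctx.set, Ctx.erase, hxe, hx']
      · exact hf'.subset fun x hx hx' => hx ((hΔ'.none_iff x).2 hx')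

end

/-! ### Preservation for communication -/

section

variable {S : Sig}

theorem CT.dist_update (hS : S.WellFormed) {υ : Chan → St} {q : ℚ≥0} {c : Chan} {n : ℕ}
    {p : FinDist (Fin n)} {C : Fin n → Config} {i : Fin n} {C' : Config}
    (h : CT S υ q [.dist c n p C])
    (hC : ∀ σ r, CT S σ r (C i) → (∀ x, υ x = .absent → σ x = .absent) → CT S σ r C') :
    CT S υ q [.dist c n p (Function.update C i C')] := by
  obtain ⟨σs, qs, h₁, h₂, h₃, h₄⟩ := h.dist_inv hS
  refine .dist_intro (σs := σs) (qs := qs) (fun j => ?_) h₂ h₃ h₄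
  by_cases hj : j = i
  · subst hj
    rw [Function.update_self]
    refine hC _ _ (h₁ j) fun x hx => ?_
    have := h₂ x
    rw [hx] at this
    exact this.eq_absent j
  · rw [Function.update_of_ne hj]
    exact h₁ j

theorem CStep.client_chan (hS : S.WellFormed) {d : Chan} {κ : CommSort} {O O' : Obj} {R : Config}
    (h : CStep d κ [O, O'] R) (hd : O'.chan = d) (hs : Separated [O, O'])
    {σ τ : Chan → St} {q q' : ℚ≥0} (hO : CT S σ q [O]) (hO' : CT S τ q' [O']) :
    σ d ≠ .absent := by
  rcases deepC_cons.1 (h.deep hs).1 with h₁ | h₁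
  · rcases hO.deep_client hS (deepC_singleton.2 h₁) with h | ⟨A, h, h'⟩ <;> simp [h]
  · obtain ⟨B, hB⟩ := (hO'.sole hS d).2 hd.symm
    rcases hO'.deep_client hS h₁ with h | ⟨A, h, h'⟩ <;> simp [hB] at h

/-- Decomposition rules are handled by typing the decomposed configuration and then applying the
induction hypothesis. Finiteness of the non-absent channels is carried along for the substitutions
in channel communication. -/
theorem CStep.preserves (hS : S.WellFormed) {d : Chan} {κ : CommSort} {C C' : Config}
    (h : CStep d κ C C') : ∀ {σ : Chan → St} {q : ℚ≥0}, {x | σ x ≠ .absent}.Finite →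
      CT S σ q C → CT S σ q C' := by
  induction h with
  | ichoice hk => exact fun hf h => h.ichoice_step hS hf hk
  | echoice hk => exact fun hf h => h.echoice_step hS hf hk
  | tensor => exact fun hf h => h.tensor_step hS hf
  | lolli => exact fun hf h => h.lolli_step hS hf
  | one => exact fun hf h => h.one_step hS
  | id hQ => exact fun hf h => h.id_step hS hQ
  | payPot => exact fun hf h => h.payPot_step hS hf
  | getPot => exact fun hf h => h.getPot_step hS hf
  | pichoice hk => exact fun hf h => h.pichoice_step hS hf hk
  | pechoice hk => exact fun hf h => h.pechoice_step hS hf hk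
  | @dist κ c n p C i C' hstep ih =>
    exact fun hf h => h.dist_update hS fun σ r h' hσ => ih (hf.subset fun x hx hx' => hx (hσ x hx')) h'
  | @sdistR κ c w Q n p C C' hstep ih =>
    intro υ r hf h
    refine ih hf ?_
    obtain ⟨σ, τ, q, q', h₁, h₂, hc, rfl⟩ := h.of_cons
    have hstep' := CStep.sdistR hstep
    obtain ⟨⟨A, hd, hd', hA⟩, -⟩ := hstep'.link hS rfl h₁ h₂ hc
    refine h₁.push_client hS h₂ hc hd hd' fun As hAs => ?_
    by_cases hκ : κ = .pint
    · subst hκ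
      -- For `pint` the provider's branches may disagree on the probabilities of `d`. The copied
      -- client is then a receiver on `d`, so its derivation can be split.
      have := (hstep'.deep h.separated).1
      rcases deepC_cons.1 this with h₃ | h₃
      · cases (deep_proc.1 h₃).2
        exact h₁.splitsClient_pcase hS hd hAs
      · rcases h₂.deep_client hS h₃ with h | ⟨A, h, h'⟩ <;> simp [hd'] at h
    · exact h₁.splitsClient hS hd fun i => hAs.tyEq (hA ▸ hκ) i
  | @sdistL κ c w P n p C C' hstep ih =>
    intro υ r hf h
    refine ih hf ?_
    obtain ⟨σ, τ, q, q', h₁, h₂, hc, rfl⟩ := h.of_cons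
    obtain ⟨⟨A, hd, hd', hA⟩, hP⟩ := (CStep.sdistL hstep).link hS rfl h₁ h₂ hc
    refine h₁.push_server hS h₂ hc rfl hd hd' fun As hAs => ?_
    -- Dually, only for `pext` may the client's branches disagree; then the provider receives or
    -- forwards.
    by_cases hκ : κ = .pext
    · exact h₂.splitsServer_proc hS ((deep_proc.1 hP).2 hκ) hd' hAs
    · exact h₂.splitsServer hS hd' fun i => hAs.tyEq (hA ▸ hκ) i
  | bdistD hstep ih =>
    intro υ r hf h
    refine ih hf ?_
    obtain ⟨σ, τ, q, q', h₁, h₂, hc, rfl⟩ := h.of_cons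
    obtain ⟨⟨A, hd, hd', hA⟩, -⟩ := (CStep.bdistD hstep).link hS rfl h₁ h₂ hc
    exact h₁.push_prod hS h₂ hc hd hd' hA
  | bdistR hstep ih =>
    intro υ r hf h
    refine ih hf ?_
    obtain ⟨σ, τ, q, q', h₁, h₂, hc, rfl⟩ := h.of_cons
    obtain ⟨⟨A, hd, hd', hA⟩, -⟩ := (CStep.bdistR hstep).link hS rfl h₁ h₂ hc
    exact h₁.push_client hS h₂ hc hd hd' fun As hAs =>
      h₁.splitsClient hS hd fun i => hAs.tyEq (by simp [hA]) i
  | bdistL hstep ih =>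
    intro υ r hf h
    refine ih hf ?_
    obtain ⟨σ, τ, q, q', h₁, h₂, hc, rfl⟩ := h.of_cons
    obtain ⟨⟨A, hd, hd', hA⟩, -⟩ := (CStep.bdistL hstep).link hS rfl h₁ h₂ hc
    exact h₁.push_server hS h₂ hc rfl hd hd' fun As hAs =>
      h₂.splitsServer hS hd' fun i => hAs.tyEq (by simp [hA]) i
  | frame₁ hstep ih =>
    exact fun hf h => h.frame hS fun σ r h' hσ => ih (hf.subset fun x hx hx' => hx (hσ x hx')) h'
  | @frame₂ κ O O' R C₁ C₂ C₃ hd hstep ih =>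
    intro υ q hf h
    have hs := h.separated
    have h₁ := (separated_append.1 hs).1
    have h₂ := separated_cons.1 (separated_append.1 hs).2.1
    have h₃ := separated_cons.1 (separated_append.1 h₁).2.1
    have hs' : Separated [O, O'] := separated_cons.2 ⟨h₃.1, h₂.1, fun b hb hb' =>
      (separated_append.1 hs).2.2 b (provides_of_mem (O := O) (by simp) hb)
        (provides_cons.2 (.inl hb'))⟩
    obtain ⟨-, τ, -, q₂, -, hC, -⟩ := h.of_append hS
    obtain ⟨τ, -, q₃, -, hO', -⟩ := hC.of_cons
    exact h.frame_pair hS (fun σ r hO => hd ▸ hstep.client_chan hS hd hs' hO hO')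
      fun σ r h' hσ => ih (hf.subset fun x hx hx' => hx (hσ x hx')) h'

end

/-! ### Preservation for single-object steps -/

section

variable {S : Sig} {U : Set Chan} {σ : Chan → St} {q : ℚ≥0} {C C' : Config}

open Classical in
/-- The states `σ`, with the channels in `N` reserved. -/
noncomputable def reserve (N : Set Chan) (σ : Chan → St) (x : Chan) : St :=
  if x ∈ N then .inner else σ x

theorem reserve_empty (σ : Chan → St) : reserve ∅ σ = σ := by
  funext x; simp [reserve]

theorem SComp.reserve {N : Set Chan} {σ τ υ : Chan → St} {x : Chan} (h : SComp (σ x) (τ x) (υ x))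
    (hN : x ∈ N → υ x = .absent) : SComp (reserve N σ x) (τ x) (reserve N υ x) := by
  unfold PRast.reserve
  split
  · rw [hN ‹_›] at h
    generalize σ x = s, τ x = t at h
    cases h <;> exact .left _
  · exact h

theorem SComp.reserve_right {N : Set Chan} {σ τ υ : Chan → St} {x : Chan}
    (h : SComp (σ x) (τ x) (υ x)) (hN : x ∈ N → υ x = .absent) :
    SComp (σ x) (PRast.reserve N τ x) (PRast.reserve N υ x) := by
  unfold PRast.reserve
  split
  · rw [hN ‹_›] at h
    generalize σ x = s, τ x = t at h
    cases h <;> exact .right _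
  · exact h

theorem SComp.eq_absent {s t : St} (h : SComp s t .absent) : s = .absent ∧ t = .absent := by
  cases h <;> exact ⟨rfl, rfl⟩

theorem Sole.reserve {c : Chan} {N : Set Chan} (h : Sole c σ) (hN : ∀ x ∈ N, σ x = .absent) :
    Sole c (PRast.reserve N σ) := by
  intro x
  rw [← h x]
  unfold PRast.reserve
  split
  · simp [hN x ‹_›]
  · rfl

/-- A channel spawned in branch `i` stays absent in the other branches; both states are idle, so the
whole object may regard it as internal. -/
theorem DSum.reserve {ι : Type} [Fintype ι] [DecidableEq ι] {p : FinDist ι} {σs : ι → Chan → St}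
    {N : Set Chan} {x : Chan} (i : ι) (h : DSum S p (fun i => σs i x) (σ x))
    (hN : x ∈ N → σ x = .absent) :
    DSum S p (fun j => Function.update σs i (PRast.reserve N (σs i)) j x)
      (PRast.reserve N σ x) := by
  by_cases hx : x ∈ N
  · have h₁ : PRast.reserve N σ x = .inner := if_pos hx
    rw [h₁]
    rw [hN hx] at h
    refine .inner fun j => ?_
    by_cases hj : j = i
    · subst hj; exact .inr (by simp [PRast.reserve, hx])
    · exact .inl (by simpa [hj] using h.eq_absent j)
  · have h₁ : PRast.reserve N σ x = σ x := if_neg hx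
    rw [h₁]
    convert h using 2 with j
    by_cases hj : j = i
    · subst hj; simp [PRast.reserve, hx]
    · simp [hj]

theorem CT.work_step (hS : S.WellFormed) {c : Chan} {w r : ℚ≥0} {P : Proc}
    (h : CT S σ q [.proc c w (.work r P)]) : CT S σ q [.proc c (w + r) P] := by
  obtain ⟨Δ, q₁, A, ht, hp, rfl⟩ := h.proc_inv hS
  obtain ⟨Δ', q₂, A', r', ht', hΔ, hA, rfl⟩ := ht.inv hS
  cases ht' with | work ht' hq => ?_
  rw [hq]
  have := CT.proc_intro (w := w + r) ((ht'.conv hΔ hA).weak r' rfl) hp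
  convert this using 1
  ring

theorem CT.flip_step (hS : S.WellFormed) {c : Chan} {w p : ℚ≥0} {hp : p ≤ 1} {PH PT : Proc}
    (h : CT S σ q [.proc c w (.flip p hp PH PT)]) :
    CT S σ q [.dist c 2 (FinDist.coin p hp) ![[.proc c w PH], [.proc c w PT]]] := by
  obtain ⟨Δ, q₁, A, ht, hσ, rfl⟩ := h.proc_inv hS
  obtain ⟨Δ', q₂, A', r', ht', hΔ, hA, rfl⟩ := ht.inv hS
  cases ht' with | @flip _ _ _ _ _ _ _ _ Δs qs As h₁ h₂ h₃ h₄ h₅ => ?_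
  have h₆ : ∀ i, CT S (procSt c (As i) (Δs i) σ) (qs i + (r' + w))
      (![[Obj.proc c w PH], [Obj.proc c w PT]] i) := by
    intro i
    rw [← add_assoc]
    fin_cases i
    · exact .proc_intro (h₄.weak r' rfl) fun x => procSt_spec _ _ _ _ _
    · exact .proc_intro (h₅.weak r' rfl) fun x => procSt_spec _ _ _ _ _
  refine .dist_intro h₆ (fun x => procSt_dsum (hσ x) (h₂.conv hA) (h₁.conv hΔ x))
    (ProcSt.sole hσ) ?_
  rw [FinDist.sum_add_const, Fin.sum_univ_two, h₃, add_assoc]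
  rfl

theorem CT.spawn_step (hS : S.WellFormed) (hfin : {x | σ x ≠ .absent}.Finite)
    {c b : Chan} {w : ℚ≥0} {f : PName} {Q : Proc} {D : PDef} {ds : List Chan}
    (hD : S.pdef f = some D) (hl : ds.length = D.args.length) (hb : σ b = .absent)
    (h : CT S σ q [.proc c w (.spawn f (ds.map Name.chan) Q)]) :
    CT S (reserve {b} σ) q
      [.proc c w (Q.subst b), .proc b 0 (D.body.rename (D.ren b ds))] := by
  obtain ⟨Δ, q₁, A, ht, hσ, rfl⟩ := h.proc_inv hS
  obtain ⟨Δ', q₂, A', r', ht', hΔ, hA, rfl⟩ := ht.inv hS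
  obtain ⟨hbc, hbΔ⟩ : b ≠ c ∧ Δ b = none := by
    have := hσ b
    rw [hb] at this
    cases this with | absent h₁ h₂ => exact ⟨h₁, h₂⟩
  have hfin' : {x | Δ' x ≠ none}.Finite := by
    refine hfin.subset fun x hx hx' => hx ((hΔ.none_iff x).2 ?_)
    have := hσ x
    rw [hx'] at this
    cases this with | absent h₁ h₂ => exact h₂
  generalize hys : ds.map Name.chan = ys' at ht'
  cases ht' with | @spawn Δ Δ₀ q r z C f Q D' ys F h₁ h₂ h₃ h₄ h₅ h₆ h₇ h₈ => ?_
  obtain rfl : ds = ys := List.map_injective_iff.2 (fun _ _ h => by simpa using h) hys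
  obtain rfl : D = D' := by simpa [hD] using h₁
  subst h₇
  have hbΔ' := (hΔ.none_iff b).2 hbΔ
  rw [h₆, Ctx.join, Option.or_eq_none_iff] at hbΔ'
  have hbd : b ∉ ds := by
    have := hbΔ'.2
    rw [Ctx.ofList_eq_none_iff, List.map_fst_zip (by simp [hl])] at this
    exact this
  have h₉ : Typed S (Δ₀.set b D.ty) q (Q.subst b) c A' := by
    refine Typed.subst_of_cofinite (hfin'.subset fun x hx hx' => hx ?_) h₈ hbc hbΔ'.1
    rw [h₆, Ctx.join, Option.or_eq_none_iff] at hx'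
    exact hx'.1
  have hlink : Linked S c A' b D.ty (Q.subst b) (D.body.rename (D.ren b ds)) (q + r') D.pot
      (Δ₀.set b D.ty) (Ctx.ofList (ds.zip (D.args.map Prod.snd))) := by
    refine ⟨h₉.weak r' rfl, hS.typed_body hD hl h₃ hbd, by simp [Ctx.set],
      Ctx.ofList_zip_eq_none h₄, fun x => ?_⟩
    by_cases hx : x = b
    · exact .inr (hx ▸ hbΔ'.2)
    · simpa [Ctx.set, hx] using h₅ x
  -- The new channel is an internal link, and all other channels keep the states of the spawning
  -- process.
  have h₁₀ := hlink.toCT hS (υ := fun x => if x = b then .inner else procSt c A' Δ' σ x)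
    (fun x => ?_) w 0
  · have h₁₁ := h₁₀.mono hS (σ' := reserve {b} σ) fun x => ?_
    · convert h₁₁ using 1
      ring
    · simp only [reserve, Set.mem_singleton_iff]
      split
      · exact .inner
      · have h₁ := hσ x
        have h₂ := hΔ x
        unfold procSt
        generalize σ x = s, Δ' x = o' at *
        cases h₁ with
        | prov h => simpa [h] using .prov hA
        | used h h' => rw [h'] at h₂; cases h₂ with | some h₂ => simpa [h] using .used h₂
        | inner h h' => rw [h'] at h₂; cases h₂; simpa [h] using .inner
        | absent h h' => rw [h'] at h₂; cases h₂; simpa [h] using .absent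
  · by_cases hxc : x = c
    · simpa [hxc, hbc.symm, procSt] using PairSt.prov rfl
    by_cases hxb : x = b
    · simpa [hxb] using PairSt.link hbc rfl
    have h₁₁ : ((Δ₀.set b D.ty) x).or (Ctx.ofList (ds.zip (D.args.map Prod.snd)) x) = Δ' x := by
      rw [h₆]; simp [Ctx.set, hxb, Ctx.join]
    rw [h₁₁]
    simp only [hxb, if_false, procSt, hxc]
    cases h : Δ' x with
    | some B => exact .used hxc hxb rfl
    | none =>
      refine .idle hxc hxb rfl ?_
      cases σ x <;> simp [St.Idle]

/-- `N` holds the spawned channel, or is empty. Since it avoids `U` and every channel outside `U` is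
absent, reserving it conflicts with no state in the surrounding objects or branches. -/
theorem EStep.preserves (hS : S.WellFormed) (h : EStep S U C C') :
    ∀ {σ : Chan → St} {q : ℚ≥0}, {x | σ x ≠ .absent}.Finite → (∀ x ∉ U, σ x = .absent) →
      CT S σ q C → ∃ N : Set Chan, Disjoint N U ∧ CT S (reserve N σ) q C' := by
  induction h with
  | @spawn c w f Q b D ds hD hl hb =>
    exact fun hf hU h => ⟨{b}, by simpa using hb, h.spawn_step hS hf hD hl (hU b hb)⟩
  | work => exact fun hf hU h => ⟨∅, by simp, by rw [reserve_empty]; exact h.work_step hS⟩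
  | flip => exact fun hf hU h => ⟨∅, by simp, by rw [reserve_empty]; exact h.flip_step hS⟩
  | @dist c n p C i C' hstep ih =>
    intro σ q hf hU h
    obtain ⟨σs, qs, h₁, h₂, h₃, h₄⟩ := h.dist_inv hS
    have h₅ : ∀ x, σ x = .absent → σs i x = .absent := by
      intro x hx
      have := h₂ x
      rw [hx] at this
      exact this.eq_absent i
    obtain ⟨N, hN, hC⟩ := ih (hf.subset fun x hx hx' => hx (h₅ x hx'))
      (fun x hx => h₅ x (hU x hx)) (h₁ i)
    have hN' : ∀ x ∈ N, σ x = .absent := fun x hx => hU x (Set.disjoint_left.1 hN hx)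
    refine ⟨N, hN, .dist_intro (σs := Function.update σs i (reserve N (σs i))) (qs := qs)
      (fun j => ?_) (fun x => (h₂ x).reserve i (hN' x)) (h₃.reserve hN') h₄⟩
    by_cases hj : j = i
    · subst hj; simpa using hC
    · simpa [hj] using h₁ j
  | @frame O R C₁ C₂ hstep ih =>
    intro σ q hf hU h
    obtain ⟨a, y, r₁, r₂, h₁, h₂, h₃, rfl⟩ := h.of_append hS
    obtain ⟨o, c, r₃, r₄, h₄, h₅, h₆, rfl⟩ := h₂.of_cons
    have h₇ : ∀ x, σ x = .absent → y x = .absent ∧ o x = .absent := by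
      intro x hx
      have h₃ := h₃ x
      rw [hx] at h₃
      have hy := h₃.eq_absent.2
      have h₆ := h₆ x
      rw [hy] at h₆
      exact ⟨hy, h₆.eq_absent.1⟩
    obtain ⟨N, hN, hR⟩ := ih (hf.subset fun x hx hx' => hx (h₇ x hx').2)
      (fun x hx => (h₇ x (hU x hx)).2) h₄
    have hN' : ∀ x ∈ N, σ x = .absent := fun x hx => hU x (Set.disjoint_left.1 hN hx)
    refine ⟨N, hN, ?_⟩
    rw [List.append_assoc]
    exact h₁.append hS (hR.append hS h₅ fun x => (h₆ x).reserve fun hx => (h₇ x (hN' x hx)).1)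
      fun x => (h₃ x).reserve_right (hN' x)

end

/-! ### Preservation for steps -/

theorem occurs_cons {b : Chan} {O : Obj} {C : Config} :
    Occurs b (O :: C) ↔ Occurs b [O] ∨ Occurs b C := by
  constructor
  · intro h
    cases h with
    | head h => exact .inl (.head h)
    | body h => exact .inl (.body h)
    | inner i h => exact .inl (.inner i h)
    | tail h => exact .inr h
  · rintro (h | h)
    · cases h with
      | head h => exact .head h
      | body h => exact .body h
      | inner i h => exact .inner i h
      | tail h => cases h
    · exact .tail h

theorem occurs_nil {b : Chan} : ¬ Occurs b [] := fun h => by cases h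

theorem occurs_proc {b c : Chan} {w : ℚ≥0} {P : Proc} :
    Occurs b [.proc c w P] ↔ b = c ∨ b ∈ P.chans := by
  constructor
  · intro h
    cases h with
    | head h => exact .inl h.symm
    | body h => exact .inr h
    | tail h => cases h
  · rintro (rfl | h)
    · exact .head rfl
    · exact .body h

theorem occurs_dist {b c : Chan} {n : ℕ} {p : FinDist (Fin n)} {C : Fin n → Config} :
    Occurs b [.dist c n p C] ↔ b = c ∨ ∃ i, Occurs b (C i) := by
  constructor
  · intro h
    cases h with
    | head h => exact .inl h.symm
    | inner i h => exact .inr ⟨i, h⟩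
    | tail h => cases h
  · rintro (rfl | ⟨i, h⟩)
    · exact .head rfl
    · exact .inner i h

theorem Provides.occurs {b : Chan} {C : Config} (h : Provides b C) : Occurs b C := by
  induction h with
  | head h => exact .head h
  | inner i _ ih => exact .inner i ih
  | tail _ ih => exact .tail ih

section

variable {S : Sig} {σ : Chan → St} {q : ℚ≥0} {C C' : Config} {Γ : Ctx}

/-- Finiteness supplies both fresh channels for spawning and the finite contexts required by
substitution. -/
theorem CT.finite_occurs (h : CT S σ q C) : {b | Occurs b C}.Finite := by
  induction h with
  | nil => simp [occurs_nil]
  | @proc Δ A c w P R q q₁ q₂ σ τ υ ht hp hR hc hq ih =>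
    refine (((P.finite_chans).insert c).union ih).subset fun b hb => ?_
    rcases occurs_cons.1 hb with hb | hb
    · exact .inl (occurs_proc.1 hb)
    · exact .inr hb
  | @dist n c R q q₂ σ τ υ p C σs qs hC hs hp hR hc hq ihC ihR =>
    refine (((Set.finite_iUnion ihC).insert c).union ihR).subset fun b hb => ?_
    rcases occurs_cons.1 hb with hb | hb
    · exact .inl ((occurs_dist.1 hb).imp_right Set.mem_iUnion.2)
    · exact .inr hb

theorem CTyped.ne_nil {Δ : Ctx} (h : CTyped S Δ q C Γ) : C ≠ [] := by
  cases h <;> simp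

theorem CTyped.exists_provided {Δ : Ctx} (h : CTyped S Δ q C Γ) : ∃ c A, Γ c = some A := by
  cases h with
  | proc _ _ h => exact ⟨_, _, by rw [h]; exact if_pos rfl⟩
  | dist _ _ _ _ h => exact ⟨_, _, by rw [h]; exact if_pos rfl⟩
  | compose _ _ _ _ _ _ _ _ _ h => exact ⟨_, _, by rw [h]; exact if_pos rfl⟩

theorem CT.ne_nil (h : CT S σ q C) {c : Chan} {A : Ty} (hc : σ c = .prov A) : C ≠ [] := by
  rintro rfl
  cases h with | nil h => simpa [hc, St.Idle] using h c

theorem ctxU_mkSt_empty (V : Set Chan) : ctxU (mkSt Ctx.empty Γ V) = Ctx.empty := by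
  funext x
  unfold ctxU mkSt Ctx.empty
  cases Γ x with
  | some A => rfl
  | none => by_cases hx : x ∈ V <;> simp [hx, St.usedTy]

theorem ctxP_mkSt (Δ : Ctx) (V : Set Chan) : ctxP (mkSt Δ Γ V) = Γ := by
  funext x
  unfold ctxP mkSt
  cases Γ x with
  | some A => rfl
  | none =>
    cases Δ x with
    | some A => rfl
    | none => by_cases hx : x ∈ V <;> simp [hx, St.provTy]

theorem mkSt_empty_absent {V : Set Chan} (hV : ∀ x, Γ x ≠ none → x ∈ V) {x : Chan} (hx : x ∉ V) :
    mkSt Ctx.empty Γ V x = .absent := by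
  have : Γ x = none := by_contra fun h => hx (hV x h)
  simp [mkSt, Ctx.empty, this, hx]

theorem ctxU_reserve {N : Set Chan} (h : ∀ x ∈ N, σ x = .absent) :
    ctxU (reserve N σ) = ctxU σ := by
  funext x
  by_cases hx : x ∈ N <;> simp [ctxU, reserve, hx, h, St.usedTy]

theorem ctxP_reserve {N : Set Chan} (h : ∀ x ∈ N, σ x = .absent) :
    ctxP (reserve N σ) = ctxP σ := by
  funext x
  by_cases hx : x ∈ N <;> simp [ctxP, reserve, hx, h, St.provTy]

/-- In a closed configuration a non-absent state belongs to a channel that is provided at some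
depth, so there are finitely many. After the step, the contexts are read back from the states;
reservations of fresh channels do not affect them. -/
theorem Step.preserves (hS : S.WellFormed) (h : Step S C C') (hC : CTyped S Ctx.empty q C Γ) :
    CTyped S Ctx.empty q C' Γ := by
  obtain ⟨c, A, hΓ⟩ := hC.exists_provided
  have hct := hC.toCT hS
  set V := {x | Provides x C}
  have hV : ∀ x, x ∉ V → mkSt Ctx.empty Γ V x = .absent :=
    fun x hx => mkSt_empty_absent hC.provides.1 hx
  have hfin : {x | mkSt Ctx.empty Γ V x ≠ .absent}.Finite :=
    hct.finite_occurs.subset fun x hx => by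
      by_contra h
      exact hx (hV x fun h' => h h'.occurs)
  have hc : mkSt Ctx.empty Γ V c = .prov A := by simp [mkSt, hΓ]
  rcases h with h | ⟨d, κ, h⟩
  · have hU : ∀ x ∉ {b | Occurs b C}, mkSt Ctx.empty Γ V x = .absent :=
      fun x hx => hV x fun h' => hx h'.occurs
    obtain ⟨N, hN, h'⟩ := h.preserves hS hfin hU hct
    have hN' : ∀ x ∈ N, mkSt Ctx.empty Γ V x = .absent :=
      fun x hx => hU x (Set.disjoint_left.1 hN hx)
    have := h'.toCTyped hS (h'.ne_nil (c := c) (A := A) ?_)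
    · rwa [ctxU_reserve hN', ctxP_reserve hN', ctxU_mkSt_empty, ctxP_mkSt] at this
    · rw [reserve, if_neg fun hcN => ?_, hc]
      rw [hN' c hcN] at hc
      cases hc
  · have h' := h.preserves hS hfin hct
    have := h'.toCTyped hS (h'.ne_nil hc)
    rwa [ctxU_mkSt_empty, ctxP_mkSt] at this

theorem IsRun.typed (hS : S.WellFormed) {run : ℕ → Config} (h : IsRun S C run)
    (hC : CTyped S Ctx.empty q C Γ) (n : ℕ) : CTyped S Ctx.empty q (run n) Γ := by
  induction n with
  | zero => rwa [h.zero]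
  | succ n ih =>
    rcases h.succ n with h | ⟨-, h⟩
    · exact h.preserves hS ih
    · rwa [h]

end

/-! ### Progress -/

open Name in
/-- The client expression is ready to communicate along `d`, of a type of shape `s`. -/
inductive ClientReady (d : Chan) : Shape → Proc → Prop
  | wait {Q} : ClientReady d .one (.wait (chan d) Q)
  | caseL {L Q} : ClientReady d (.ichoice L) (.caseL (chan d) L Q)
  | sendL {L k Q} : k ∈ L → ClientReady d (.echoice L) (.sendL (chan d) k Q)
  | pcase {L Q} : ClientReady d (.pichoice L) (.pcase (chan d) L Q)
  | psend {L k Q} : k ∈ L → ClientReady d (.pechoice L) (.psend (chan d) k Q)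
  | get {r Q} : ClientReady d (.payPot r) (.get (chan d) r Q)
  | pay {r Q} : ClientReady d (.getPot r) (.pay (chan d) r Q)
  | recvC {Q} : ClientReady d .tensor (.recvC (chan d) Q)
  | sendC {e Q} : ClientReady d .lolli (.sendC (chan d) (chan e) Q)

open Name in
/-- The expression is ready to communicate along the provided channel `d`, of a type of shape `s`. -/
inductive ServerReady (d : Chan) : Shape → Proc → Prop
  | close : ServerReady d .one (.close (chan d))
  | sendL {L k P} : k ∈ L → ServerReady d (.ichoice L) (.sendL (chan d) k P)
  | caseL {L P} : ServerReady d (.echoice L) (.caseL (chan d) L P)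
  | psend {L k P} : k ∈ L → ServerReady d (.pichoice L) (.psend (chan d) k P)
  | pcase {L P} : ServerReady d (.pechoice L) (.pcase (chan d) L P)
  | pay {r P} : ServerReady d (.payPot r) (.pay (chan d) r P)
  | get {r P} : ServerReady d (.getPot r) (.get (chan d) r P)
  | sendC {e P} : ServerReady d .tensor (.sendC (chan d) (chan e) P)
  | recvC {P} : ServerReady d .lolli (.recvC (chan d) P)
  | fwd {s e} : ServerReady d s (.fwd (chan d) (chan e))

/-- The object provides `d`, of a type of shape `s`, and is ready to communicate along it. -/
inductive ProviderReady (d : Chan) (s : Shape) : Obj → Prop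
  | proc {w P} : ServerReady d s P → ProviderReady d s (.proc d w P)
  | dist {n p} {C : Fin n → Config} {O : Obj} (i : Fin n) : O ∈ C i → ProviderReady d s O →
      ProviderReady d s (.dist d n p C)

section

variable {S : Sig} {U : Set Chan} {d : Chan} {s : Shape} {O O' : Obj} {P Q : Proc}

theorem ProviderReady.chan_eq (h : ProviderReady d s O) : O.chan = d := by
  cases h <;> rfl

theorem ServerReady.poised (h : ServerReady d s P) (w : ℚ≥0) : Poised [.proc d w P] := by
  cases h <;> constructor

/-- A common shape already forces matching constructors, label sets and amounts of potential. A
forwarder answers a client of any shape. -/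
theorem ClientReady.step (hQ : ClientReady d s Q) (hP : ServerReady d s P) (c : Chan)
    (wc wd : ℚ≥0) : ∃ R, CStep d s.sort [.proc c wc Q, .proc d wd P] R := by
  cases hP with
  | fwd => cases hQ <;> exact ⟨_, .id (by constructor)⟩
  | close => cases hQ; exact ⟨_, .one⟩
  | sendL hk => cases hQ; exact ⟨_, .ichoice hk⟩
  | caseL => cases hQ with | sendL hk => exact ⟨_, .echoice hk⟩
  | psend hk => cases hQ; exact ⟨_, .pichoice hk⟩
  | pcase => cases hQ with | psend hk => exact ⟨_, .pechoice hk⟩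
  | pay => cases hQ; exact ⟨_, .payPot⟩
  | get => cases hQ; exact ⟨_, .getPot⟩
  | sendC => cases hQ; exact ⟨_, .tensor⟩
  | recvC => cases hQ; exact ⟨_, .lolli⟩

/-- A ready client and a ready provider communicate. -/
theorem Deep.step (hO : Deep (fun _ Q => ClientReady d s Q) O) :
    ∀ {O'}, ProviderReady d s O' → ∃ R, CStep d s.sort [O, O'] R := by
  induction hO with
  | @proc c w Q hQ =>
    intro O' hO'
    induction hO' with
    | proc hP => exact hQ.step hP _ _ _
    | @dist n p C O i hO hP ih =>
      obtain ⟨R, hR⟩ := ih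
      obtain ⟨C₁, C₂, hC⟩ := List.append_of_mem hO
      refine ⟨_, .sdistR (.dist (i := i) (C' := [] ++ R ++ C₁ ++ C₂) ?_)⟩
      rw [hC]
      exact .frame₂ (C₁ := []) hP.chan_eq hR
  | @dist c n p C O i hO hQ ih =>
    intro O' hO'
    obtain ⟨C₁, C₂, hC⟩ := List.append_of_mem hO
    -- The sort selects the decomposition rule when both sides are distributions: `det` descends
    -- into both, `pint` into the client and `pext` into the provider.
    generalize hκ : s.sort = κ at *
    induction hO' with
    | @proc w P hP =>
      obtain ⟨R, hR⟩ := ih (.proc (w := w) hP)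
      refine ⟨_, .sdistL (.dist (i := i) (C' := C₁ ++ R ++ C₂ ++ []) ?_)⟩
      rw [hC]
      exact .frame₂ rfl hR
    | @dist m p' C' O' j hO' hP ih' =>
      obtain ⟨D₁, D₂, hD⟩ := List.append_of_mem hO'
      cases κ with
      | det =>
        obtain ⟨R, hR⟩ := ih hP
        refine ⟨_, .bdistD (.dist (i := finProdFinEquiv (i, j))
          (C' := C₁ ++ R ++ (C₂ ++ D₁) ++ D₂) ?_)⟩
        simp only [Equiv.symm_apply_apply, hC, hD]
        have := CStep.frame₂ (C₁ := C₁) (C₂ := C₂ ++ D₁) (C₃ := D₂) hP.chan_eq hR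
        simpa using this
      | pint =>
        obtain ⟨R, hR⟩ := ih (.dist (p := p') j hO' hP)
        refine ⟨_, .bdistL (.dist (i := i) (C' := C₁ ++ R ++ C₂ ++ []) ?_)⟩
        rw [hC]
        exact .frame₂ rfl hR
      | pext =>
        obtain ⟨R, hR⟩ := ih'
        refine ⟨_, .bdistR (.dist (i := j) (C' := [] ++ R ++ D₁ ++ D₂) ?_)⟩
        rw [hD]
        exact .frame₂ (C₁ := []) hP.chan_eq hR

/-- The framing rule rewrites a single object, so it must be merged with a frame that is already
present or applied to one of the axioms. -/
theorem EStep.cons {C C' : Config} (h : EStep S U C C') (O : Obj) :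
    ∃ C'', EStep S U (O :: C) C'' := by
  cases h with
  | @frame O' R C₁ C₂ h => exact ⟨_, .frame (C₁ := O :: C₁) h⟩
  | spawn h₁ h₂ h₃ => exact ⟨_, .frame (C₁ := [O]) (C₂ := []) (.spawn h₁ h₂ h₃)⟩
  | work => exact ⟨_, .frame (C₁ := [O]) (C₂ := []) .work⟩
  | flip => exact ⟨_, .frame (C₁ := [O]) (C₂ := []) .flip⟩
  | dist h => exact ⟨_, .frame (C₁ := [O]) (C₂ := []) (.dist h)⟩

theorem CStep.cons {κ : CommSort} {C C' : Config} (h : CStep d κ C C') (O : Obj) :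
    ∃ C'', CStep d κ (O :: C) C'' := by
  have pair : ∀ {O₁ O₂ : Obj} {R : Config}, O₂.chan = d → CStep d κ [O₁, O₂] R →
      ∃ C'', CStep d κ [O, O₁, O₂] C'' :=
    fun hd h => ⟨_, .frame₂ (C₁ := [O]) (C₂ := []) (C₃ := []) hd h⟩
  cases h with
  | @frame₁ κ O' R C₁ C₂ h => exact ⟨_, .frame₁ (C₁ := O :: C₁) h⟩
  | @frame₂ κ O₁ O₂ R C₁ C₂ C₃ hd h => exact ⟨_, .frame₂ (C₁ := O :: C₁) hd h⟩
  | dist h => exact ⟨_, .frame₁ (C₁ := [O]) (C₂ := []) (.dist h)⟩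
  | ichoice hk => exact pair rfl (.ichoice hk)
  | echoice hk => exact pair rfl (.echoice hk)
  | tensor => exact pair rfl .tensor
  | lolli => exact pair rfl .lolli
  | one => exact pair rfl .one
  | id h => exact pair rfl (.id h)
  | payPot => exact pair rfl .payPot
  | getPot => exact pair rfl .getPot
  | pichoice hk => exact pair rfl (.pichoice hk)
  | pechoice hk => exact pair rfl (.pechoice hk)
  | sdistR h => exact pair rfl (.sdistR h)
  | sdistL h => exact pair rfl (.sdistL h)
  | bdistD h => exact pair rfl (.bdistD h)
  | bdistR h => exact pair rfl (.bdistR h)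
  | bdistL h => exact pair rfl (.bdistL h)

/-- The last syntax-directed rule decides the case: it acts on the provided channel, on a used
channel, or is a local step. A spawn needs a channel outside `U`, hence the finiteness assumption.
-/
theorem Typed.progress (hS : S.WellFormed) (hU : U.Finite) {Δ : Ctx} {q w : ℚ≥0} {z : Chan}
    {A : Ty} (h : Typed S Δ q P z A) : ServerReady z (S.shape A) P ∨
      (∃ d B, Δ d = some B ∧ ClientReady d (S.shape B) P) ∨ ∃ C, EStep S U [.proc z w P] C := by
  obtain ⟨Δ', q', A', r, h, hΔ, hA, -⟩ := h.inv hS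
  have client : ∀ {d B}, Δ' d = some B → ClientReady d (S.shape B) P →
      ∃ d B, Δ d = some B ∧ ClientReady d (S.shape B) P := by
    intro d B hd hP
    obtain ⟨B', hd', hB⟩ := hΔ.some_left hd
    exact ⟨d, B', hd', hB.shape_eq ▸ hP⟩
  rw [← hA.shape_eq]
  cases h with
  | echoiceR => exact .inl .caseL
  | echoiceL hk hx => exact .inr (.inl (client hx (.sendL hk)))
  | ichoiceR hk hx => exact .inl (.sendL hk)
  | ichoiceL _ hx => exact .inr (.inl (client hx .caseL))
  | tensorR => exact .inl .sendC
  | tensorL F hx => exact .inr (.inl (client hx .recvC))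
  | lolliR => exact .inl .recvC
  | lolliL _ _ hx => exact .inr (.inl (client hx .sendC))
  | oneR => exact .inl .close
  | oneL _ hx => exact .inr (.inl (client hx .wait))
  | id => exact .inl .fwd
  | spawn F h₁ h₂ =>
    obtain ⟨b, hb⟩ := hU.exists_notMem
    exact .inr (.inr ⟨_, .spawn h₁ h₂ hb⟩)
  | payR => exact .inl .pay
  | payL hx => exact .inr (.inl (client hx .get))
  | getR => exact .inl .get
  | getL hx => exact .inr (.inl (client hx .pay))
  | work => exact .inr (.inr ⟨_, .work⟩)
  | flip => exact .inr (.inr ⟨_, .flip⟩)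
  | pichoiceL hx => exact .inr (.inl (client hx .pcase))
  | pichoiceR hk => exact .inl (.psend hk)
  | pechoiceL hk _ _ hx => exact .inr (.inl (client hx (.psend hk)))
  | pechoiceR => exact .inl .pcase

/-- A configuration that is poised, with providers that are ready to communicate. -/
structure Ready (S : Sig) (σ : Chan → St) (C : Config) : Prop where
  poised : C = [] ∨ Poised C
  provider : ∀ x A, σ x = .prov A → ∃ C₁ O C₂, C = C₁ ++ O :: C₂ ∧ ProviderReady x (S.shape A) O

/-- The configuration is ready or makes a step or is blocked at a used channel. -/
def Progress (S : Sig) (U : Set Chan) (σ : Chan → St) (C : Config) : Prop :=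
  Ready S σ C ∨ (∃ C', EStep S U C C') ∨ (∃ d κ C', CStep d κ C C') ∨
    ∃ d A, σ d = .used A ∧ DeepC (fun _ Q => ClientReady d (S.shape A) Q) C

/-- The new situation is a ready tail with a blocked head. Either the channel is still used from
outside and the block persists, or the tail provides it with a ready object and the two communicate.
-/
theorem Progress.cons {σ τ υ : Chan → St} {R : Config} (hO : Progress S U σ [O])
    (hR : Progress S U τ R) (hc : ∀ x, SComp (σ x) (τ x) (υ x)) : Progress S U υ (O :: R) := by
  rcases hR with hR | ⟨C', h⟩ | ⟨d, κ, C', h⟩ | ⟨d, A, hd, h⟩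
  · rcases hO with hO | ⟨C', h⟩ | ⟨d, κ, C', h⟩ | ⟨d, A, hd, h⟩
    · refine .inl ⟨.inr ?_, fun x A hx => ?_⟩
      · have h₁ := hO.poised.resolve_left (by simp)
        rcases hR.poised with rfl | h₂
        · exact h₁
        · exact .compose h₁ h₂
      · have h₁ := hc x
        rw [hx] at h₁
        generalize hσ : σ x = s, hτ : τ x = t at h₁
        cases h₁ with
        | left =>
          obtain ⟨C₁, O', C₂, h, h'⟩ := hO.provider x A hσ
          obtain ⟨rfl, rfl, rfl⟩ : C₁ = [] ∧ O = O' ∧ C₂ = [] := by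
            cases C₁ <;> simp_all
          exact ⟨[], O, R, rfl, h'⟩
        | right =>
          obtain ⟨C₁, O', C₂, rfl, h'⟩ := hR.provider x A hτ
          exact ⟨O :: C₁, O', C₂, rfl, h'⟩
    · exact .inr (.inl ⟨_, .frame (C₁ := []) h⟩)
    · exact .inr (.inr (.inl ⟨d, κ, _, .frame₁ (C₁ := []) h⟩))
    · have h₁ := hc d
      rw [hd] at h₁
      generalize hτ : τ d = t, hυ : υ d = u at h₁
      cases h₁ with
      | left => exact .inr (.inr (.inr ⟨d, A, hυ, deepC_cons.2 (.inl (deepC_singleton.1 h))⟩))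
      | link =>
        obtain ⟨C₁, O', C₂, rfl, h'⟩ := hR.provider d A hτ
        obtain ⟨R, hR⟩ := (deepC_singleton.1 h).step h'
        exact .inr (.inr (.inl ⟨d, _, _, .frame₂ (C₁ := []) h'.chan_eq hR⟩))
  · exact .inr (.inl (h.cons O))
  · exact .inr (.inr (.inl ⟨d, κ, h.cons O⟩))
  · have h₁ := hc d
    rw [hd] at h₁
    generalize hσ : σ d = s, hυ : υ d = u at h₁
    cases h₁ with
    | right => exact .inr (.inr (.inr ⟨d, A, hυ, deepC_cons.2 (.inr h)⟩))

/-- One branch that is not ready passes its step or its block to the object. If all branches are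
ready, any of them supplies the ready provider, because averaging preserves the shape. -/
theorem Progress.dist {σ : Chan → St} {c : Chan} {n : ℕ} {p : FinDist (Fin n)}
    {C : Fin n → Config} {σs : Fin n → Chan → St} (hC : ∀ i, Progress S U (σs i) (C i))
    (hs : ∀ x, DSum S p (fun i => σs i x) (σ x)) (hc : Sole c σ) :
    Progress S U σ [.dist c n p C] := by
  by_cases hC' : ∀ i, Ready S (σs i) (C i)
  · obtain ⟨A, hA⟩ := (hc c).2 rfl
    have h₁ := hs c
    rw [hA] at h₁
    cases h₁ with | prov As h₁ h₂ => ?_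
    have h₃ := fun i => (hC' i).provider c _ (h₁ i)
    refine .inl ⟨.inr (.dist fun i => (hC' i).poised.resolve_left ?_), fun x B hx => ?_⟩
    · obtain ⟨C₁, O, C₂, h, -⟩ := h₃ i
      simp [h]
    · obtain rfl := (hc x).1 ⟨B, hx⟩
      rw [hA] at hx
      cases hx
      obtain ⟨i⟩ := p.nonempty
      obtain ⟨C₁, O, C₂, h, h'⟩ := h₃ i
      refine ⟨[], _, [], rfl, .dist i (O := O) (by simp [h]) ?_⟩
      rwa [← h₂.shape_eq i]
  · push Not at hC'
    obtain ⟨i, hi⟩ := hC'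
    rcases (hC i).resolve_left hi with ⟨C', h⟩ | ⟨d, κ, C', h⟩ | ⟨d, A, hd, h⟩
    · exact .inr (.inl ⟨_, .dist h⟩)
    · exact .inr (.inr (.inl ⟨d, κ, _, .dist h⟩))
    · have h₁ := hs d
      generalize hσ : σ d = t at h₁
      cases h₁ with
      | prov As h₁ => simp [h₁] at hd
      | used As h₁ h₂ =>
        obtain rfl : As i = A := by simpa [h₁] using hd
        exact .inr (.inr (.inr ⟨d, _, hσ, deepC_singleton.2 (deep_dist.2
          ⟨i, by rwa [← h₂.shape_eq i]⟩)⟩))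
      | inner h₁ => simpa [hd, St.Idle] using h₁ i
      | absent h₁ => simp [h₁] at hd

theorem CT.progress (hS : S.WellFormed) (hU : U.Finite) {σ : Chan → St} {q : ℚ≥0} {C : Config}
    (h : CT S σ q C) : Progress S U σ C := by
  induction h with
  | nil h => exact .inl ⟨.inl rfl, fun x A hx => by simpa [hx, St.Idle] using h x⟩
  | @proc Δ A c w P R q q₁ q₂ σ τ υ ht hp hR hc hq ih =>
    refine .cons ?_ ih hc
    rcases ht.progress hS hU (w := w) with h | ⟨d, B, hd, h⟩ | h
    · refine .inl ⟨.inr (h.poised w), fun x B hx => ⟨[], _, [], rfl, ?_⟩⟩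
      have := hp x
      rw [hx] at this
      cases this with | prov hxc => subst hxc; exact .proc h
    · refine .inr (.inr (.inr ⟨d, B, ?_, deepC_singleton.2 (.proc h)⟩))
      have := hp d
      generalize σ d = s at this
      cases this with
      | prov hd' => rw [hd', ht.ctx_self] at hd; cases hd
      | used _ h => rw [h] at hd; cases hd; rfl
      | inner _ h => rw [h] at hd; cases hd
      | absent _ h => rw [h] at hd; cases hd
    · exact .inr (.inl h)
  | dist hC hs hp hR hc hq ihC ihR => exact .cons (.dist ihC hs hp) ihR hc

theorem CTyped.progress (hS : S.WellFormed) {q : ℚ≥0} {C : Config} {Γ : Ctx}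
    (h : CTyped S Ctx.empty q C Γ) : Poised C ∨ ∃ C', Step S C C' := by
  have hct := h.toCT hS
  rcases hct.progress hS hct.finite_occurs with h' | ⟨C', h'⟩ | ⟨d, κ, C', h'⟩ | ⟨d, A, hd, -⟩
  · exact .inl (h'.poised.resolve_left h.ne_nil)
  · exact .inr ⟨C', .inl h'⟩
  · exact .inr ⟨C', .inr ⟨d, κ, h'⟩⟩
  · have := ctxU_mkSt_empty (Γ := Γ) {x | Provides x C}
    rw [← ctxU_eq_some, this] at hd
    cases hd

/-- Progress and preservation define a successor function on the subtype of typed configurations,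
and the run is its orbit. -/
theorem exists_isRun (hS : S.WellFormed) {q : ℚ≥0} {C : Config} {Γ : Ctx}
    (h : CTyped S Ctx.empty q C Γ) : ∃ run : ℕ → Config, IsRun S C run := by
  have next : ∀ X : {C // CTyped S Ctx.empty q C Γ}, ∃ Y : {C // CTyped S Ctx.empty q C Γ},
      Step S X.1 Y.1 ∨ (Poised X.1 ∧ Y.1 = X.1) := by
    rintro ⟨X, hX⟩
    rcases hX.progress hS with hp | ⟨Y, hY⟩
    · exact ⟨⟨X, hX⟩, .inr ⟨hp, rfl⟩⟩
    · exact ⟨⟨Y, hY.preserves hS hX⟩, .inl hY⟩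
  choose f hf using next
  exact ⟨fun n => (f^[n] ⟨C, h⟩).1, rfl, fun n => by
    rw [Function.iterate_succ_apply']; exact hf _⟩

end

/-! ### Laws of parallel compositions -/

/-- The law of the parallel composition of independent non-nested configurations. -/
noncomputable def conv (μ ν : PMF FConf) : PMF FConf := μ.bind fun D₁ => ν.map fun D₂ => D₁ + D₂

section conv

variable {α : Type} (μ ν ξ : PMF FConf) (p : PMF α) (f : α → PMF FConf)

theorem conv_bind_left : conv (p.bind f) ν = p.bind fun i => conv (f i) ν :=
  PMF.bind_bind ..

theorem conv_bind_right : conv μ (p.bind f) = p.bind fun i => conv μ (f i) := by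
  unfold conv
  rw [PMF.bind_comm]
  simp [PMF.map_bind]

theorem conv_pure (D : FConf) : conv (PMF.pure D) ν = ν.map fun D' => D + D' := by
  simp [conv]

theorem conv_comm : conv μ ν = conv ν μ := by
  simp only [conv, ← PMF.bind_pure_comp]
  rw [PMF.bind_comm]
  simp [Function.comp_def, add_comm]

theorem conv_assoc : conv (conv μ ν) ξ = conv μ (conv ν ξ) := by
  simp only [conv, ← PMF.bind_pure_comp, PMF.bind_bind]
  simp [Function.comp_def, add_assoc]

theorem conv_zero : conv μ (PMF.pure 0) = μ := by
  simp only [conv, ← PMF.bind_pure_comp]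
  simp [Function.comp_def]

instance : Std.Commutative conv := ⟨conv_comm⟩

instance : Std.Associative conv := ⟨conv_assoc⟩

end conv

-- The flattened law as a function on configurations.

mutual

/-- The law of the non-nested configurations that correspond to an object. -/
noncomputable def flatO : Obj → PMF FConf
  | .proc c w P => PMF.pure {⟨c, w, P⟩}
  | .dist _ _ p C => p.toPMF.bind fun i => flatC (C i)

/-- The law of the non-nested configurations that correspond to a configuration. -/
noncomputable def flatC : List Obj → PMF FConf
  | [] => PMF.pure 0
  | O :: C => conv (flatO O) (flatC C)

end

theorem flatC_singleton (O : Obj) : flatC [O] = flatO O := by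
  rw [flatC, flatC, conv_zero]

theorem flatC_append (C₁ C₂ : Config) : flatC (C₁ ++ C₂) = conv (flatC C₁) (flatC C₂) := by
  induction C₁ with
  | nil => rw [List.nil_append, flatC, conv_comm, conv_zero]
  | cons O C ih => rw [List.cons_append, flatC, ih, flatC, conv_assoc]

/-- The relation `Flat` has no clause for the empty configuration, to which `flatC` assigns a value.
A typed configuration never involves that clause except as the unit of `conv`. -/
theorem CTyped.flat {S : Sig} {Δ : Ctx} {q : ℚ≥0} {C : Config} {Γ : Ctx} (h : CTyped S Δ q C Γ) :
    Flat C (flatC C) := by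
  induction h with
  | proc => rw [flatC_singleton, flatO]; exact .proc
  | dist _ _ _ _ _ ih => rw [flatC_singleton, flatO]; exact .dist ih
  | compose h₁ h₂ _ _ _ _ _ _ _ _ _ _ _ _ ih₁ ih₂ =>
    rw [flatC_singleton] at ih₁
    rw [flatC]; exact .compose ih₁ ih₂

theorem FinDist.toPMF_apply {ι : Type} [Fintype ι] (p : FinDist ι) (i : ι) :
    p.toPMF i = (((p.w i : ℚ≥0) : ℝ≥0) : ℝ≥0∞) := rfl

theorem FinDist.prod_toPMF {n m : ℕ} (p : FinDist (Fin n)) (p' : FinDist (Fin m)) :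
    (p.prod p').toPMF =
      p.toPMF.bind fun i => p'.toPMF.bind fun j => PMF.pure (finProdFinEquiv (i, j)) := by
  ext k
  obtain ⟨⟨i, j⟩, rfl⟩ := finProdFinEquiv.surjective k
  simp only [PMF.bind_apply, PMF.pure_apply, tsum_fintype, EmbeddingLike.apply_eq_iff_eq,
    Prod.mk.injEq, FinDist.toPMF_apply]
  rw [Finset.sum_eq_single i, Finset.sum_eq_single j]
  · simp only [FinDist.prod, Equiv.symm_apply_apply]; simp
  · intro b _ hb; simp [hb.symm]
  · simp
  · intro b _ hb; simp [hb.symm]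
  · simp

/-- Independent choices may be made jointly or one after the other; decomposition into a product is
invisible after flattening. -/
theorem flatC_prod {n m : ℕ} (p : FinDist (Fin n)) (p' : FinDist (Fin m)) (C : Fin n → Config)
    (C' : Fin m → Config) (c d : Chan) :
    flatC [.dist c (n * m) (p.prod p')
        (fun k => C (finProdFinEquiv.symm k).1 ++ C' (finProdFinEquiv.symm k).2)] =
      flatC [.dist c n p C, .dist d m p' C'] := by
  rw [flatC_singleton, flatC, flatC_singleton]
  simp only [flatO, FinDist.prod_toPMF, PMF.bind_bind, PMF.pure_bind, Equiv.symm_apply_apply,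
    flatC_append, conv_bind_left, conv_bind_right]
  exact PMF.bind_comm ..

theorem flatC_dist_cons (O : Obj) {m : ℕ} (p : FinDist (Fin m)) (C : Fin m → Config) (c d : Chan) :
    flatC [.dist c m p (fun j => O :: C j)] = flatC [O, .dist d m p C] := by
  rw [flatC_singleton, flatC, flatC_singleton]
  simp only [flatO, flatC, conv_bind_right]

theorem flatC_dist_snoc (O : Obj) {n : ℕ} (p : FinDist (Fin n)) (C : Fin n → Config)
    (c : Chan) :
    flatC [.dist c n p (fun i => C i ++ [O])] = flatC [.dist c n p C, O] := by
  rw [flatC_singleton, flatC, flatC_singleton]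
  simp only [flatO, flatC_append, flatC_singleton, conv_bind_left]

/-- A channel that is fresh for the nested configuration is fresh for every outcome of positive
probability, so nested spawns are legitimate non-nested spawns. -/
theorem Flat.occurs {C : Config} {μ : PMF FConf} (h : Flat C μ) :
    ∀ D ∈ μ.support, ∀ b ∈ occ D, Occurs b C := by
  induction h with
  | @proc c w P =>
    intro D hD b hb
    rw [PMF.support_pure, Set.mem_singleton_iff] at hD
    subst hD
    obtain ⟨x, hx, hb⟩ := hb
    rw [Multiset.mem_singleton] at hx
    subst hx
    exact occurs_proc.2 hb
  | dist _ ih =>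
    intro D hD b hb
    obtain ⟨i, -, hi⟩ := (PMF.mem_support_bind_iff _ _ _).1 hD
    exact .inner i (ih i D hi b hb)
  | compose _ _ ih₁ ih₂ =>
    intro D hD b hb
    obtain ⟨D₁, h₁, hD⟩ := (PMF.mem_support_bind_iff _ _ _).1 hD
    obtain ⟨D₂, h₂, rfl⟩ := (PMF.mem_support_map_iff _ _ _).1 hD
    obtain ⟨x, hx, hb⟩ := hb
    rcases Multiset.mem_add.1 hx with hx | hx
    · exact occurs_cons.2 (.inl (ih₁ D₁ h₁ b ⟨x, hx, hb⟩))
    · exact .tail (ih₂ D₂ h₂ b ⟨x, hx, hb⟩)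

/-! ### Simulation by the non-nested semantics -/

/-- `D` steps to `ξ` in every context such that all channels are in `U`. -/
def StepsIn (S : Sig) (U : Set Chan) (D : FConf) (ξ : PMF FConf) : Prop :=
  ∀ F, occ (D + F) ⊆ U → ProbStep S (D + F) (ξ.map fun D' => D' + F)

/-- `μ'` is obtained from `μ` by steps of some of the configurations. -/
def Reach (S : Sig) (U : Set Chan) (μ μ' : PMF FConf) : Prop :=
  ∃ J : PMF (FConf × PMF FConf), J.map Prod.fst = μ ∧ J.bind Prod.snd = μ' ∧
    ∀ y ∈ J.support, y.2 = PMF.pure y.1 ∨ StepsIn S U y.1 y.2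

section

variable {S : Sig} {U : Set Chan} {μ μ' : PMF FConf}

theorem Reach.refl (μ : PMF FConf) : Reach S U μ μ := by
  refine ⟨μ.map fun D => (D, PMF.pure D), ?_, ?_, ?_⟩
  · rw [PMF.map_comp]; exact PMF.map_id _
  · rw [PMF.bind_map]; exact PMF.bind_pure _
  · intro y hy
    obtain ⟨D, -, rfl⟩ := (PMF.mem_support_map_iff _ _ _).1 hy
    exact .inl rfl

theorem Reach.of_step {D : FConf} {ξ : PMF FConf} (h : StepsIn S U D ξ) :
    Reach S U (PMF.pure D) ξ := by
  refine ⟨PMF.pure (D, ξ), PMF.pure_map _ _, PMF.pure_bind _ _, ?_⟩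
  intro y hy
  rw [PMF.support_pure, Set.mem_singleton_iff] at hy
  subst hy
  exact .inr h

theorem Reach.bind {α : Type} (p : PMF α) {f f' : α → PMF FConf}
    (h : ∀ i, Reach S U (f i) (f' i)) : Reach S U (p.bind f) (p.bind f') := by
  choose J h₁ h₂ h₃ using h
  refine ⟨p.bind J, ?_, ?_, ?_⟩
  · simp [PMF.map_bind, h₁]
  · simp [PMF.bind_bind, h₂]
  · intro y hy
    obtain ⟨i, -, hi⟩ := (PMF.mem_support_bind_iff _ _ _).1 hy
    exact h₃ i y hi

/-- Steps are required in every surrounding context exactly so that an independent outcome `F` of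
`ν` can be added to the part that is not rewritten. -/
theorem Reach.conv (h : Reach S U μ μ') (ν : PMF FConf) :
    Reach S U (conv μ ν) (conv μ' ν) := by
  obtain ⟨J, rfl, rfl, h⟩ := h
  refine ⟨J.bind fun y => ν.map fun F => (y.1 + F, y.2.map fun D => D + F), ?_, ?_, ?_⟩
  · simp only [PMF.map_bind, PMF.map_comp, PRast.conv, PMF.bind_map]
    rfl
  · simp only [PRast.conv, PMF.bind_bind, PMF.bind_map]
    congr 1
    funext y
    simp only [Function.comp_def, ← PMF.bind_pure_comp]
    rw [PMF.bind_comm]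
  · intro y hy
    obtain ⟨z, hz, hy⟩ := (PMF.mem_support_bind_iff _ _ _).1 hy
    obtain ⟨F, -, rfl⟩ := (PMF.mem_support_map_iff _ _ _).1 hy
    rcases h z hz with h | h
    · exact .inl (by simp [h, PMF.pure_map])
    · refine .inr fun F' hF' => ?_
      have := h (F + F') (by rwa [← add_assoc])
      simpa [PMF.map_comp, Function.comp_def, add_assoc] using this

theorem reach_dist_update {c : Chan} {n : ℕ} {p : FinDist (Fin n)} {C : Fin n → Config} {i : Fin n}
    {C' : Config} (h : Reach S U (flatC (C i)) (flatC C')) :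
    Reach S U (flatC [.dist c n p C]) (flatC [.dist c n p (Function.update C i C')]) := by
  rw [flatC_singleton, flatC_singleton, flatO, flatO]
  refine .bind _ fun j => ?_
  by_cases hj : j = i
  · subst hj; simpa using h
  · simpa [hj] using .refl _

theorem flatC_frame (C₁ : Config) (R : Config) (C₂ : Config) :
    flatC (C₁ ++ R ++ C₂) = conv (flatC R) (conv (flatC C₁) (flatC C₂)) := by
  rw [flatC_append, flatC_append]; ac_rfl

theorem flatC_pair (c d : Chan) (w w' : ℚ≥0) (P P' : Proc) :
    flatC [.proc c w P, .proc d w' P'] = PMF.pure (⟨d, w', P'⟩ ::ₘ {⟨c, w, P⟩}) := by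
  rw [flatC, flatC_singleton, flatO, flatO, conv_pure, PMF.pure_map, add_comm]
  rfl

theorem flatC_proc (c : Chan) (w : ℚ≥0) (P : Proc) :
    flatC [.proc c w P] = PMF.pure {⟨c, w, P⟩} := by
  rw [flatC_singleton, flatO]

theorem Reach.of_detStep {D D' : FConf}
    (h : ∀ F, occ (D + F) ⊆ U → DetStep S (D + F) (D' + F)) :
    Reach S U (PMF.pure D) (PMF.pure D') :=
  .of_step fun F hF => by rw [PMF.pure_map]; exact .det (h F hF)

theorem reach_pair {c d : Chan} {w w' v v' : ℚ≥0} {P P' Q Q' : Proc}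
    (h : ∀ F, DetStep S (⟨d, w', P'⟩ ::ₘ ⟨c, w, P⟩ ::ₘ F) (⟨d, v', Q'⟩ ::ₘ ⟨c, v, Q⟩ ::ₘ F)) :
    Reach S U (flatC [.proc c w P, .proc d w' P']) (flatC [.proc c v Q, .proc d v' Q']) := by
  rw [flatC_pair, flatC_pair]
  refine .of_detStep fun F _ => ?_
  simpa only [Multiset.cons_add, Multiset.singleton_add] using h F

/-- The base rules are single non-nested steps, and the decomposition rules leave the law unchanged.
A step in one branch moves only the outcomes of that branch, while the other outcomes rest. -/
theorem CStep.reach {d : Chan} {κ : CommSort} {C C' : Config} (h : CStep d κ C C') :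
    Reach S U (flatC C) (flatC C') := by
  induction h with
  | ichoice hk => exact reach_pair fun _ => .ichoice hk
  | echoice hk => exact reach_pair fun _ => .echoice hk
  | tensor => exact reach_pair fun _ => .tensor
  | lolli => exact reach_pair fun _ => .lolli
  | payPot => exact reach_pair fun _ => .payPot
  | getPot => exact reach_pair fun _ => .getPot
  | pichoice hk => exact reach_pair fun _ => .pichoice hk
  | pechoice hk => exact reach_pair fun _ => .pechoice hk
  | @one c wc wd Q =>
    rw [flatC_pair, flatC_proc, add_comm wc wd]
    refine .of_detStep fun F _ => ?_
    simpa only [Multiset.cons_add, Multiset.singleton_add] using .one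
  | @id κ c wc wd e Q hQ =>
    rw [flatC_pair, flatC_proc, add_comm wc wd]
    have hd : d ∈ Q.chans := by cases hQ <;> simp [Proc.chans, Name.chans]
    refine .of_detStep fun F _ => ?_
    simpa only [Multiset.cons_add, Multiset.singleton_add] using .id hd
  | dist _ ih => exact reach_dist_update ih
  | @sdistR _ _ _ _ _ _ _ _ _ ih => rwa [flatC_dist_cons] at ih
  | @sdistL _ _ _ _ _ _ _ _ _ ih => rwa [flatC_dist_snoc] at ih
  | @bdistD _ _ _ _ _ _ _ _ _ ih => rwa [flatC_prod] at ih
  | @bdistR _ _ _ _ _ _ _ _ _ ih => rwa [flatC_dist_cons] at ih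
  | @bdistL _ _ _ _ _ _ _ _ _ ih => rwa [flatC_dist_snoc] at ih
  | @frame₁ κ O R C₁ C₂ _ ih =>
    have : C₁ ++ O :: C₂ = C₁ ++ [O] ++ C₂ := by simp
    rw [this, flatC_frame, flatC_frame]
    exact ih.conv _
  | @frame₂ κ O O' R C₁ C₂ C₃ _ _ ih =>
    have h₁ : flatC (C₁ ++ O :: C₂ ++ O' :: C₃) =
        PRast.conv (flatC [O, O']) (PRast.conv (flatC C₁) (flatC (C₂ ++ C₃))) := by
      rw [flatC, flatC_singleton]
      simp only [flatC_append, flatC]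
      ac_rfl
    rw [h₁, List.append_assoc (C₁ ++ R), flatC_frame]
    exact ih.conv _

theorem EStep.reach {C C' : Config} (h : EStep S U C C') :
    Reach S U (flatC C) (flatC C') := by
  induction h with
  | @spawn c w f Q b D ds hD hl hb =>
    rw [flatC_pair, flatC_proc]
    refine .of_detStep fun F hF => ?_
    simp only [Multiset.cons_add, Multiset.singleton_add] at hF ⊢
    exact .spawn hD hl fun h => hb (hF h)
  | work =>
    rw [flatC_proc, flatC_proc]
    refine .of_detStep fun F hF => ?_
    simpa only [Multiset.cons_add, Multiset.singleton_add] using .work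
  | @flip c w p hp PH PT =>
    rw [flatC_proc, flatC_singleton, flatO]
    refine .of_step fun F _ => ?_
    convert ProbStep.flip (S := S) (F := F) (c := c) (w := w) (hp := hp) (PH := PH) (PT := PT) using 1
    · rfl
    rw [PMF.map_bind, ← PMF.bind_pure_comp]
    congr 1
    funext i
    fin_cases i <;> simp [flatC_proc, PMF.pure_map]
  | dist _ ih => exact reach_dist_update ih
  | @frame O R C₁ C₂ _ ih =>
    have : C₁ ++ O :: C₂ = C₁ ++ [O] ++ C₂ := by simp
    rw [this, flatC_frame, flatC_frame]
    exact ih.conv _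

end

/-! ### Transition laws -/

/-- `m x` is the conditional law of `J` given that its first coordinate is `x`. The value `none`
marks the points of probability zero, where `g` may be chosen freely. -/
theorem exists_disintegration {α β : Type} (J : PMF (α × β)) :
    ∃ m : α → Option (PMF (α × β)),
      (∀ x ν, m x = some ν → ∀ y ∈ ν.support, y ∈ J.support ∧ y.1 = x) ∧
      ∀ (γ : Type) (f : α × β → PMF γ) (g : α → PMF γ),
        (J.map Prod.fst).bind (fun x => (m x).elim (g x) fun ν => ν.bind f) = J.bind f := by
  classical
  refine ⟨fun x => if h : ∃ y ∈ {y : α × β | y.1 = x}, y ∈ J.support then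
    some (J.filter {y | y.1 = x} h) else none, ?_, ?_⟩
  · intro x ν hν y hy
    beta_reduce at hν
    split_ifs at hν
    · cases hν
      rw [PMF.mem_support_filter_iff] at hy
      exact ⟨hy.2, hy.1⟩
  · intro γ f g
    ext z
    -- The marginal mass of `x` is the normalizing constant of the conditional law.
    have hx : ∀ x, (J.map Prod.fst) x = ∑' y, Set.indicator {y : α × β | y.1 = x} J y := by
      intro x
      rw [PMF.map_apply]
      refine tsum_congr fun y => ?_
      by_cases h : y.1 = x
      · simp [h]
      · simp [h, Ne.symm h]
    have key : ∀ x, (J.map Prod.fst) x * ((if h : ∃ y ∈ {y : α × β | y.1 = x}, y ∈ J.support then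
        some (J.filter {y | y.1 = x} h) else none : Option (PMF (α × β))).elim (g x)
          fun ν => ν.bind f) z = ∑' y, Set.indicator {y : α × β | y.1 = x} J y * f y z := by
      intro x
      by_cases h : ∃ y ∈ {y : α × β | y.1 = x}, y ∈ J.support
      · have h₀ : (J.map Prod.fst) x ≠ 0 := by
          obtain ⟨y, hy, hy'⟩ := h
          rw [← PMF.mem_support_iff, PMF.mem_support_map_iff]
          exact ⟨y, hy', hy⟩
        rw [dif_pos h, Option.elim_some, PMF.bind_apply, ← ENNReal.tsum_mul_left]
        refine tsum_congr fun y => ?_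
        rw [PMF.filter_apply, ← hx, ← mul_assoc, mul_comm _ (_ * _), mul_assoc (Set.indicator _ _ _),
          ENNReal.inv_mul_cancel h₀ (PMF.apply_ne_top _ _), mul_one]
      · have h₀ : ∀ y, Set.indicator {y : α × β | y.1 = x} J y = 0 := by
          intro y
          push Not at h
          rw [Set.indicator_apply_eq_zero]
          exact fun hy => (PMF.apply_eq_zero_iff _ _).2 (h y hy)
        rw [hx]
        simp [h₀]
    rw [PMF.bind_apply, PMF.bind_apply]
    simp only [key]
    rw [ENNReal.tsum_comm]
    refine tsum_congr fun y => ?_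
    rw [ENNReal.tsum_mul_right, tsum_eq_single y.1]
    · simp
    · intro x hx
      have : y ∉ {y : α × β | y.1 = x} := fun h => hx (Eq.symm h)
      simp [this]

section

variable {S : Sig} {U : Set Chan} {μ μ' : PMF FConf}

theorem Scheduled.pure (D : FConf) : Scheduled S D (PMF.pure D) :=
  ⟨PMF.pure (PMF.pure D), by simp, by simp⟩

/-- One outcome may arise from several branches that behave differently, so its successor law is a
conditional mixture of rests and steps. Outcomes of probability zero rest. -/
theorem Reach.exists_kernel (h : Reach S U μ μ') (hμ : ∀ D ∈ μ.support, occ D ⊆ U) :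
    ∃ K : FConf → PMF FConf, (∀ x, Scheduled S x (K x)) ∧ μ.bind K = μ' := by
  obtain ⟨J, rfl, rfl, hJ⟩ := h
  obtain ⟨m, hm, hm'⟩ := exists_disintegration J
  refine ⟨fun x => (m x).elim (PMF.pure x) fun ν => ν.bind Prod.snd, fun x => ?_, hm' _ _ _⟩
  beta_reduce
  cases hx : m x with
  | none => exact .pure x
  | some ν =>
    rw [Option.elim_some]
    refine ⟨ν.map Prod.snd, fun ξ hξ => ?_, by simp [PMF.bind_map]⟩
    obtain ⟨y, hy, rfl⟩ := (PMF.mem_support_map_iff _ _ _).1 hξ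
    obtain ⟨hy, rfl⟩ := hm x ν hx y hy
    refine (hJ y hy).imp_right fun h => ?_
    -- The outcome is now the complete configuration, so the context is empty.
    have := h 0 (by
      rw [add_zero]
      exact hμ _ ((PMF.mem_support_map_iff _ _ _).2 ⟨y, hy, rfl⟩))
    simpa only [add_zero, show (fun D : FConf => D) = id from rfl, PMF.map_id] using this

theorem Step.exists_kernel {q : ℚ≥0} {C C' : Config} {Γ : Ctx} (h : Step S C C')
    (hC : CTyped S Ctx.empty q C Γ) :
    ∃ K : FConf → PMF FConf, (∀ x, Scheduled S x (K x)) ∧ (flatC C).bind K = flatC C' := by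
  have hμ : ∀ D ∈ (flatC C).support, occ D ⊆ {b | Occurs b C} := hC.flat.occurs
  rcases h with h | ⟨d, κ, h⟩
  · exact h.reach.exists_kernel hμ
  · exact h.reach.exists_kernel hμ

/-! ### Expected work -/

/-- The expected work of a random non-nested configuration. -/
noncomputable def meanWork (μ : PMF FConf) : ℝ≥0∞ := ∑' D, μ D * workE D

theorem meanWork_pure (D : FConf) : meanWork (PMF.pure D) = workE D := by
  rw [meanWork, tsum_eq_single D]
  · simp
  · intro D' h; simp [PMF.pure_apply, h]

theorem meanWork_bind {α : Type} (p : PMF α) (f : α → PMF FConf) :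
    meanWork (p.bind f) = ∑' i, p i * meanWork (f i) := by
  simp only [meanWork, PMF.bind_apply, ← ENNReal.tsum_mul_right, ← ENNReal.tsum_mul_left]
  rw [ENNReal.tsum_comm]
  simp only [mul_assoc]

theorem workE_add (D D' : FConf) : workE (D + D') = workE D + workE D' := by
  simp [workE, work]

theorem meanWork_conv (μ ν : PMF FConf) : meanWork (conv μ ν) = meanWork μ + meanWork ν := by
  have h : ∀ D, meanWork (ν.map fun D' => D + D') = workE D + meanWork ν := by
    intro D
    rw [← PMF.bind_pure_comp, meanWork_bind]
    simp only [Function.comp_apply, meanWork_pure, workE_add, mul_add]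
    rw [ENNReal.tsum_add, ENNReal.tsum_mul_right, PMF.tsum_coe, one_mul]
    rfl
  rw [conv, meanWork_bind]
  simp only [h, mul_add]
  rw [ENNReal.tsum_add, ENNReal.tsum_mul_right, PMF.tsum_coe, one_mul]
  rfl

/-- For a process, `q = q' + w` is at least the recorded work; averages and sums of potential then
match those of expected work. -/
theorem CTyped.meanWork_le {Δ : Ctx} {q : ℚ≥0} {C : Config} {Γ : Ctx} (h : CTyped S Δ q C Γ) :
    meanWork (flatC C) ≤ ((q : ℝ≥0) : ℝ≥0∞) := by
  induction h with
  | @proc Δ q q' w c P A Γ _ hq =>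
    rw [flatC_proc, meanWork_pure, workE, ENNReal.coe_le_coe, hq]
    simp [work]
  | @dist Δ q c n p C A Γ Δs qs As _ _ _ hq _ ih =>
    rw [flatC_singleton, flatO, meanWork_bind, tsum_fintype, hq]
    push_cast
    refine Finset.sum_le_sum fun i _ => ?_
    rw [FinDist.toPMF_apply]
    exact mul_le_mul_right (ih i) _
  | compose h₁ h₂ _ _ _ _ _ _ _ _ hq _ _ _ ih₁ ih₂ =>
    rw [flatC_singleton] at ih₁
    rw [flatC, meanWork_conv, hq]
    push_cast
    exact add_le_add ih₁ ih₂

/-- Closing and forwarding hand the recorded work to the client, spawned processes start with none,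
and only `work` changes the total. -/
theorem DetStep.work_mono {D D' : FConf} (h : DetStep S D D') :
    PRast.work D ≤ PRast.work D' := by
  cases h <;> simp [PRast.work, add_assoc]

theorem meanWork_map_le {α : Type} {x : ℝ≥0∞} (p : PMF α) (f : α → FConf)
    (h : ∀ i, x ≤ workE (f i)) : x ≤ meanWork (p.map f) := by
  rw [← PMF.bind_pure_comp, meanWork_bind]
  calc x = ∑' i, p i * x := by rw [ENNReal.tsum_mul_right, PMF.tsum_coe, one_mul]
    _ ≤ _ := by
      refine ENNReal.tsum_le_tsum fun i => ?_
      rw [Function.comp_apply, meanWork_pure]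
      gcongr
      exact h i

theorem ProbStep.workE_le {D : FConf} {ξ : PMF FConf} (h : ProbStep S D ξ) :
    workE D ≤ meanWork ξ := by
  cases h with
  | det h =>
    rw [meanWork_pure, workE, workE, ENNReal.coe_le_coe]
    exact_mod_cast h.work_mono
  | flip =>
    refine meanWork_map_le _ _ fun i => ?_
    fin_cases i <;> simp [workE, work]

theorem Scheduled.workE_le {D : FConf} {ν : PMF FConf} (h : Scheduled S D ν) :
    workE D ≤ meanWork ν := by
  obtain ⟨m, hm, rfl⟩ := h
  rw [meanWork_bind]
  calc workE D = ∑' ξ, m ξ * workE D := by rw [ENNReal.tsum_mul_right, PMF.tsum_coe, one_mul]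
    _ ≤ _ := by
      refine ENNReal.tsum_le_tsum fun ξ => ?_
      by_cases hξ : ξ ∈ m.support
      · gcongr
        rcases hm ξ hξ with rfl | h
        · rw [id, meanWork_pure]
        · exact h.workE_le
      · rw [(PMF.apply_eq_zero_iff _ _).2 hξ, zero_mul]
        exact zero_le

theorem meanWork_le_bind {K : FConf → PMF FConf} (hK : ∀ x, Scheduled S x (K x)) :
    meanWork μ ≤ meanWork (μ.bind K) := by
  rw [meanWork_bind]
  exact ENNReal.tsum_le_tsum fun D => by gcongr; exact (hK D).workE_le

end

/-! ### Markov chains with given transition laws -/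

open MeasureTheory ProbabilityTheory Finset

/-- All sets are measurable, so the measure of a mass function is a sum of weighted point masses. -/
theorem lintegral_toMeasure (p : PMF FConf) (f : FConf → ℝ≥0∞) :
    ∫⁻ x, f x ∂p.toMeasure = ∑' x, p x * f x := by
  have : p.toMeasure = Measure.sum fun x => p x • Measure.dirac x := by
    ext s hs
    rw [Measure.sum_apply _ hs, PMF.toMeasure_apply _ hs]
    refine tsum_congr fun x => ?_
    by_cases hx : x ∈ s <;> simp [hx]
  rw [this, lintegral_sum_measure]
  simp [lintegral_dirac' _ (measurable_from_top)]

/-- The history of a trajectory up to time `n`. -/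
abbrev history (n : ℕ) : (ℕ → FConf) → (Π _ : Iic n, FConf) :=
  Preorder.frestrictLe (π := fun _ => FConf) n

/-- Transition laws as kernels on histories. -/
noncomputable def historyKernel (K : ℕ → FConf → PMF FConf) (n : ℕ) :
    Kernel (Π _ : Iic n, FConf) FConf where
  toFun y := (K n (y ⟨n, mem_Iic.2 le_rfl⟩)).toMeasure
  measurable' := (measurable_from_top (f := fun x => (K n x).toMeasure)).comp
    (measurable_pi_apply _)

instance (K : ℕ → FConf → PMF FConf) (n : ℕ) : IsMarkovKernel (historyKernel K n) :=
  ⟨fun _ => PMF.toMeasure.isProbabilityMeasure _⟩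

/-- The law of the trajectories that start at `0` and have the given transition laws. -/
noncomputable def pathLaw (K : ℕ → FConf → PMF FConf) : Measure (ℕ → FConf) :=
  Kernel.traj (historyKernel K) 0 fun _ => 0

section

variable (K : ℕ → FConf → PMF FConf)

instance : IsProbabilityMeasure (pathLaw K) := by unfold pathLaw; infer_instance

/-- The joint law of the history and the next state is the law of the history composed with the
kernel, and that kernel depends only on the last state of the history. -/
theorem pathLaw_prod (n : ℕ) {A : Set (Π _ : Iic n, FConf)} (hA : MeasurableSet A)
    (B : Set FConf) :
    pathLaw K {ω | history n ω ∈ A ∧ ω (n + 1) ∈ B} =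
      ∫⁻ ω in {ω | history n ω ∈ A}, (K n (ω n)).toMeasure B ∂pathLaw K := by
  have h := Kernel.partialTraj_compProd_eq_map_traj (X := fun _ => FConf) (κ := historyKernel K) (Nat.zero_le n)
    (x₀ := fun _ => 0)
  have hB : MeasurableSet B := trivial
  have h₁ : Measurable fun ω : ℕ → FConf => (history n ω, ω (n + 1)) := by fun_prop
  have h₂ : {ω : ℕ → FConf | history n ω ∈ A ∧ ω (n + 1) ∈ B} =
      (fun ω : ℕ → FConf => (history n ω, ω (n + 1))) ⁻¹' (A ×ˢ B) := rfl
  rw [h₂, ← Measure.map_apply h₁ (hA.prod hB), pathLaw, ← h, Measure.compProd_apply_prod hA hB,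
    ← Kernel.traj_map_frestrictLe_apply, setLIntegral_map hA]
  · rfl
  · exact (historyKernel K n).measurable_coe hB
  · fun_prop

theorem pathLaw_map_succ (n : ℕ) {μ : PMF FConf}
    (h : (pathLaw K).map (fun ω => ω n) = μ.toMeasure) :
    (pathLaw K).map (fun ω => ω (n + 1)) = (μ.bind (K n)).toMeasure := by
  ext s hs
  rw [Measure.map_apply (by fun_prop) hs, PMF.toMeasure_bind_apply _ _ _ hs, ← lintegral_toMeasure,
    ← h, lintegral_map measurable_from_top (by fun_prop)]
  have := pathLaw_prod K n MeasurableSet.univ s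
  simp only [Set.mem_univ, true_and, Set.ofPred_true, Measure.restrict_univ] at this
  exact this

/-- Coordinate zero is a deterministic dummy state, the empty multiset. -/
theorem pathLaw_map_zero : (pathLaw K).map (fun ω => ω 0) = (PMF.pure 0).toMeasure := by
  have h := Kernel.traj_map_frestrictLe_apply (X := fun _ => FConf) (κ := historyKernel K) 0 0 fun _ => 0
  rw [Kernel.partialTraj_self, Kernel.id_apply] at h
  have h' := congrArg (Measure.map fun y => y ⟨0, mem_Iic.2 le_rfl⟩) h
  rw [Measure.map_map (by fun_prop) (by fun_prop), Measure.map_dirac' (by fun_prop)] at h'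
  rw [PMF.toMeasure_pure]
  exact h'

/-- Coordinates and kernels are shifted by one because of the dummy initial state. On the event that
the history is prescribed, the transition probability is constant and leaves the integral. -/
theorem pathLaw_step (n : ℕ) (x : ℕ → FConf) :
    pathLaw K {ω | ∀ i ≤ n + 1, ω (i + 1) = x i} =
      pathLaw K {ω | ∀ i ≤ n, ω (i + 1) = x i} * K (n + 1) (x n) (x (n + 1)) := by
  have hm : ∀ D : FConf, MeasurableSet {D} := fun _ => trivial
  set A : Set (Π _ : Iic (n + 1), FConf) :=
    {y | ∀ i (hi : i ≤ n), y ⟨i + 1, mem_Iic.2 (Nat.succ_le_succ hi)⟩ = x i} with hA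
  have hA' : MeasurableSet A := by
    have : A = ⋂ i, ⋂ hi : i ≤ n,
        (fun y => y ⟨i + 1, mem_Iic.2 (Nat.succ_le_succ hi)⟩) ⁻¹' {x i} := by
      ext y; simp [hA]
    rw [this]
    exact .iInter fun i => .iInter fun hi => measurable_pi_apply _ (hm _)
  have h₁ : {ω : ℕ → FConf | ∀ i ≤ n + 1, ω (i + 1) = x i} =
      {ω | history (n + 1) ω ∈ A ∧ ω (n + 1 + 1) ∈ ({x (n + 1)} : Set FConf)} := by
    ext ω
    simp only [hA, Set.mem_ofPred_eq, history, Preorder.frestrictLe_apply, Set.mem_singleton_iff]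
    constructor
    · exact fun h => ⟨fun i hi => h i (hi.trans n.le_succ), h _ le_rfl⟩
    · rintro ⟨h, h'⟩ i hi
      rcases Nat.le_succ_iff.1 hi with hi | rfl
      · exact h i hi
      · exact h'
  have h₂ : {ω : ℕ → FConf | ∀ i ≤ n, ω (i + 1) = x i} =
      {ω | history (n + 1) ω ∈ A} := rfl
  rw [h₁, pathLaw_prod K _ hA', h₂]
  have h₃ : ∀ ω ∈ {ω : ℕ → FConf | history (n + 1) ω ∈ A},
      (K (n + 1) (ω (n + 1))).toMeasure {x (n + 1)} = K (n + 1) (x n) (x (n + 1)) := by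
    intro ω hω
    rw [show ω (n + 1) = x n from hω n le_rfl, PMF.toMeasure_apply_singleton _ _ (hm _)]
  have h₄ : MeasurableSet {ω : ℕ → FConf | history (n + 1) ω ∈ A} :=
    Preorder.measurable_frestrictLe (X := fun _ => FConf) _ hA'
  rw [setLIntegral_congr_fun h₄ h₃, setLIntegral_const, mul_comm]

end

end PRast

-- Assembly of the chain and the limit of expected work.

theorem mainTheorem3 (S : PRast.Sig) (hS : S.WellFormed) (q : ℚ≥0) (C : PRast.Config)
    (Γ : PRast.Ctx) (hC : PRast.CTyped S PRast.Ctx.empty q C Γ) :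
    (∃ run : ℕ → PRast.Config, PRast.IsRun S C run) ∧
    ∀ run : ℕ → PRast.Config, PRast.IsRun S C run →
      ∃ (Ω : Type) (_ : MeasurableSpace Ω) (Pr : MeasureTheory.Measure Ω)
        (D : ℕ → Ω → PRast.FConf) (K : ℕ → PRast.FConf → PMF PRast.FConf),
        MeasureTheory.IsProbabilityMeasure Pr ∧
        PRast.IsMarkovChain Pr D K ∧
        (∀ n x, PRast.Scheduled S x (K n x)) ∧
        (∀ n, PRast.CTyped S PRast.Ctx.empty q (run n) Γ ∧
          ∃ μ : PMF PRast.FConf, PRast.Flat (run n) μ ∧ Pr.map (D n) = μ.toMeasure) ∧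
        (∀ n, ∫⁻ ω, PRast.workE (D n ω) ∂Pr ≤ ((q : ℝ≥0) : ℝ≥0∞)) ∧
        ∃ etw : ℝ≥0∞,
          Filter.Tendsto (fun n => ∫⁻ ω, PRast.workE (D n ω) ∂Pr) Filter.atTop (nhds etw) ∧
          etw ≤ ((q : ℝ≥0) : ℝ≥0∞) := by
  refine ⟨PRast.exists_isRun hS hC, fun run hrun => ?_⟩
  have htyped := hrun.typed hS hC
  have hK : ∀ n, ∃ K : PRast.FConf → PMF PRast.FConf, (∀ x, PRast.Scheduled S x (K x)) ∧
      (PRast.flatC (run n)).bind K = PRast.flatC (run (n + 1)) := by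
    intro n
    rcases hrun.succ n with h | ⟨-, h⟩
    · exact h.exists_kernel (htyped n)
    -- A poised configuration is repeated, so the chain rests.
    · exact ⟨PMF.pure, .pure, by rw [PMF.bind_pure, h]⟩
  choose K hK hK' using hK
  -- time is shifted by one, and the first transition draws the initial configuration
  let L : ℕ → PRast.FConf → PMF PRast.FConf
    | 0 => fun _ => PRast.flatC (run 0)
    | n + 1 => K n
  have hlaw : ∀ n, (PRast.pathLaw L).map (fun ω => ω (n + 1)) = (PRast.flatC (run n)).toMeasure := by
    intro n
    induction n with
    | zero => simpa [L] using PRast.pathLaw_map_succ L 0 (PRast.pathLaw_map_zero L)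
    | succ n ih => rw [PRast.pathLaw_map_succ L (n + 1) ih, hK']
  have hwork : ∀ n, ∫⁻ ω, PRast.workE (ω (n + 1)) ∂PRast.pathLaw L =
      PRast.meanWork (PRast.flatC (run n)) := by
    intro n
    rw [PRast.meanWork, ← PRast.lintegral_toMeasure, ← hlaw,
      MeasureTheory.lintegral_map measurable_from_top (by fun_prop)]
  have hle : ∀ n, PRast.meanWork (PRast.flatC (run n)) ≤ ((q : ℝ≥0) : ℝ≥0∞) :=
    fun n => (htyped n).meanWork_le
  refine ⟨ℕ → PRast.FConf, inferInstance, PRast.pathLaw L, fun n ω => ω (n + 1), K, inferInstance,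
    ⟨fun n => by fun_prop, fun n x => PRast.pathLaw_step L n x⟩, hK,
    fun n => ⟨htyped n, _, (htyped n).flat, hlaw n⟩, fun n => by rw [hwork]; exact hle n,
    -- Expected work is nondecreasing along the chain, so its limit is the supremum and inherits the
    -- bound.
    ⨆ n, PRast.meanWork (PRast.flatC (run n)), ?_, iSup_le hle⟩
  simp only [hwork]
  exact tendsto_atTop_iSup (monotone_nat_of_le_succ fun n => by
    rw [← hK' n]; exact PRast.meanWork_le_bind (hK n))
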